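/- Let $n\ge 1$ and let $\mathcal{NP}_n$ be the set of noncrossing partitions of $[n]$. A (circular planar) electrical network $\Gamma$ is a finite graph with positive real edge weights, embedded in a closed disk, with boundary vertices $\bar 1,\dots,\bar n$ in clockwise order on the boundary circle and everything else in the open disk. A grove of $\Gamma$ is a spanning forest in which every component contains a boundary vertex. For $\sigma\in\mathcal{NP}_n$ let $L_\sigma(\Gamma)$ be the sum, over the groves $F$ for which two boundary vertices are connected in $F$ exactly if they are in the same part of $\sigma$, of the product of the weights of the edges of $F$. Let $\mathfrak I_n\subset\mathbb C[L_\sigma\mid\sigma\in\mathcal{NP}_n]$ be the ideal of polynomials that vanish on all electrical networks, and let $G_n=\mathbb C[L_\sigma]/\mathfrak I_n$ be the grove algebra, with $\deg L_\sigma=1$. Let $R(n-1,2n)$ be the Plücker ring, i.e. the homogeneous coordinate ring of the Grassmannian $\mathrm{Gr}(n-1,2n)$ of $(n-1)$-dimensional subspaces of $\mathbb C^{2n}$ in its Plücker embedding, with the Plücker coordinates $\Delta_I$, $I\in\binom{[2n]}{n-1}$, as generators of degree $1$. For $\sigma\in\mathcal{NP}_n$ put $\bar i$ at the place $2i-1$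 and a dual vertex $\tilde i$ at the place $2i$ of $2n$ points on a circle, and let $\tilde\sigma$ be the dual partition: $\tilde i,\tilde j$ are in the same part of $\tilde\sigma$ if and only if no part of $\sigma$ has elements on both sides of the chord $\tilde i\tilde j$. For $I\in\binom{[2n]}{n-1}$ let $\mathcal E(I)$ be the set of all $\sigma\in\mathcal{NP}_n$ such that each part of $\sigma$ and each part of $\tilde\sigma$ (both viewed as subsets of $[2n]$) contains exactly one element that is not in $I$. **Theorem.** 1. $R(n-1,2n)$ and $G_n$ are graded by degree, and there is a unique homomorphism of $\mathbb C$-algebras $\iota^*\colon R(n-1,2n)\to G_n$ with $$\iota^*(\Delta_I)=\sum_{\sigma\in\mathcal E(I)}L_\sigma\qquad\text{for all } I\in\tbinom{[2n]}{n-1}.$$ It is a homomorphism of graded rings, and it is surjective, so that it induces a closed embedding $\mathrm{Proj}(G_n)\hookrightarrow\mathrm{Proj}(R(n-1,2n))=\mathrm{Gr}(n-1,2n)$. 2. On points: let $\mathcal X_n\subset\mathbb P(\mathbb C^{\mathcal{NP}_n})$ be the projective variety of common zeros of $\mathfrak I_n$, that is, the Zariski closure of the set of points $[L_\sigma(\Gamma)]_\sigma$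 of electrical networks $\Gamma$ with $(L_\sigma(\Gamma))_\sigma\neq 0$. There is an injective map $\iota\colon\mathcal X_n\to\mathrm{Gr}(n-1,2n)$ such that for every $[v]\in\mathcal X_n$ the vector $\bigl(\sum_{\sigma\in\mathcal E(I)}v_\sigma\bigr)_I$ is a vector of Plücker coordinates of $\iota([v])$. In particular electrical networks, up to a common scaling of their grove measurements, and the limits of their grove points are embedded into $\mathrm{Gr}(n-1,2n)$. -/

import Mathlib

open scoped LinearAlgebra.Projectivization

noncomputable section

/-! ### Circular planar electrical networks and groves -/

/-- A circular planar electrical network with `n` boundary vertices: a finite undirected multigraph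
with positive edge weights, drawn in the closed unit disk. The boundary vertices lie on the unit
circle in clockwise order; everything else lies in the open disk, and edges meet only at their
end vertices. The orientation of an edge from `src` to `tgt` only parametrizes the curve. -/
structure ElectricalNetwork (n : ℕ) where
  V : Type
  E : Type
  [fintypeV : Fintype V]
  [fintypeE : Fintype E]
  src : E → V
  tgt : E → V
  wt : E → ℝ
  wt_pos : ∀ e, 0 < wt e
  /-- the boundary vertices, in order -/
  bdry : Fin n → V
  /-- position of the vertices in the plane -/
  pos : V → ℂ
  pos_injective : Function.Injective pos
  /-- angular positions of the boundary vertices -/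
  angle : Fin n → ℝ
  angle_strictAnti : StrictAnti angle
  angle_lt : ∀ i j, angle i - angle j < 2 * Real.pi
  pos_bdry : ∀ i, pos (bdry i) = Complex.exp (angle i * Complex.I)
  pos_interior : ∀ v, v ∉ Set.range bdry → ‖pos v‖ < 1
  /-- the curves that draw the edges -/
  arc : ∀ e, Path (pos (src e)) (pos (tgt e))
  arc_interior : ∀ e, ∀ t ∈ Set.Ioo (0 : unitInterval) 1, ‖arc e t‖ < 1
  arc_ne_pos : ∀ e, ∀ t ∈ Set.Ioo (0 : unitInterval) 1, ∀ v, arc e t ≠ pos v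
  arc_disjoint : ∀ e e', ∀ t ∈ Set.Ioo (0 : unitInterval) 1, ∀ t' ∈ Set.Ioo (0 : unitInterval) 1,
    arc e t = arc e' t' → e = e' ∧ t = t'

attribute [instance] ElectricalNetwork.fintypeV ElectricalNetwork.fintypeE

namespace ElectricalNetwork

variable {n : ℕ} (Γ : ElectricalNetwork n)

/-- Connectedness of vertices in the spanning subgraph with edge set `F`. -/
def conn (F : Finset Γ.E) : Setoid Γ.V :=
  Relation.EqvGen.setoid fun u v => ∃ e ∈ F, Γ.src e = u ∧ Γ.tgt e = v

open Classical in
/-- A grove: a spanning subgraph without cycles (the ends of an edge are disconnected when the edge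
is removed) in which every vertex is connected to a boundary vertex. -/
def IsGrove (F : Finset Γ.E) : Prop :=
  (∀ e ∈ F, ¬ Γ.conn (F.erase e) (Γ.src e) (Γ.tgt e)) ∧
    ∀ v, ∃ i, Γ.conn F v (Γ.bdry i)

/-- The boundary partition of a spanning subgraph. -/
def boundaryPartition (F : Finset Γ.E) : Setoid (Fin n) :=
  (Γ.conn F).comap Γ.bdry

end ElectricalNetwork

/-! ### Noncrossing partitions and concordance -/

/-- Noncrossing set partitions of `Fin n`. -/
def NCPartition (n : ℕ) : Type :=
  {σ : Setoid (Fin n) // ∀ a b c d : Fin n, a < b → b < c → c < d → σ a c → σ b d → σ a b}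

instance (n : ℕ) : Finite (NCPartition n) :=
  Finite.of_injective (fun σ : NCPartition n => fun i j => σ.1 i j) fun _ _ h =>
    Subtype.ext (Setoid.ext fun i j => iff_of_eq (congrFun (congrFun h i) j))

instance (n : ℕ) : Fintype (NCPartition n) := Fintype.ofFinite _

/-- The dual partition. The `a`-th dual point lies on the circle between the boundary vertices `a`
and `a + 1` (cyclically). Two dual points `a`, `b` are in the same part iff they lie in the same
region of the disk cut by the parts of `σ`, that is, iff no part of `σ` has elements on both sides
of the chord joining them. A boundary vertex `i` lies on the arc of that chord that does not contain
the `(n-1)`-st dual point iff exactly one of `i ≤ a`, `i ≤ b` holds. -/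
def dualPartition {n : ℕ} (σ : Setoid (Fin n)) : Setoid (Fin n) where
  r a b := ∀ i j, σ i j → ((i ≤ a ↔ i ≤ b) ↔ (j ≤ a ↔ j ≤ b))
  iseqv :=
    { refl := fun _ _ _ _ => by simp
      symm := fun h i j hij => by have := h i j hij; tauto
      trans := fun h h' i j hij => by have := h i j hij; have := h' i j hij; tauto }

/-- The `k`-element subsets of `Fin m`. -/
abbrev KSubset (k m : ℕ) : Type := {I : Finset (Fin m) // I.card = k}

/-- The place of the `i`-th boundary vertex among `2n` points (the odd places, counting from 1). -/
def oddPlace {n : ℕ} (i : Fin n) : Fin (2 * n) := ⟨2 * i, by omega⟩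

/-- The place of the `i`-th dual vertex among `2n` points (the even places, counting from 1). -/
def evenPlace {n : ℕ} (i : Fin n) : Fin (2 * n) := ⟨2 * i + 1, by omega⟩

/-- `I` is concordant with `σ`: each part of `σ` and each part of the dual partition contains
exactly one element that is not in `I`. -/
def Concordant {n : ℕ} (I : Finset (Fin (2 * n))) (σ : Setoid (Fin n)) : Prop :=
  (∀ B ∈ σ.classes, ∃! i, i ∈ B ∧ oddPlace i ∉ I) ∧
    ∀ B ∈ (dualPartition σ).classes, ∃! i, i ∈ B ∧ evenPlace i ∉ I

open Classical in
/-- The set of noncrossing partitions concordant with `I`. -/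
def concordantSet {n : ℕ} (I : KSubset (n - 1) (2 * n)) : Finset (NCPartition n) :=
  {σ | Concordant I.1 σ.1}

/-! ### The grove algebra -/

open Classical in
/-- The grove measurement: the weighted count of the groves with boundary partition `σ`. -/
def ElectricalNetwork.groveMeasurement {n : ℕ} (Γ : ElectricalNetwork n) (σ : NCPartition n) : ℝ :=
  ∑ F : Finset Γ.E with Γ.IsGrove F ∧ Γ.boundaryPartition F = σ.1, ∏ e ∈ F, Γ.wt e

/-- The ideal of polynomials in the variables `L_σ` that vanish on all electrical networks. -/
def groveIdeal (n : ℕ) : Ideal (MvPolynomial (NCPartition n) ℂ) :=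
  MvPolynomial.vanishingIdeal ℂ
    (Set.range fun Γ : ElectricalNetwork n => fun σ => (Γ.groveMeasurement σ : ℂ))

/-- The grove algebra over `ℂ`. -/
abbrev GroveAlgebra (n : ℕ) : Type := MvPolynomial (NCPartition n) ℂ ⧸ groveIdeal n

/-- The grove coordinate `L_σ` in the grove algebra. -/
def groveCoord {n : ℕ} (σ : NCPartition n) : GroveAlgebra n :=
  Ideal.Quotient.mk (groveIdeal n) (MvPolynomial.X σ)

/-- The degree `d` piece of the grove algebra. -/
def grovePiece (n d : ℕ) : Submodule ℂ (GroveAlgebra n) :=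
  (MvPolynomial.homogeneousSubmodule (NCPartition n) ℂ d).map
    (Ideal.Quotient.mkₐ ℂ (groveIdeal n)).toLinearMap

/-- The projective variety cut out by the grove ideal, that is, the Zariski closure of the grove
vectors of electrical networks: the points of projective space whose line lies in the zero locus. -/
def groveVariety (n : ℕ) : Set (ℙ ℂ (NCPartition n → ℂ)) :=
  {p | (p.submodule : Set (NCPartition n → ℂ)) ⊆ MvPolynomial.zeroLocus ℂ (groveIdeal n)}

/-! ### The Grassmannian and the Plücker ring -/

/-- The Grassmannian of `k`-dimensional subspaces of `ℂ^m`. -/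
abbrev Gr (k m : ℕ) : Type := {W : Submodule ℂ (Fin m → ℂ) // Module.finrank ℂ W = k}

/-- The maximal minor of a `k × m` matrix in the columns `I`, taken in increasing order. -/
def maxMinor {k m : ℕ} (A : Matrix (Fin k) (Fin m) ℂ) (I : KSubset k m) : ℂ :=
  (A.submatrix id (I.1.orderEmbOfFin I.2)).det

/-- `p` is a vector of homogeneous Plücker coordinates of the subspace `W`. -/
def IsPluckerVector {k m : ℕ} (W : Gr k m) (p : KSubset k m → ℂ) : Prop :=
  ∃ A : Matrix (Fin k) (Fin m) ℂ, Submodule.span ℂ (Set.range A.row) = W.1 ∧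
    ∃ c : ℂ, c ≠ 0 ∧ p = fun I => c * maxMinor A I

/-- The homogeneous ideal of the Grassmannian in its Plücker embedding. -/
def pluckerIdeal (k m : ℕ) : Ideal (MvPolynomial (KSubset k m) ℂ) :=
  MvPolynomial.vanishingIdeal ℂ {p | ∃ W : Gr k m, IsPluckerVector W p}

/-- The Plücker ring `R(k, m)`: the homogeneous coordinate ring of the Grassmannian. -/
abbrev PluckerRing (k m : ℕ) : Type := MvPolynomial (KSubset k m) ℂ ⧸ pluckerIdeal k m

/-- The Plücker coordinate `Δ_I` in the Plücker ring. -/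
def pluckerCoord {k m : ℕ} (I : KSubset k m) : PluckerRing k m :=
  Ideal.Quotient.mk (pluckerIdeal k m) (MvPolynomial.X I)

/-- The degree `d` piece of the Plücker ring. -/
def pluckerPiece (k m d : ℕ) : Submodule ℂ (PluckerRing k m) :=
  (MvPolynomial.homogeneousSubmodule (KSubset k m) ℂ d).map
    (Ideal.Quotient.mkₐ ℂ (pluckerIdeal k m)).toLinearMap

end

/-! ### Crossing paths in the disk -/

/-! The core is that, for a network with `N + 1` boundary vertices, the concordant sums are up to
one common sign a family of determinants in which `N` columns are chosen from vectors indexed by the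
`2 * (N + 1)` places. In `networkMatrix f` the columns at interior vertices are those of the
weighted Laplacian, the column at the first boundary vertex is a unit vector, and the remaining `N`
columns are given by the tuple `f`: a Laplacian column for a boundary vertex, a current from `x` to
`x + 1` for a dual vertex, with signs. By Cramer's rule such determinants satisfy the Plücker
relations (`isPluckerFunction_det`), and a nonzero solution of these relations is a vector of
Plücker coordinates (`IsPluckerFunction.exists_isPluckerVector`).

The determinants are evaluated by a mixed matrix-tree theorem (`det_mixed_eq_sum`, from
Cauchy–Binet). It gives a sum over spanning forests rooted at the boundary vertices missing in `f`,
and elimination of the interior reduces the factor of a forest to the small determinant of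
`placeMatrix`. That factor depends only on the boundary partition `σ` and on `f`. It vanishes if a
region of `σ` has no missing dual vertex; otherwise `f` is concordant with `σ` and the factor is
`tupleSign f` times a sign independent of `σ` and `f` (`IsConcordantTuple.det_mul_tupleSign`). This
absence of cancellation is where planarity enters: the argument needs `σ` to be noncrossing, which
follows from the crossing of interlaced paths in the disk (`exists_eq_of_interlacing`).

Thus the linear map `concordantSum` sends grove vectors into the affine cone of the Grassmannian,
and substitution defines the ring homomorphism. The map is injective because it is triangular with
respect to leading places (`eq_zero_of_sum_concordantSet_eq_zero`). A linear left inverse writes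
each `L_σ` as a combination of images of Plücker coordinates, which gives surjectivity; together
with the uniqueness of Plücker vectors up to scaling, injectivity also gives the embedding on
points.

Both rings are graded because the point sets that define the ideals are stable under infinitely many
scalings. For grove vectors the scaling by `w > 0` is realized by a pendant edge of weight `w`
(`groveMeasurement_addPendant`). -/

theorem arg_one_sub_exp_of_pos {θ : ℝ} (h0 : 0 < θ) (h1 : θ < 2 * Real.pi) :
    Complex.arg (1 - Complex.exp (θ * Complex.I)) = θ / 2 - Real.pi / 2 := by
  have hs : 0 < Real.sin (θ / 2) := Real.sin_pos_of_pos_of_lt_pi (by linarith) (by linarith)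
  -- Half-angle polar form; the modulus `2 sin (θ/2)` is positive on the given range.
  have h : (1 - Complex.exp (θ * Complex.I)) = ((2 * Real.sin (θ / 2) : ℝ) : ℂ) *
      (Complex.cos ((θ / 2 - Real.pi / 2 : ℝ) : ℂ) +
        Complex.sin ((θ / 2 - Real.pi / 2 : ℝ) : ℂ) * Complex.I) := by
    have e1 : Real.cos (θ / 2 - Real.pi / 2) = Real.sin (θ / 2) := Real.cos_sub_pi_div_two _
    have e2 : Real.sin (θ / 2 - Real.pi / 2) = - Real.cos (θ / 2) := Real.sin_sub_pi_div_two _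
    rw [← Complex.ofReal_cos, ← Complex.ofReal_sin, e1, e2, Complex.exp_mul_I]
    have h2 : (θ : ℂ) = 2 * ((θ / 2 : ℝ) : ℂ) := by push_cast; ring
    rw [h2, Complex.cos_two_mul, Complex.sin_two_mul]
    push_cast
    have := Complex.sin_sq_add_cos_sq ((θ : ℂ) / 2)
    linear_combination (-2 : ℂ) * this
  rw [h, Complex.arg_mul_cos_add_sin_mul_I (by linarith)]
  constructor <;> linarith

theorem arg_one_sub_exp_of_neg {θ : ℝ} (h0 : θ < 0) (h1 : -(2 * Real.pi) < θ) :
    Complex.arg (1 - Complex.exp (θ * Complex.I)) = θ / 2 + Real.pi / 2 := by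
  have h := arg_one_sub_exp_of_pos (θ := θ + 2 * Real.pi) (by linarith) (by linarith)
  have e : Complex.exp ((θ + 2 * Real.pi : ℝ) * Complex.I) = Complex.exp (θ * Complex.I) := by
    push_cast
    rw [add_mul, Complex.exp_periodic]
  rw [e] at h
  rw [h]; ring

/-- A continuous logarithm of `k * (u - g)`, for a path `g` in the unit disk that avoids the point
`u` of the unit circle, varies like the principal logarithm of `1 - g / u`. -/
theorem im_log_sub_eq {u k : ℂ} (hu : ‖u‖ = 1) {g L : ℝ → ℂ} (hg : Continuous g)
    (hL : Continuous L) (hg1 : ∀ t, ‖g t‖ ≤ 1) (hgu : ∀ t, g t ≠ u)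
    (hexp : ∀ t, Complex.exp (L t) = k * (u - g t)) (s t : ℝ) :
    (L t).im - (L s).im = Complex.arg (1 - g t / u) - Complex.arg (1 - g s / u) := by
  have hu0 : u ≠ 0 := by rintro rfl; simp at hu
  -- The quotient `g t / u` lies in the closed unit disk and differs from 1, so `1 - g t / u` stays
  -- in the right half plane, where the principal logarithm is continuous.
  have hre : ∀ t, 0 < (1 - g t / u).re := by
    intro t
    have hn : ‖g t / u‖ ≤ 1 := by rw [norm_div, hu, div_one]; exact hg1 t
    have hne : g t / u ≠ 1 := by
      intro h; exact hgu t ((div_eq_one_iff_eq hu0).1 h)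
    rw [Complex.sub_re, Complex.one_re, sub_pos]
    refine lt_of_le_of_ne ((Complex.re_le_norm _).trans hn) ?_
    intro h
    apply hne
    have h2 : Complex.normSq (g t / u) ≤ 1 := by
      rw [Complex.normSq_eq_norm_sq]; nlinarith [norm_nonneg (g t / u)]
    rw [Complex.normSq_apply, h] at h2
    apply Complex.ext
    · simpa using h
    · simp only [Complex.one_im]
      nlinarith
  -- The two logarithms belong to functions with constant quotient `k * u`, so their difference
  -- moves continuously in a coset of `2πiℤ` and is constant.
  set h : ℝ → ℂ := fun t => L t - Complex.log (1 - g t / u) with hh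
  have hcont : Continuous h := by
    refine hL.sub (continuous_iff_continuousAt.2 fun t => ContinuousAt.clog ?_ (Or.inl (hre t)))
    fun_prop
  have hne : ∀ t, 1 - g t / u ≠ 0 := fun t h0 => by
    have := hre t; rw [h0] at this; simp at this
  have hexp' : ∀ t, Complex.exp (h t) = k * u := by
    intro t
    rw [hh, Complex.exp_sub, Complex.exp_log (hne t), hexp t, div_eq_iff (hne t)]
    field_simp
  have hint : ∀ t, ∃ m : ℤ, h t = h s + m * (2 * Real.pi * Complex.I) := fun t =>
    Complex.exp_eq_exp_iff_exists_int.1 ((hexp' t).trans (hexp' s).symm)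
  choose m hm using hint
  have hmc : Continuous m := by
    rw [Int.isClosedEmbedding_coe_real.isEmbedding.continuous_iff]
    have : ((fun n : ℤ => (n : ℝ)) ∘ m) = fun t => ((h t).im - (h s).im) / (2 * Real.pi) := by
      funext t
      have := congrArg Complex.im (hm t)
      simp at this
      simp only [Function.comp]
      rw [this]
      field_simp
      ring
    rw [this]
    exact ((Complex.continuous_im.comp hcont).sub continuous_const).div_const _
  have hms : m s = 0 := by
    have := hm s
    simpa [Real.pi_ne_zero] using this
  have hmt : m t = 0 := by rw [← hms]; exact PreconnectedSpace.constant inferInstance hmc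
  have := congrArg Complex.im (hm t)
  rw [hmt] at this
  simp [hh, Complex.log_im] at this
  linarith

/-- Two paths in the closed unit disk whose end points interlace on the unit circle meet. -/
theorem exists_eq_of_interlacing {α β γ δ : ℝ} (hαβ : α < β) (hβγ : β < γ) (hγδ : γ < δ)
    (hδα : δ < α + 2 * Real.pi)
    (p : Path (Complex.exp (α * Complex.I)) (Complex.exp (γ * Complex.I)))
    (q : Path (Complex.exp (β * Complex.I)) (Complex.exp (δ * Complex.I)))
    (hp : ∀ t, ‖p t‖ ≤ 1) (hq : ∀ t, ‖q t‖ ≤ 1) : ∃ s t, p s = q t := by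
  by_contra! hne
  have hp' : ∀ t, ‖p.extend t‖ ≤ 1 := fun t => hp _
  have hq' : ∀ t, ‖q.extend t‖ ≤ 1 := fun t => hq _
  have hne' : ∀ s t, p.extend s ≠ q.extend t := fun s t => hne _ _
  have hpc : Continuous p.extend := p.continuous_extend
  have hqc : Continuous q.extend := q.continuous_extend
  let F : C(ℝ × ℝ, ℂ) := ⟨fun x => p.extend x.1 - q.extend x.2, by fun_prop⟩
  have hF0 : ∀ x, F x ≠ 0 := fun x => sub_ne_zero.2 (hne' _ _)
  -- If the paths do not meet, `p s - q t` has no zero on the plane and so has a continuous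
  -- logarithm. On each edge of the unit square one of the two points is fixed on the circle, and
  -- the change of the argument is known.
  obtain ⟨L, ⟨-, hL⟩, -⟩ := Complex.isCoveringMapOn_exp.existsUnique_continuousMap_lifts
    F (a₀ := (0, 0)) (Complex.exp_log (hF0 (0, 0))) (fun x => hF0 x)
  have hL' : ∀ s t, Complex.exp (L (s, t)) = p.extend s - q.extend t := fun s t => congrFun hL (s, t)
  have hcirc : ∀ θ : ℝ, ‖Complex.exp (θ * Complex.I)‖ = 1 := Complex.norm_exp_ofReal_mul_I
  have hdiv : ∀ θ φ : ℝ, Complex.exp (θ * Complex.I) / Complex.exp (φ * Complex.I) =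
      Complex.exp ((θ - φ : ℝ) * Complex.I) := fun θ φ => by
    rw [← Complex.exp_sub]; congr 1; push_cast; ring
  have h1 := im_log_sub_eq (hcirc α) (k := 1) hqc (L := fun t => L (0, t)) (by fun_prop) hq'
    (fun t => by have := hne' 0 t; simpa using this.symm) (fun t => by simp [hL']) 0 1
  have h2 := im_log_sub_eq (hcirc γ) (k := 1) hqc (L := fun t => L (1, t)) (by fun_prop) hq'
    (fun t => by have := hne' 1 t; simpa using this.symm) (fun t => by simp [hL']) 0 1
  have h3 := im_log_sub_eq (hcirc β) (k := -1) hpc (L := fun t => L (t, 0)) (by fun_prop) hp'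
    (fun t => by have := hne' t 0; simpa using this) (fun t => by simp [hL']) 0 1
  have h4 := im_log_sub_eq (hcirc δ) (k := -1) hpc (L := fun t => L (t, 1)) (by fun_prop) hp'
    (fun t => by have := hne' t 1; simpa using this) (fun t => by simp [hL']) 0 1
  simp only [Path.extend_zero, Path.extend_one, hdiv] at h1 h2 h3 h4
  have hpi := Real.pi_pos
  rw [arg_one_sub_exp_of_pos (by linarith) (by linarith),
    arg_one_sub_exp_of_pos (by linarith) (by linarith)] at h1
  rw [arg_one_sub_exp_of_pos (by linarith) (by linarith),
    arg_one_sub_exp_of_neg (by linarith) (by linarith)] at h2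
  rw [arg_one_sub_exp_of_pos (by linarith) (by linarith),
    arg_one_sub_exp_of_neg (by linarith) (by linarith)] at h3
  rw [arg_one_sub_exp_of_neg (by linarith) (by linarith),
    arg_one_sub_exp_of_neg (by linarith) (by linarith)] at h4
  -- From `(0, 0)` to `(1, 1)` the argument increases by `((δ - β) + (γ - α)) / 2` via the corner
  -- `(0, 1)`, and by `2π` less via `(1, 0)`.
  linarith

/-! ### Boundary partitions of planar networks are noncrossing -/

namespace ElectricalNetwork

variable {n : ℕ} (Γ : ElectricalNetwork n)

/-- The part of the drawing that belongs to the component of `v` in the spanning subgraph `F`. -/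
def componentDrawing (F : Finset Γ.E) (v : Γ.V) : Set ℂ :=
  {z | (∃ w, Γ.conn F v w ∧ z = Γ.pos w) ∨ ∃ e ∈ F, Γ.conn F v (Γ.src e) ∧ ∃ t, z = Γ.arc e t}

variable {Γ}

theorem conn_src_tgt {F : Finset Γ.E} {e : Γ.E} (he : e ∈ F) : Γ.conn F (Γ.src e) (Γ.tgt e) :=
  Relation.EqvGen.rel _ _ ⟨e, he, rfl, rfl⟩

theorem componentDrawing_congr {F : Finset Γ.E} {v w : Γ.V} (h : Γ.conn F v w) :
    Γ.componentDrawing F v = Γ.componentDrawing F w := by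
  have key : ∀ {v w}, Γ.conn F v w → Γ.componentDrawing F v ⊆ Γ.componentDrawing F w := by
    rintro v w h z (⟨x, hx, rfl⟩ | ⟨e, he, hx, t, rfl⟩)
    · exact Or.inl ⟨x, (Γ.conn F).trans ((Γ.conn F).symm h) hx, rfl⟩
    · exact Or.inr ⟨e, he, (Γ.conn F).trans ((Γ.conn F).symm h) hx, t, rfl⟩
  exact (key h).antisymm (key ((Γ.conn F).symm h))

theorem joinedIn_componentDrawing {F : Finset Γ.E} {v w : Γ.V} (h : Γ.conn F v w) :
    JoinedIn (Γ.componentDrawing F v) (Γ.pos v) (Γ.pos w) := by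
  have h' : Relation.EqvGen (fun u v => ∃ e ∈ F, Γ.src e = u ∧ Γ.tgt e = v) v w := h
  clear h
  induction h' with
  | rel u v h =>
    obtain ⟨e, he, rfl, rfl⟩ := h
    exact ⟨Γ.arc e, fun t => Or.inr ⟨e, he, (Γ.conn F).refl _, t, rfl⟩⟩
  | refl u => exact JoinedIn.refl (Or.inl ⟨u, (Γ.conn F).refl _, rfl⟩)
  | symm u v h ih =>
    rw [← componentDrawing_congr (show Γ.conn F u v from h)]
    exact ih.symm
  | trans u v w h1 h2 ih1 ih2 =>
    rw [← componentDrawing_congr (show Γ.conn F u v from h1)] at ih2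
    exact ih1.trans ih2

theorem arc_cases (e : Γ.E) (t : unitInterval) :
    Γ.arc e t = Γ.pos (Γ.src e) ∨ Γ.arc e t = Γ.pos (Γ.tgt e) ∨
      t ∈ Set.Ioo (0 : unitInterval) 1 := by
  rcases eq_or_lt_of_le (unitInterval.nonneg' (t := t)) with h | h
  · left; rw [← h]; exact (Γ.arc e).source
  rcases eq_or_lt_of_le (unitInterval.le_one' (t := t)) with h' | h'
  · right; left; rw [h']; exact (Γ.arc e).target
  · exact Or.inr (Or.inr ⟨h, h'⟩)

theorem mem_componentDrawing {F : Finset Γ.E} {v : Γ.V} {z : ℂ} (h : z ∈ Γ.componentDrawing F v) :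
    (∃ w, Γ.conn F v w ∧ z = Γ.pos w) ∨
      ∃ e, Γ.conn F v (Γ.src e) ∧ ∃ t ∈ Set.Ioo (0 : unitInterval) 1, z = Γ.arc e t := by
  rcases h with h | ⟨e, he, hx, t, rfl⟩
  · exact Or.inl h
  · rcases arc_cases e t with h | h | h
    · exact Or.inl ⟨_, hx, h⟩
    · exact Or.inl ⟨_, (Γ.conn F).trans hx (conn_src_tgt he), h⟩
    · exact Or.inr ⟨e, hx, t, h, rfl⟩

/-- Edges meet only at end vertices, so a point common to two drawings is a vertex of both or an
inner point of a single edge of both; different components have disjoint drawings. -/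
theorem conn_of_mem_componentDrawing {F : Finset Γ.E} {v w : Γ.V} {z : ℂ}
    (hv : z ∈ Γ.componentDrawing F v) (hw : z ∈ Γ.componentDrawing F w) : Γ.conn F v w := by
  rcases mem_componentDrawing hv with ⟨x, hx, rfl⟩ | ⟨e, hx, t, ht, rfl⟩ <;>
  rcases mem_componentDrawing hw with ⟨y, hy, h⟩ | ⟨e', hy, t', ht', h⟩
  · rw [Γ.pos_injective h] at hx
    exact (Γ.conn F).trans hx ((Γ.conn F).symm hy)
  · exact absurd h.symm (Γ.arc_ne_pos e' t' ht' x)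
  · exact absurd h (Γ.arc_ne_pos e t ht y)
  · rw [(Γ.arc_disjoint e e' t ht t' ht' h).1] at hx
    exact (Γ.conn F).trans hx ((Γ.conn F).symm hy)

theorem norm_pos_le (v : Γ.V) : ‖Γ.pos v‖ ≤ 1 := by
  by_cases h : v ∈ Set.range Γ.bdry
  · obtain ⟨i, rfl⟩ := h
    rw [Γ.pos_bdry, Complex.norm_exp_ofReal_mul_I]
  · exact (Γ.pos_interior v h).le

theorem norm_arc_le (e : Γ.E) (t : unitInterval) : ‖Γ.arc e t‖ ≤ 1 := by
  rcases arc_cases e t with h | h | h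
  · rw [h]; exact norm_pos_le _
  · rw [h]; exact norm_pos_le _
  · exact (Γ.arc_interior e t h).le

theorem norm_le_of_mem_componentDrawing {F : Finset Γ.E} {v : Γ.V} {z : ℂ}
    (h : z ∈ Γ.componentDrawing F v) : ‖z‖ ≤ 1 := by
  rcases h with ⟨w, -, rfl⟩ | ⟨e, -, -, t, rfl⟩
  · exact norm_pos_le w
  · exact norm_arc_le e t

/-- Paths inside the drawings of the two components have interlacing end points on the circle. They
meet, so the components coincide. -/
theorem boundaryPartition_noncrossing (F : Finset Γ.E) (a b c d : Fin n) (hab : a < b) (hbc : b < c)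
    (hcd : c < d) (hac : Γ.boundaryPartition F a c) (hbd : Γ.boundaryPartition F b d) :
    Γ.boundaryPartition F a b := by
  obtain ⟨p, hp⟩ := (joinedIn_componentDrawing (show Γ.conn F _ _ from hac)).symm
  obtain ⟨q, hq⟩ := (joinedIn_componentDrawing (show Γ.conn F _ _ from hbd)).symm
  have h1 := Γ.angle_strictAnti hab
  have h2 := Γ.angle_strictAnti hbc
  have h3 := Γ.angle_strictAnti hcd
  have h4 := Γ.angle_lt a d
  -- Clockwise order means decreasing angles: the counterclockwise order is `d`, `c`, `b`, `a`.
  obtain ⟨s, t, hst⟩ := exists_eq_of_interlacing h3 h2 h1 (by linarith)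
    (q.cast (Γ.pos_bdry d).symm (Γ.pos_bdry b).symm)
    (p.cast (Γ.pos_bdry c).symm (Γ.pos_bdry a).symm)
    (fun t => norm_le_of_mem_componentDrawing (hq t))
    (fun t => norm_le_of_mem_componentDrawing (hp t))
  have hst' : q s = p t := hst
  exact conn_of_mem_componentDrawing (hp t) (hst' ▸ hq s)

/-- The boundary partition of a spanning subgraph, as a noncrossing partition. -/
def ncBoundaryPartition (F : Finset Γ.E) : NCPartition n :=
  ⟨Γ.boundaryPartition F, boundaryPartition_noncrossing F⟩

theorem bdry_injective : Function.Injective Γ.bdry := by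
  intro i j h
  have h' : Complex.exp (Γ.angle i * Complex.I) = Complex.exp (Γ.angle j * Complex.I) := by
    rw [← Γ.pos_bdry, ← Γ.pos_bdry, h]
  obtain ⟨m, hm⟩ := Complex.exp_eq_exp_iff_exists_int.1 h'
  have h2 : Γ.angle i - Γ.angle j = m * (2 * Real.pi) := by
    have := congrArg Complex.im hm
    simp at this
    linarith
  have h3 := Γ.angle_lt i j
  have h4 := Γ.angle_lt j i
  have hpi := Real.two_pi_pos
  have hm0 : m = 0 := by
    have a1 : (m : ℝ) < 1 := by
      by_contra hc; push Not at hc; nlinarith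
    have a2 : (-1 : ℝ) < m := by
      by_contra hc; push Not at hc; nlinarith
    have a1' : m < 1 := by exact_mod_cast a1
    have a2' : -1 < m := by exact_mod_cast a2
    omega
  rw [hm0] at h2
  exact Γ.angle_strictAnti.injective (by simp at h2; linarith)

end ElectricalNetwork

/-! ### Attaching a pendant edge -/

open Metric in
/-- The radial contraction of the disk towards its centre that fixes the points of `B`. -/
noncomputable def radialShrink (B : Set ℂ) (z : ℂ) : ℂ := ((1 - infDist z B / 4 : ℝ) : ℂ) * z

namespace radialShrink
open Metric

variable {B : Set ℂ}

theorem infDist_le_two (hB : B.Nonempty) (h1 : ∀ b ∈ B, ‖b‖ = 1) {z : ℂ} (hz : ‖z‖ ≤ 1) :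
    infDist z B ≤ 2 := by
  obtain ⟨b, hb⟩ := hB
  refine (infDist_le_dist_of_mem hb).trans ?_
  rw [dist_eq_norm]
  have := norm_sub_le z b
  rw [h1 b hb] at this
  linarith

theorem continuous (B : Set ℂ) : Continuous (radialShrink B) := by
  unfold radialShrink
  exact (Complex.continuous_ofReal.comp (by fun_prop)).mul continuous_id

theorem eq_self {z : ℂ} (hz : z ∈ B) : radialShrink B z = z := by
  simp [radialShrink, infDist_zero_of_mem hz]

theorem norm_le (hB : B.Nonempty) (h1 : ∀ b ∈ B, ‖b‖ = 1) {z : ℂ} (hz : ‖z‖ ≤ 1) :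
    ‖radialShrink B z‖ ≤ ‖z‖ := by
  have h2 := infDist_le_two hB h1 hz
  have h0 : 0 ≤ infDist z B := infDist_nonneg
  rw [radialShrink, norm_mul, Complex.norm_real, Real.norm_eq_abs, abs_of_nonneg (by linarith)]
  nlinarith [norm_nonneg z]

/-- The distance to `B` is 1-Lipschitz and at most 2 on the disk, so with the factor 1/4 the
contraction displaces `z - w` by at most `(2/4 + 1/4) ‖z - w‖`; equal images force `z = w`. -/
theorem injOn (hB : B.Nonempty) (h1 : ∀ b ∈ B, ‖b‖ = 1) :
    Set.InjOn (radialShrink B) {z | ‖z‖ ≤ 1} := by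
  intro z hz w hw h
  have hz2 := infDist_le_two hB h1 hz
  have hz0 : 0 ≤ infDist z B := infDist_nonneg
  have e : z - w = ((infDist z B / 4 : ℝ) : ℂ) * (z - w) +
      (((infDist z B - infDist w B) / 4 : ℝ) : ℂ) * w := by
    unfold radialShrink at h
    push_cast at h ⊢
    linear_combination h
  have hl : |infDist z B - infDist w B| ≤ ‖z - w‖ := by
    rw [← dist_eq_norm, ← Real.dist_eq]
    exact (lipschitz_infDist_pt B).dist_le_mul z w |>.trans (by simp)
  have hn : ‖z - w‖ ≤ infDist z B / 4 * ‖z - w‖ + |infDist z B - infDist w B| / 4 * ‖w‖ := by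
    conv_lhs => rw [e]
    refine (norm_add_le _ _).trans ?_
    rw [norm_mul, norm_mul, Complex.norm_real, Complex.norm_real, Real.norm_eq_abs,
      Real.norm_eq_abs, abs_of_nonneg (by linarith), abs_div]
    norm_num
  have hw' : ‖w‖ ≤ 1 := hw
  have : ‖z - w‖ ≤ 0 := by
    nlinarith [norm_nonneg (z - w), norm_nonneg w, abs_nonneg (infDist z B - infDist w B)]
  exact sub_eq_zero.1 (norm_le_zero_iff.1 this)

/-- The shrunk disk misses the points halfway between its rim and the unit circle. -/
theorem ne_of_norm_eq_one {z u : ℂ} (hB : B.Nonempty) (h1 : ∀ b ∈ B, ‖b‖ = 1)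
    (hz : ‖z‖ ≤ 1) (hu : ‖u‖ = 1) (hpos : 0 < infDist u B) :
    ((1 - infDist u B / 8 : ℝ) : ℂ) * u ≠ radialShrink B z := by
  intro h
  have hu2 := infDist_le_two hB h1 hu.le
  have hz2 := infDist_le_two hB h1 hz
  have hz0 : 0 ≤ infDist z B := infDist_nonneg
  have hn := congrArg norm h
  rw [radialShrink, norm_mul, norm_mul, Complex.norm_real, Complex.norm_real, Real.norm_eq_abs,
    Real.norm_eq_abs, abs_of_nonneg (by linarith), abs_of_nonneg (by linarith), hu, mul_one] at hn
  -- Both factors are positive, so comparison of norms shows that `z` lies on the ray through `u`.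
  have hzu : z = (‖z‖ : ℂ) * u := by
    have hc : ((1 - infDist z B / 4 : ℝ) : ℂ) ≠ 0 := by
      rw [Complex.ofReal_ne_zero]; intro h0; linarith
    rw [hn, radialShrink] at h
    apply mul_left_cancel₀ hc
    rw [← h]; push_cast; ring
  have hd : dist u z = 1 - ‖z‖ := by
    rw [dist_eq_norm]
    have : u - z = ((1 - ‖z‖ : ℝ) : ℂ) * u := by
      conv_lhs => rw [hzu]
      push_cast; ring
    rw [this, norm_mul, Complex.norm_real, hu, mul_one, Real.norm_eq_abs, abs_of_nonneg]
    linarith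
  have hl : infDist u B ≤ infDist z B + (1 - ‖z‖) := by
    rw [← hd]; exact infDist_le_infDist_add_dist
  have hr := norm_nonneg z
  set r := ‖z‖
  set p := infDist u B
  -- The shrunk disk reaches only the radius `1 - p / 4` in the direction of `u`; since the distance
  -- to `B` is 1-Lipschitz, a smaller `r` does not help.
  have h5 : 1 - p / 8 ≤ (1 - p / 4 + (1 - r) / 4) * r := by
    rw [hn]; exact mul_le_mul_of_nonneg_right (by linarith) hr
  rcases le_total r (1 / 2) with h6 | h6
  · nlinarith
  · rcases eq_or_lt_of_le hz with h7 | h7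
    · rw [h7] at h5; nlinarith
    · nlinarith [mul_nonneg hpos.le (by linarith : (0:ℝ) ≤ 2 * r - 1)]

end radialShrink

/-! ### Drawing the pendant edge in the collar outside the shrunk disk -/

namespace ElectricalNetwork
open Metric

variable {n : ℕ} (Γ : ElectricalNetwork (n + 1))

/-- The positions of the boundary vertices. -/
def bdryPoints : Set ℂ := Set.range fun i => Γ.pos (Γ.bdry i)

/-- The angle at which the pendant vertex is placed. -/
noncomputable def pendantAngle : ℝ :=
  (Γ.angle 0 + (Γ.angle (Fin.last n) + 2 * Real.pi)) / 2

/-- The curve that carries the pendant edge, in terms of the angle. -/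
noncomputable def pendantCurve (θ : ℝ) : ℂ :=
  ((1 - infDist (Complex.exp (θ * Complex.I)) Γ.bdryPoints / 8 : ℝ) : ℂ) *
    Complex.exp (θ * Complex.I)

theorem bdryPoints_nonempty : Γ.bdryPoints.Nonempty := Set.range_nonempty _

theorem norm_of_mem_bdryPoints : ∀ b ∈ Γ.bdryPoints, ‖b‖ = 1 := by
  rintro b ⟨i, rfl⟩
  simp only [Γ.pos_bdry, Complex.norm_exp_ofReal_mul_I]

theorem angle_zero_lt_pendantAngle : Γ.angle 0 < Γ.pendantAngle := by
  have := Γ.angle_lt 0 (Fin.last n)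
  unfold pendantAngle; linarith

/-- Modulo full turns, the boundary angles lie between that of the last vertex and that of vertex 0;
`pendantAngle` is the midpoint of the free arc that follows vertex 0 counterclockwise. -/
theorem infDist_bdryPoints_pos {θ : ℝ} (h0 : Γ.angle 0 < θ) (h1 : θ ≤ Γ.pendantAngle) :
    0 < infDist (Complex.exp (θ * Complex.I)) Γ.bdryPoints := by
  have hc : IsClosed Γ.bdryPoints := (Set.finite_range _).isClosed
  rw [← hc.notMem_iff_infDist_pos Γ.bdryPoints_nonempty]
  rintro ⟨i, hi⟩
  simp only [Γ.pos_bdry] at hi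
  obtain ⟨m, hm⟩ := Complex.exp_eq_exp_iff_exists_int.1 hi
  have h2 : Γ.angle i - θ = m * (2 * Real.pi) := by
    have := congrArg Complex.im hm
    simp at this
    linarith
  have h3 : Γ.angle i ≤ Γ.angle 0 := Γ.angle_strictAnti.antitone (Fin.zero_le i)
  have h4 : Γ.angle (Fin.last n) ≤ Γ.angle i := Γ.angle_strictAnti.antitone (Fin.le_last i)
  have h5 := Γ.angle_lt 0 (Fin.last n)
  unfold pendantAngle at h1
  have hpi := Real.two_pi_pos
  have a1 : (m : ℝ) < 0 := by
    by_contra hc; push Not at hc; nlinarith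
  have a2 : (-1 : ℝ) < m := by
    by_contra hc; push Not at hc; nlinarith
  have a1' : m < 0 := by exact_mod_cast a1
  have a2' : -1 < m := by exact_mod_cast a2
  omega

theorem norm_pendantCurve (θ : ℝ) :
    ‖Γ.pendantCurve θ‖ = 1 - infDist (Complex.exp (θ * Complex.I)) Γ.bdryPoints / 8 := by
  have h2 := radialShrink.infDist_le_two Γ.bdryPoints_nonempty Γ.norm_of_mem_bdryPoints
    (Complex.norm_exp_ofReal_mul_I θ).le
  rw [pendantCurve, norm_mul, Complex.norm_exp_ofReal_mul_I, mul_one, Complex.norm_real,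
    Real.norm_eq_abs, abs_of_nonneg (by linarith)]

theorem continuous_pendantCurve : Continuous Γ.pendantCurve := by
  unfold pendantCurve
  exact (Complex.continuous_ofReal.comp (by fun_prop)).mul (by fun_prop)

theorem pendantCurve_angle_zero : Γ.pendantCurve (Γ.angle 0) = Γ.pos (Γ.bdry 0) := by
  have : Complex.exp (Γ.angle 0 * Complex.I) ∈ Γ.bdryPoints := ⟨0, Γ.pos_bdry 0⟩
  rw [pendantCurve, infDist_zero_of_mem this, Γ.pos_bdry]
  simp

/-- The norm recovers the radial factor, hence the direction, and the range of angles is shorter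
than a full turn. -/
theorem pendantCurve_injOn {θ φ : ℝ} (hθ : Γ.angle 0 ≤ θ) (hθ1 : θ ≤ Γ.pendantAngle)
    (hφ : Γ.angle 0 ≤ φ) (hφ1 : φ ≤ Γ.pendantAngle) (h : Γ.pendantCurve θ = Γ.pendantCurve φ) :
    θ = φ := by
  have hn := congrArg norm h
  rw [norm_pendantCurve, norm_pendantCurve] at hn
  have h2 := radialShrink.infDist_le_two Γ.bdryPoints_nonempty Γ.norm_of_mem_bdryPoints
    (Complex.norm_exp_ofReal_mul_I θ).le
  have he : Complex.exp (θ * Complex.I) = Complex.exp (φ * Complex.I) := by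
    unfold pendantCurve at h
    rw [← hn] at h
    refine mul_left_cancel₀ ?_ h
    rw [Complex.ofReal_ne_zero]; intro h0; linarith
  obtain ⟨m, hm⟩ := Complex.exp_eq_exp_iff_exists_int.1 he
  have h3 : θ - φ = m * (2 * Real.pi) := by
    have := congrArg Complex.im hm
    simp at this
    linarith
  have h4 : Γ.pendantAngle < Γ.angle 0 + 2 * Real.pi := by
    have := Γ.angle_strictAnti.antitone (Fin.zero_le (Fin.last n))
    have := Real.two_pi_pos
    unfold pendantAngle; linarith
  have hpi := Real.two_pi_pos
  have a1 : (m : ℝ) < 1 := by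
    by_contra hc; push Not at hc; nlinarith
  have a2 : (-1 : ℝ) < m := by
    by_contra hc; push Not at hc; nlinarith
  have a1' : m < 1 := by exact_mod_cast a1
  have a2' : -1 < m := by exact_mod_cast a2
  have : m = 0 := by omega
  rw [this] at h3
  simp at h3; linarith

theorem pendantCurve_ne {θ : ℝ} (h0 : Γ.angle 0 < θ) (h1 : θ ≤ Γ.pendantAngle) {z : ℂ}
    (hz : ‖z‖ ≤ 1) : Γ.pendantCurve θ ≠ radialShrink Γ.bdryPoints z :=
  radialShrink.ne_of_norm_eq_one Γ.bdryPoints_nonempty Γ.norm_of_mem_bdryPoints hz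
    (Complex.norm_exp_ofReal_mul_I θ) (Γ.infDist_bdryPoints_pos h0 h1)

/-- The vertex positions after a pendant vertex has been added. -/
noncomputable def pendantPos : Option Γ.V → ℂ
  | some v => radialShrink Γ.bdryPoints (Γ.pos v)
  | none => Γ.pendantCurve Γ.pendantAngle

theorem pendantPos_bdry (i : Fin (n + 1)) :
    Γ.pendantPos (some (Γ.bdry i)) = Complex.exp (Γ.angle i * Complex.I) := by
  have h : Γ.pos (Γ.bdry i) ∈ Γ.bdryPoints := ⟨i, rfl⟩
  rw [pendantPos, radialShrink.eq_self h, Γ.pos_bdry]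

/-- The edges after a pendant edge has been added. -/
noncomputable def pendantArc : ∀ e : Option Γ.E,
    Path (Γ.pendantPos (e.elim (some (Γ.bdry 0)) fun e => some (Γ.src e)))
      (Γ.pendantPos (e.elim none fun e => some (Γ.tgt e)))
  | some e => (Γ.arc e).map (radialShrink.continuous Γ.bdryPoints)
  | none =>
    { toFun := fun t => Γ.pendantCurve (Γ.angle 0 + t * (Γ.pendantAngle - Γ.angle 0))
      continuous_toFun := Γ.continuous_pendantCurve.comp (by fun_prop)
      source' := by
        simp only [Set.Icc.coe_zero, zero_mul, add_zero, pendantCurve_angle_zero]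
        rw [Γ.pos_bdry]; exact (Γ.pendantPos_bdry 0).symm
      target' := by simp [pendantPos] }

theorem pendantArc_some (e : Γ.E) (t : unitInterval) :
    Γ.pendantArc (some e) t = radialShrink Γ.bdryPoints (Γ.arc e t) := rfl

theorem pendantArc_none (t : unitInterval) : Γ.pendantArc none t =
    Γ.pendantCurve (Γ.angle 0 + t * (Γ.pendantAngle - Γ.angle 0)) := rfl

theorem pendant_param {t : unitInterval} (ht : t ∈ Set.Ioo (0 : unitInterval) 1) :
    Γ.angle 0 < Γ.angle 0 + t * (Γ.pendantAngle - Γ.angle 0) ∧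
      Γ.angle 0 + t * (Γ.pendantAngle - Γ.angle 0) < Γ.pendantAngle := by
  have h := Γ.angle_zero_lt_pendantAngle
  have h0 : (0 : ℝ) < t := ht.1
  have h1 : (t : ℝ) < 1 := ht.2
  constructor <;> nlinarith

/-- The network with an additional interior vertex, joined to the first boundary vertex by an edge
of weight `w`. -/
noncomputable abbrev addPendant (w : ℝ) (hw : 0 < w) : ElectricalNetwork (n + 1) where
  V := Option Γ.V
  E := Option Γ.E
  src e := e.elim (some (Γ.bdry 0)) fun e => some (Γ.src e)
  tgt e := e.elim none fun e => some (Γ.tgt e)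
  wt e := e.elim w Γ.wt
  wt_pos e := by cases e; exacts [hw, Γ.wt_pos _]
  bdry i := some (Γ.bdry i)
  pos := Γ.pendantPos
  pos_injective := by
    rintro (_ | v) (_ | w) h
    · rfl
    · exact absurd h (Γ.pendantCurve_ne Γ.angle_zero_lt_pendantAngle le_rfl (norm_pos_le w))
    · exact absurd h.symm (Γ.pendantCurve_ne Γ.angle_zero_lt_pendantAngle le_rfl (norm_pos_le v))
    · exact congrArg some (Γ.pos_injective (radialShrink.injOn Γ.bdryPoints_nonempty
        Γ.norm_of_mem_bdryPoints (norm_pos_le v) (norm_pos_le w) h))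
  angle := Γ.angle
  angle_strictAnti := Γ.angle_strictAnti
  angle_lt := Γ.angle_lt
  pos_bdry := Γ.pendantPos_bdry
  pos_interior := by
    rintro (_ | v) h
    · have := Γ.infDist_bdryPoints_pos Γ.angle_zero_lt_pendantAngle le_rfl
      change ‖Γ.pendantCurve Γ.pendantAngle‖ < 1
      rw [norm_pendantCurve]; linarith
    · refine (radialShrink.norm_le Γ.bdryPoints_nonempty Γ.norm_of_mem_bdryPoints
        (norm_pos_le v)).trans_lt (Γ.pos_interior v ?_)
      rintro ⟨i, rfl⟩
      exact h ⟨i, rfl⟩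
  arc := Γ.pendantArc
  arc_interior := by
    rintro (_ | e) t ht
    · have h := Γ.pendant_param ht
      have := Γ.infDist_bdryPoints_pos h.1 h.2.le
      rw [pendantArc_none, norm_pendantCurve]; linarith
    · rw [pendantArc_some]
      exact (radialShrink.norm_le Γ.bdryPoints_nonempty Γ.norm_of_mem_bdryPoints
        (norm_arc_le e t)).trans_lt (Γ.arc_interior e t ht)
  arc_ne_pos := by
    rintro (_ | e) t ht (_ | v) h
    · have hp := Γ.pendant_param ht
      rw [pendantArc_none] at h
      have := Γ.pendantCurve_injOn hp.1.le hp.2.le Γ.angle_zero_lt_pendantAngle.le le_rfl h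
      linarith
    · have hp := Γ.pendant_param ht
      exact Γ.pendantCurve_ne hp.1 hp.2.le (norm_pos_le v) h
    · exact Γ.pendantCurve_ne Γ.angle_zero_lt_pendantAngle le_rfl (norm_arc_le e t) h.symm
    · exact Γ.arc_ne_pos e t ht v (radialShrink.injOn Γ.bdryPoints_nonempty
        Γ.norm_of_mem_bdryPoints (norm_arc_le e t) (norm_pos_le v) h)
  arc_disjoint := by
    rintro (_ | e) (_ | e') t ht t' ht' h
    · have hp := Γ.pendant_param ht
      have hp' := Γ.pendant_param ht'
      have := Γ.pendantCurve_injOn hp.1.le hp.2.le hp'.1.le hp'.2.le h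
      have h0 := Γ.angle_zero_lt_pendantAngle
      exact ⟨rfl, Subtype.ext (mul_right_cancel₀ (sub_pos.2 h0).ne' (add_left_cancel this))⟩
    · have hp := Γ.pendant_param ht
      exact absurd h (Γ.pendantCurve_ne hp.1 hp.2.le (norm_arc_le e' t'))
    · have hp := Γ.pendant_param ht'
      exact absurd h.symm (Γ.pendantCurve_ne hp.1 hp.2.le (norm_arc_le e t))
    · have := Γ.arc_disjoint e e' t ht t' ht' (radialShrink.injOn Γ.bdryPoints_nonempty
        Γ.norm_of_mem_bdryPoints (norm_arc_le e t) (norm_arc_le e' t') h)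
      exact ⟨congrArg some this.1, this.2⟩

end ElectricalNetwork

/-! ### Groves of the network with a pendant edge -/

namespace ElectricalNetwork

/-- Describing the deletion of an edge by its members makes acyclicity independent of a choice of
decidable equality. -/
theorem isGrove_iff {n : ℕ} {Γ : ElectricalNetwork n} {F : Finset Γ.E} : Γ.IsGrove F ↔
    (∀ e ∈ F, ∀ F' : Finset Γ.E, (∀ x, x ∈ F' ↔ x ∈ F ∧ x ≠ e) →
      ¬ Γ.conn F' (Γ.src e) (Γ.tgt e)) ∧ ∀ v, ∃ i, Γ.conn F v (Γ.bdry i) := by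
  classical
  refine and_congr_left fun _ => forall₂_congr fun e _ => ⟨fun h F' hF' => ?_, fun h => ?_⟩
  · convert h
    ext x
    rw [hF', Finset.mem_erase, and_comm]
  · convert h (F.erase e) (fun x => by rw [Finset.mem_erase, and_comm])

variable {n : ℕ} {Γ : ElectricalNetwork (n + 1)} {w : ℝ} {hw : 0 < w}

/-- The pendant edge is contracted: `getD` sends the new vertex to the boundary vertex it hangs
from. -/
theorem conn_eraseNone_of_conn {F : Finset (Option Γ.E)} {x y : Option Γ.V}
    (h : (Γ.addPendant w hw).conn F x y) :
    Γ.conn (Finset.eraseNone F) (x.getD (Γ.bdry 0)) (y.getD (Γ.bdry 0)) := by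
  have h' : Relation.EqvGen (fun u v => ∃ e ∈ F, (Γ.addPendant w hw).src e = u ∧
    (Γ.addPendant w hw).tgt e = v) x y := h
  clear h
  induction h' with
  | rel x y h =>
    obtain ⟨e | e, he, rfl, rfl⟩ := h
    · exact (Γ.conn _).refl _
    · exact conn_src_tgt (Finset.mem_eraseNone.2 he)
  | refl x => exact (Γ.conn _).refl _
  | symm x y _ ih => exact (Γ.conn _).symm ih
  | trans x y z _ _ ih1 ih2 => exact (Γ.conn _).trans ih1 ih2

theorem conn_addPendant_some_iff {F : Finset (Option Γ.E)} {u v : Γ.V} :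
    (Γ.addPendant w hw).conn F (some u) (some v) ↔ Γ.conn (Finset.eraseNone F) u v := by
  refine ⟨fun h => conn_eraseNone_of_conn h, fun h => ?_⟩
  have h' : Relation.EqvGen (fun u v => ∃ e ∈ Finset.eraseNone F, Γ.src e = u ∧ Γ.tgt e = v) u v := h
  clear h
  induction h' with
  | rel x y h =>
    obtain ⟨e, he, rfl, rfl⟩ := h
    exact conn_src_tgt (Γ := Γ.addPendant w hw) (e := some e) (Finset.mem_eraseNone.1 he)
  | refl x => exact ((Γ.addPendant w hw).conn F).refl _
  | symm x y _ ih => exact ((Γ.addPendant w hw).conn F).symm ih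
  | trans x y z _ _ ih1 ih2 => exact ((Γ.addPendant w hw).conn F).trans ih1 ih2

theorem eq_none_iff_of_conn_addPendant {F : Finset (Option Γ.E)} (hF : none ∉ F)
    {x y : Option Γ.V} (h : (Γ.addPendant w hw).conn F x y) : x = none ↔ y = none := by
  have h' : Relation.EqvGen (fun u v => ∃ e ∈ F, (Γ.addPendant w hw).src e = u ∧
    (Γ.addPendant w hw).tgt e = v) x y := h
  clear h
  induction h' with
  | rel x y h =>
    obtain ⟨e | e, he, rfl, rfl⟩ := h
    · exact absurd he hF
    · simp
  | refl x => exact Iff.rfl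
  | symm x y _ ih => exact ih.symm
  | trans x y z _ _ ih1 ih2 => exact ih1.trans ih2

/-- The new vertex is interior and must be connected to the boundary, which only the pendant edge
can do. That edge never closes a cycle and does not change the other connections. -/
theorem isGrove_addPendant_iff {F : Finset (Option Γ.E)} :
    (Γ.addPendant w hw).IsGrove F ↔ none ∈ F ∧ Γ.IsGrove (Finset.eraseNone F) := by
  refine isGrove_iff.trans (Iff.trans ?_ (and_congr_right' isGrove_iff.symm))
  constructor
  · rintro ⟨h1, h2⟩
    refine ⟨?_, ?_, ?_⟩
    · by_contra hF
      obtain ⟨i, hi⟩ := h2 none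
      have := (eq_none_iff_of_conn_addPendant hF hi).1 rfl
      exact absurd this (Option.some_ne_none _)
    · intro e he F' hF' hc
      obtain ⟨F'', hF''⟩ : ∃ F'' : Finset (Option Γ.E), ∀ x, x ∈ F'' ↔ x ∈ F ∧ x ≠ some e := by
        classical
        exact ⟨F.erase (some e), by simp [and_comm]⟩
      refine h1 (some e) (Finset.mem_eraseNone.1 he) F'' hF'' (conn_addPendant_some_iff.2 ?_)
      convert hc
      ext x
      simp [hF', hF'']
    · intro v
      obtain ⟨i, hi⟩ := h2 (some v)
      exact ⟨i, conn_addPendant_some_iff.1 hi⟩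
  · rintro ⟨h0, h1, h2⟩
    refine ⟨?_, ?_⟩
    · rintro (_ | e) he F' hF' hc
      · have := (eq_none_iff_of_conn_addPendant (F := F') (by simp [hF']) hc).2 rfl
        exact absurd this (Option.some_ne_none _)
      · refine h1 e (Finset.mem_eraseNone.2 he) (Finset.eraseNone F') ?_
          (conn_addPendant_some_iff.1 hc)
        intro x
        simp [hF']
    · rintro (_ | v)
      · exact ⟨0, ((Γ.addPendant w hw).conn F).symm
          (conn_src_tgt (Γ := Γ.addPendant w hw) (e := none) h0)⟩
      · obtain ⟨i, hi⟩ := h2 v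
        exact ⟨i, conn_addPendant_some_iff.2 hi⟩

theorem boundaryPartition_addPendant (F : Finset (Option Γ.E)) :
    (Γ.addPendant w hw).boundaryPartition F = Γ.boundaryPartition (Finset.eraseNone F) :=
  Setoid.ext fun _ _ => conn_addPendant_some_iff

/-- A pendant edge scales all grove measurements by its weight. -/
theorem groveMeasurement_addPendant (σ : NCPartition (n + 1)) :
    (Γ.addPendant w hw).groveMeasurement σ = w * Γ.groveMeasurement σ := by
  classical
  suffices h : ∀ s : Setoid (Fin (n + 1)),
      ∑ F : Finset (Option Γ.E) with (Γ.addPendant w hw).IsGrove F ∧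
        (Γ.addPendant w hw).boundaryPartition F = s, ∏ e ∈ F, (e.elim w Γ.wt : ℝ) =
      w * ∑ F : Finset Γ.E with Γ.IsGrove F ∧ Γ.boundaryPartition F = s, ∏ e ∈ F, Γ.wt e by
    have h' := h σ.1
    unfold groveMeasurement
    convert h'
  intro s
  rw [Finset.mul_sum]
  symm
  refine Finset.sum_bij' (fun F _ => Finset.insertNone F) (fun F _ => Finset.eraseNone F)
    ?_ ?_ ?_ ?_ ?_
  · intro F hF
    simp only [Finset.mem_filter, Finset.mem_univ, true_and] at hF ⊢
    rw [isGrove_addPendant_iff, boundaryPartition_addPendant, Finset.eraseNone_insertNone]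
    exact ⟨⟨Finset.none_mem_insertNone, hF.1⟩, hF.2⟩
  · intro F hF
    simp only [Finset.mem_filter, Finset.mem_univ, true_and] at hF ⊢
    rw [isGrove_addPendant_iff, boundaryPartition_addPendant] at hF
    exact ⟨hF.1.2, hF.2⟩
  · intro F _
    exact Finset.eraseNone_insertNone F
  · intro F hF
    simp only [Finset.mem_filter, Finset.mem_univ, true_and] at hF
    rw [isGrove_addPendant_iff] at hF
    rw [Finset.insertNone_eraseNone]
    exact Finset.insert_eq_self.2 hF.1.1
  · intro F _
    exact (Finset.prod_insertNone (fun e : Option Γ.E => (e.elim w Γ.wt : ℝ)) F).symm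

end ElectricalNetwork

/-! ### Quotients by homogeneous ideals -/

section HomogeneousQuotient
open MvPolynomial

variable {τ : Type*}

theorem MvPolynomial.aeval_smul_of_isHomogeneous {f : MvPolynomial τ ℂ} {d : ℕ}
    (hf : f.IsHomogeneous d) (c : ℂ) (x : τ → ℂ) :
    aeval (c • x) f = c ^ d * aeval x f := by
  rw [aeval_def, aeval_def, eval₂_eq, eval₂_eq, Finset.mul_sum]
  refine Finset.sum_congr rfl fun m hm => ?_
  have hd : m.degree = d := by
    rw [Finsupp.degree_eq_weight_one]
    exact hf (mem_support_iff.1 hm)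
  have : ∏ i ∈ m.support, (c • x) i ^ m i = c ^ d * ∏ i ∈ m.support, x i ^ m i := by
    simp only [Pi.smul_apply, smul_eq_mul, mul_pow]
    rw [Finset.prod_mul_distrib, Finset.prod_pow_eq_pow_sum, ← hd]
    rfl
  rw [this]
  ring

/-- A polynomial that vanishes at infinitely many multiples of a point has homogeneous components
that vanish at this point. -/
theorem MvPolynomial.aeval_homogeneousComponent_eq_zero {f : MvPolynomial τ ℂ} {x : τ → ℂ}
    (h : {c : ℂ | aeval (c • x) f = 0}.Infinite) (d : ℕ) :
    aeval x (homogeneousComponent d f) = 0 := by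
  classical
  -- As a polynomial in `c`, the value of `f` at `c • x` has the values of the homogeneous
  -- components at `x` as coefficients.
  set q : Polynomial ℂ := ∑ k ∈ Finset.range (f.totalDegree + 1),
    Polynomial.C (aeval x (homogeneousComponent k f)) * Polynomial.X ^ k with hq
  have hev : ∀ c, q.eval c = aeval (c • x) f := by
    intro c
    conv_rhs => rw [← sum_homogeneousComponent f]
    rw [map_sum, hq, Polynomial.eval_finsetSum]
    refine Finset.sum_congr rfl fun k _ => ?_
    rw [aeval_smul_of_isHomogeneous (homogeneousComponent_isHomogeneous k f)]
    rw [Polynomial.eval_mul, Polynomial.eval_C, Polynomial.eval_pow, Polynomial.eval_X, mul_comm]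
  have hq0 : q = 0 := by
    refine Polynomial.eq_zero_of_infinite_isRoot q ?_
    convert h using 3 with c
    rw [Polynomial.IsRoot.def, hev]
  rcases le_or_gt d f.totalDegree with hd | hd
  · have := congrArg (fun p => Polynomial.coeff p d) hq0
    simp only [hq, Polynomial.finsetSum_coeff, Polynomial.coeff_C_mul, Polynomial.coeff_X_pow,
      Polynomial.coeff_zero] at this
    simpa [Finset.sum_ite_eq, Nat.lt_succ_iff, hd] using this
  · rw [homogeneousComponent_eq_zero d f hd, map_zero]

/-- The set need not be a cone: infinitely many scalars per point suffice. This matters for grove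
vectors, where positive real scalars are used. -/
theorem MvPolynomial.homogeneousComponent_mem_vanishingIdeal {S : Set (τ → ℂ)}
    (hS : ∀ x ∈ S, {c : ℂ | c • x ∈ S}.Infinite) {f : MvPolynomial τ ℂ}
    (hf : f ∈ vanishingIdeal ℂ S) (d : ℕ) : homogeneousComponent d f ∈ vanishingIdeal ℂ S :=
  fun x hx => aeval_homogeneousComponent_eq_zero ((hS x hx).mono fun _ hc => hf _ hc) d

/-- The quotient of a polynomial ring by a homogeneous ideal is graded by degree. -/
theorem MvPolynomial.nonempty_gradedAlgebra_quotient (I : Ideal (MvPolynomial τ ℂ))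
    (hI : ∀ f ∈ I, ∀ d, homogeneousComponent d f ∈ I) :
    Nonempty (GradedAlgebra fun d : ℕ =>
      (homogeneousSubmodule τ ℂ d).map (Ideal.Quotient.mkₐ ℂ I).toLinearMap) := by
  classical
  set A : ℕ → Submodule ℂ (MvPolynomial τ ℂ ⧸ I) := fun d =>
    (homogeneousSubmodule τ ℂ d).map (Ideal.Quotient.mkₐ ℂ I).toLinearMap with hA
  have hmon : SetLike.GradedMonoid A :=
    { one_mem := ⟨1, isHomogeneous_one τ ℂ, map_one (Ideal.Quotient.mkₐ ℂ I)⟩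
      mul_mem := by
        rintro i j _ _ ⟨f, hf, rfl⟩ ⟨g, hg, rfl⟩
        exact ⟨f * g, IsHomogeneous.mul hf hg, map_mul (Ideal.Quotient.mkₐ ℂ I) f g⟩ }
  have hint : DirectSum.IsInternal A := by
    constructor
    · rw [injective_iff_map_eq_zero]
      intro x hx
      rw [DirectSum.coeAddMonoidHom_eq_dfinsuppSum] at hx
      choose f hf hfx using fun i => (x i).2
      -- A linear relation between the pieces lifts to a polynomial in `I`, whose homogeneous
      -- components are the lifts of the summands.
      have hmem : ∑ i ∈ DFinsupp.support x, f i ∈ I := by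
        rw [← Ideal.Quotient.eq_zero_iff_mem, map_sum, ← hx]
        exact Finset.sum_congr rfl fun i _ => hfx i
      ext i
      by_cases hi : i ∈ DFinsupp.support x
      · have h2 := hI _ hmem i
        rw [map_sum, Finset.sum_congr rfl fun j _ => homogeneousComponent_of_mem (hf j)] at h2
        rw [Finset.sum_ite_eq, if_pos hi] at h2
        rw [← hfx i]
        exact Ideal.Quotient.eq_zero_iff_mem.2 h2
      · rw [DFinsupp.notMem_support_iff.1 hi]; rfl
    · intro y
      obtain ⟨f, rfl⟩ := Ideal.Quotient.mk_surjective y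
      rw [← sum_homogeneousComponent f, map_sum]
      refine ⟨∑ k ∈ Finset.range (f.totalDegree + 1), DirectSum.of (fun d => A d) k
        ⟨Ideal.Quotient.mk I (homogeneousComponent k f), homogeneousComponent k f,
          homogeneousComponent_isHomogeneous k f, rfl⟩, ?_⟩
      rw [map_sum]
      exact Finset.sum_congr rfl fun k _ => DirectSum.coeAddMonoidHom_of A k _
  exact ⟨{ hmon, hint.chooseDecomposition with }⟩

end HomogeneousQuotient

/-- Pendant edges turn every positive multiple of a grove vector into a grove vector. -/
theorem nonempty_gradedAlgebra_grovePiece (n : ℕ) :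
    Nonempty (GradedAlgebra (grovePiece (n + 1))) := by
  refine MvPolynomial.nonempty_gradedAlgebra_quotient _ fun f hf d =>
    MvPolynomial.homogeneousComponent_mem_vanishingIdeal ?_ hf d
  rintro _ ⟨Γ, rfl⟩
  refine Set.Infinite.mono (s := (fun r : ℝ => (r : ℂ)) '' Set.Ioi 0) ?_
    ((Set.Ioi_infinite 0).image Complex.ofReal_injective.injOn)
  rintro _ ⟨w, hw, rfl⟩
  refine ⟨Γ.addPendant w hw, funext fun σ => ?_⟩
  exact (congrArg Complex.ofReal
    (ElectricalNetwork.groveMeasurement_addPendant σ)).trans (Complex.ofReal_mul _ _)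

theorem nonempty_gradedAlgebra_pluckerPiece (k m : ℕ) :
    Nonempty (GradedAlgebra (pluckerPiece k m)) := by
  refine MvPolynomial.nonempty_gradedAlgebra_quotient _ fun f hf d =>
    MvPolynomial.homogeneousComponent_mem_vanishingIdeal ?_ hf d
  rintro _ ⟨W, A, hA, c, hc, rfl⟩
  refine Set.Infinite.mono (s := {0}ᶜ) ?_ (Set.finite_singleton 0).infinite_compl
  intro b hb
  refine ⟨W, A, hA, b * c, mul_ne_zero hb hc, funext fun I => ?_⟩
  simp [mul_assoc]

/-! ### Plücker coordinates as functions of tuples -/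

/-- The sign of the permutation that sorts an injective tuple, zero for other tuples. -/
def tupleSign {k m : ℕ} (f : Fin k → Fin m) : ℤ :=
  Int.sign (Matrix.vandermonde fun i => ((f i : ℕ) : ℤ)).det

section TupleSign

variable {k m : ℕ}

theorem tupleSign_comp_perm (f : Fin k → Fin m) (τ : Equiv.Perm (Fin k)) :
    tupleSign (f ∘ τ) = Equiv.Perm.sign τ * tupleSign f := by
  unfold tupleSign
  have : (Matrix.vandermonde fun i => (((f ∘ τ) i : ℕ) : ℤ)) =
      (Matrix.vandermonde fun i => ((f i : ℕ) : ℤ)).submatrix τ id := rfl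
  rw [this, Matrix.det_permute, Int.sign_mul]
  rcases Int.units_eq_one_or (Equiv.Perm.sign τ) with h | h <;> simp [h]

theorem tupleSign_of_strictMono {f : Fin k → Fin m} (hf : StrictMono f) : tupleSign f = 1 := by
  unfold tupleSign
  rw [Matrix.det_vandermonde]
  · refine Int.sign_eq_one_of_pos (Finset.prod_pos fun i _ => Finset.prod_pos fun j hj => ?_)
    have : f i < f j := hf (Finset.mem_Ioi.1 hj)
    have : (f i : ℕ) < f j := this
    omega

theorem tupleSign_mul_self {f : Fin k → Fin m} (hf : Function.Injective f) :
    tupleSign f * tupleSign f = 1 := by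
  unfold tupleSign
  have h : (Matrix.vandermonde fun i => ((f i : ℕ) : ℤ)).det ≠ 0 := by
    rw [Matrix.det_vandermonde_ne_zero_iff]
    intro i j h
    exact hf (Fin.ext (Nat.cast_injective (R := ℤ) h))
  rcases lt_or_gt_of_ne h with h | h
  · rw [Int.sign_eq_neg_one_of_neg h]; rfl
  · rw [Int.sign_eq_one_of_pos h]; rfl

theorem exists_perm_orderEmbOfFin {f : Fin k → Fin m} (hf : Function.Injective f)
    (I : KSubset k m) (hI : ∀ i, f i ∈ I.1) :
    ∃ τ : Equiv.Perm (Fin k), (I.1.orderEmbOfFin I.2) ∘ τ = f := by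
  let g : Fin k → Fin k := fun i => (I.1.orderIsoOfFin I.2).symm ⟨f i, hI i⟩
  have hg : Function.Injective g := by
    intro i j h
    have := (I.1.orderIsoOfFin I.2).symm.injective h
    exact hf (congrArg Subtype.val this)
  refine ⟨Equiv.ofBijective g (Finite.injective_iff_bijective.1 hg), funext fun i => ?_⟩
  simp [g, ← Finset.coe_orderIsoOfFin_apply]

end TupleSign

/-- The Plücker relations for a function of tuples of columns. -/
structure IsPluckerFunction {k m : ℕ} (P : (Fin k → Fin m) → ℂ) : Prop where
  comp_perm : ∀ f (τ : Equiv.Perm (Fin k)), P (f ∘ τ) = (Equiv.Perm.sign τ : ℤ) * P f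
  eq_zero : ∀ f, ¬ Function.Injective f → P f = 0
  exchange : ∀ f g i, P f * P g =
    ∑ j, P (Function.update f i (g j)) * P (Function.update g j (f i))

/-- By Cramer's rule `y.det` times column `i` of `x` is a combination of the columns of `y`, with
coefficients `det (y.updateCol j x_i)`; now expand the determinant of `x` linearly in column `i`. -/
theorem Matrix.det_mul_det_eq_sum_updateCol {ι : Type*} [Fintype ι] [DecidableEq ι]
    (x y : Matrix ι ι ℂ) (i : ι) : x.det * y.det =
      ∑ j, (x.updateCol i (fun r => y r j)).det * (y.updateCol j (fun r => x r i)).det := by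
  have h1 : y.mulVec (y.cramer fun r => x r i) = y.det • fun r => x r i :=
    Matrix.mulVec_cramer y _
  have h2 : y.mulVec (y.cramer fun r => x r i) =
      ∑ j, y.cramer (fun r => x r i) j • fun r => y r j := by
    ext r
    simp [Matrix.mulVec, dotProduct, mul_comm]
  rw [mul_comm]
  calc y.det * x.det = x.cramer (y.det • fun r => x r i) i := by
        rw [map_smul, Pi.smul_apply, Matrix.cramer_apply, smul_eq_mul]
        congr 2
        exact (Matrix.updateCol_eq_self x i).symm
    _ = x.cramer (∑ j, y.cramer (fun r => x r i) j • fun r => y r j) i := by rw [← h1, h2]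
    _ = _ := by
        rw [map_sum, Finset.sum_apply]
        refine Finset.sum_congr rfl fun j _ => ?_
        rw [map_smul, Pi.smul_apply, Matrix.cramer_apply, Matrix.cramer_apply, smul_eq_mul,
          mul_comm]

/-- Determinants of square matrices, some columns of which vary in a fixed family of vectors,
satisfy the Plücker relations. -/
theorem isPluckerFunction_det {k m : ℕ} {ι : Type*} [Fintype ι] [DecidableEq ι]
    (N : (Fin k → Fin m) → Matrix ι ι ℂ) (c : Fin k ↪ ι) (X : Fin m → ι → ℂ)
    (hc : ∀ f i r, N f r (c i) = X (f i) r)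
    (hN : ∀ f g r s, s ∉ Set.range c → N f r s = N g r s) :
    IsPluckerFunction fun f => (N f).det := by
  refine ⟨fun f τ => ?_, fun f hf => ?_, fun f g i => ?_⟩
  · have h : N (f ∘ τ) = (N f).submatrix id (τ.viaFintypeEmbedding c) := by
      ext r s
      by_cases hs : s ∈ Set.range c
      · obtain ⟨i, rfl⟩ := hs
        rw [Matrix.submatrix_apply, Equiv.Perm.viaFintypeEmbedding_apply_image, hc, hc]
        rfl
      · rw [Matrix.submatrix_apply, Equiv.Perm.viaFintypeEmbedding_apply_notMem_range _ _ hs]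
        exact hN _ _ _ _ hs
    change (N (f ∘ τ)).det = _
    rw [h, Matrix.det_permute', Equiv.Perm.viaFintypeEmbedding_sign]
  · obtain ⟨i, j, hij, hne⟩ : ∃ i j, f i = f j ∧ i ≠ j := by
      simpa [Function.Injective] using hf
    exact Matrix.det_zero_of_column_eq (c.injective.ne hne) fun r => by rw [hc, hc, hij]
  · have hup : ∀ (f : Fin k → Fin m) i a,
        (N f).updateCol (c i) (X a) = N (Function.update f i a) := by
      intro f i a
      ext r s
      rcases eq_or_ne s (c i) with rfl | hs
      · rw [Matrix.updateCol_self, hc, Function.update_self]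
      · rw [Matrix.updateCol_ne hs]
        by_cases h : s ∈ Set.range c
        · obtain ⟨j, rfl⟩ := h
          rw [hc, hc, Function.update_of_ne]
          rintro rfl; exact hs rfl
        · exact hN _ _ _ _ h
    change (N f).det * (N g).det = _
    rw [Matrix.det_mul_det_eq_sum_updateCol _ _ (c i)]
    have hcol : ∀ (f : Fin k → Fin m) i, (fun r => N f r (c i)) = X (f i) :=
      fun f i => funext fun r => hc f i r
    -- Exchange with a fixed column contributes nothing, since the first matrix then contains that
    -- column twice.
    rw [← Finset.sum_subset (Finset.subset_univ (Finset.univ.map c))]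
    · rw [Finset.sum_map]
      refine Finset.sum_congr rfl fun j _ => ?_
      rw [hcol, hcol, hup, hup]
    · intro s _ hs
      have hs' : s ∉ Set.range c := by
        rintro ⟨j, rfl⟩; simp at hs
      have hne : s ≠ c i := fun h => hs' ⟨i, h.symm⟩
      rw [Matrix.det_zero_of_column_eq (M := (N f).updateCol (c i) fun r => N g r s) hne, zero_mul]
      intro r
      rw [Matrix.updateCol_self, Matrix.updateCol_ne hne]
      exact hN _ _ _ _ hs'

theorem isPluckerFunction_minor {k m : ℕ} (A : Matrix (Fin k) (Fin m) ℂ) :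
    IsPluckerFunction fun f : Fin k → Fin m => (A.submatrix id f).det :=
  isPluckerFunction_det (fun f => A.submatrix id f) (Function.Embedding.refl _)
    (fun a r => A r a) (fun _ _ _ => rfl) fun _ _ _ s hs => absurd ⟨s, rfl⟩ hs

namespace IsPluckerFunction

variable {k m : ℕ} {P : (Fin k → Fin m) → ℂ}

theorem eq_tupleSign_mul (hP : IsPluckerFunction P) {f : Fin k → Fin m}
    (hf : Function.Injective f) (I : KSubset k m) (hI : ∀ i, f i ∈ I.1) :
    P f = tupleSign f * P (I.1.orderEmbOfFin I.2) := by
  obtain ⟨τ, rfl⟩ := exists_perm_orderEmbOfFin hf I hI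
  rw [hP.comp_perm, tupleSign_comp_perm, tupleSign_of_strictMono (OrderEmbedding.strictMono _),
    mul_one]

/-- The matrix with a given function of minors. -/
noncomputable def coordMatrix (P : (Fin k → Fin m) → ℂ) (g : Fin k → Fin m) :
    Matrix (Fin k) (Fin m) ℂ := Matrix.of fun j a => P (Function.update g j a) / P g

theorem coordMatrix_apply_self (hP : IsPluckerFunction P) {g : Fin k → Fin m} (hg : P g ≠ 0) :
    (coordMatrix P g).submatrix id g = 1 := by
  ext j l
  rw [Matrix.submatrix_apply, coordMatrix, Matrix.of_apply, id]
  rcases eq_or_ne j l with rfl | h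
  · rw [Function.update_eq_self, div_self hg, Matrix.one_apply_eq]
  · rw [Matrix.one_apply_ne h, hP.eq_zero, zero_div]
    intro hinj
    exact h (hinj (by rw [Function.update_self, Function.update_of_ne h.symm]))

/-- Induction on the number of entries of `f` outside the range of `g`. The exchange relation with
`g` replaces one such entry by an entry of `g`; it holds for `P` and for the minors, and the second
factors agree by construction of the matrix. -/
theorem eq_mul_minor (hP : IsPluckerFunction P) {g : Fin k → Fin m} (hg : P g ≠ 0)
    (f : Fin k → Fin m) : P f = P g * ((coordMatrix P g).submatrix id f).det := by
  classical
  set A := coordMatrix P g with hA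
  have hAg := hP.coordMatrix_apply_self hg
  induction hN : (Finset.univ.filter fun i => f i ∉ Set.range g).card generalizing f with
  | zero =>
    have hr : ∀ i, f i ∈ Set.range g := by
      intro i
      by_contra hi
      have := Finset.card_eq_zero.1 hN
      exact Finset.notMem_empty i (this ▸ Finset.mem_filter.2 ⟨Finset.mem_univ _, hi⟩)
    choose φ hφ using hr
    have hfφ : f = g ∘ φ := funext fun i => (hφ i).symm
    by_cases hinj : Function.Injective φ
    · have hf : f = g ∘ Equiv.ofBijective φ (Finite.injective_iff_bijective.1 hinj) := hfφ
      have : A.submatrix id f = (A.submatrix id g).submatrix id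
          (Equiv.ofBijective φ (Finite.injective_iff_bijective.1 hinj)) := by
        rw [Matrix.submatrix_submatrix, ← hf]; rfl
      rw [this, Matrix.det_permute', hAg, Matrix.det_one, hf, hP.comp_perm]
      ring
    · have hf : ¬ Function.Injective f := fun h => hinj (by
        rw [hfφ] at h; exact h.of_comp)
      rw [hP.eq_zero f hf, (isPluckerFunction_minor A).eq_zero f hf, mul_zero]
  | succ N ih =>
    obtain ⟨i, hi⟩ : (Finset.univ.filter fun i => f i ∉ Set.range g).Nonempty := by
      rw [← Finset.card_pos, hN]; omega
    have hi' : f i ∉ Set.range g := (Finset.mem_filter.1 hi).2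
    have hstep : ∀ j, P (Function.update f i (g j)) =
        P g * (A.submatrix id (Function.update f i (g j))).det := by
      intro j
      refine ih _ ?_
      have : (Finset.univ.filter fun l => Function.update f i (g j) l ∉ Set.range g) =
          (Finset.univ.filter fun l => f l ∉ Set.range g).erase i := by
        ext l
        rcases eq_or_ne l i with rfl | h
        · simp
        · simp [h]
      rw [this, Finset.card_erase_of_mem hi, hN]
      rfl
    have h1 := hP.exchange f g i
    have h2 : (A.submatrix id f).det * (A.submatrix id g).det = _ :=
      (isPluckerFunction_minor A).exchange f g i
    rw [hAg, Matrix.det_one, mul_one] at h2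
    have hcol : ∀ j, (A.submatrix id (Function.update g j (f i))).det * P g =
        P (Function.update g j (f i)) := by
      intro j
      have : A.submatrix id (Function.update g j (f i)) =
          (1 : Matrix (Fin k) (Fin k) ℂ).updateCol j (fun r => A r (f i)) := by
        rw [← hAg]
        ext r s
        rcases eq_or_ne s j with rfl | h
        · simp
        · simp [h, hA]
      rw [this, ← Matrix.cramer_apply, Matrix.cramer_one]
      simp [hA, coordMatrix, hg]
    apply mul_right_cancel₀ hg
    rw [h1, h2, Finset.mul_sum, Finset.sum_mul]
    refine Finset.sum_congr rfl fun j _ => ?_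
    rw [hstep j, ← hcol j]
    ring

/-- The columns `g` of `coordMatrix P g` form an identity block, so its rows span a `k`-dimensional
space, whose minors are `P` up to the scalar `P g`. -/
theorem exists_isPluckerVector (hP : IsPluckerFunction P) {g : Fin k → Fin m} (hg : P g ≠ 0) :
    ∃ W : Gr k m, IsPluckerVector W fun I => P (I.1.orderEmbOfFin I.2) := by
  set A := coordMatrix P g with hA
  have hAg := hP.coordMatrix_apply_self hg
  have hli : LinearIndependent ℂ A.row := by
    have h1 : LinearIndependent ℂ (A.submatrix id g).row := by
      rw [Matrix.linearIndependent_rows_iff_isUnit, hAg]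
      exact isUnit_one
    exact LinearIndependent.of_comp (LinearMap.funLeft ℂ ℂ g) h1
  refine ⟨⟨Submodule.span ℂ (Set.range A.row), ?_⟩, A, rfl, P g, hg, funext fun I =>
    hP.eq_mul_minor hg _⟩
  rw [finrank_span_eq_card hli, Fintype.card_fin]

end IsPluckerFunction

/-! ### The Plücker ideal -/

section PluckerIdeal
open MvPolynomial

variable {k m : ℕ}

/-- The extension of a vector of Plücker coordinates to all tuples of columns. -/
noncomputable def tupleCoord {R : Type*} [CommRing R] (p : KSubset k m → R)
    (f : Fin k → Fin m) : R :=
  open Classical in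
  if h : Function.Injective f then
    (tupleSign f : R) * p ⟨Finset.univ.image f, by rw [Finset.card_image_of_injective _ h]; simp⟩
  else 0

theorem tupleCoord_of_mem {R : Type*} [CommRing R] (p : KSubset k m → R) {f : Fin k → Fin m}
    (hf : Function.Injective f) (I : KSubset k m) (hI : ∀ i, f i ∈ I.1) :
    tupleCoord p f = tupleSign f * p I := by
  classical
  rw [tupleCoord, dif_pos hf]
  congr 2
  refine Subtype.ext (Finset.eq_of_subset_of_card_le ?_ ?_)
  · intro a ha
    obtain ⟨i, -, rfl⟩ := Finset.mem_image.1 ha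
    exact hI i
  · rw [I.2]
    simp [Finset.card_image_of_injective _ hf]

theorem tupleCoord_of_not_injective {R : Type*} [CommRing R] (p : KSubset k m → R)
    {f : Fin k → Fin m} (hf : ¬ Function.Injective f) : tupleCoord p f = 0 := dif_neg hf

theorem tupleCoord_orderEmbOfFin {R : Type*} [CommRing R] (p : KSubset k m → R)
    (I : KSubset k m) : tupleCoord p (I.1.orderEmbOfFin I.2) = p I := by
  rw [tupleCoord_of_mem p ((Finset.orderEmbOfFin _ _).injective) I fun i => Finset.orderEmbOfFin_mem _ _ _,
    tupleSign_of_strictMono (OrderEmbedding.strictMono _)]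
  simp

theorem exists_kSubset_of_injective {f : Fin k → Fin m} (hf : Function.Injective f) :
    ∃ I : KSubset k m, ∀ i, f i ∈ I.1 := by
  classical
  exact ⟨⟨Finset.univ.image f, by rw [Finset.card_image_of_injective _ hf]; simp⟩,
    fun i => Finset.mem_image_of_mem _ (Finset.mem_univ i)⟩

theorem aeval_tupleCoord (p : KSubset k m → ℂ) (f : Fin k → Fin m) :
    aeval p (tupleCoord (X : KSubset k m → MvPolynomial (KSubset k m) ℂ) f) = tupleCoord p f := by
  by_cases hf : Function.Injective f
  · obtain ⟨I, hI⟩ := exists_kSubset_of_injective hf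
    rw [tupleCoord_of_mem _ hf I hI, tupleCoord_of_mem _ hf I hI]
    simp
  · rw [tupleCoord_of_not_injective _ hf, tupleCoord_of_not_injective _ hf, map_zero]

theorem IsPluckerVector.tupleCoord_eq {W : Gr k m} {p : KSubset k m → ℂ}
    (h : IsPluckerVector W p) : ∃ (A : Matrix (Fin k) (Fin m) ℂ) (c : ℂ),
      ∀ f, tupleCoord p f = c * (A.submatrix id f).det := by
  obtain ⟨A, -, c, -, rfl⟩ := h
  refine ⟨A, c, fun f => ?_⟩
  by_cases hf : Function.Injective f
  · obtain ⟨I, hI⟩ := exists_kSubset_of_injective hf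
    rw [tupleCoord_of_mem _ hf I hI, (isPluckerFunction_minor A).eq_tupleSign_mul hf I hI,
      maxMinor]
    ring
  · rw [tupleCoord_of_not_injective _ hf, (isPluckerFunction_minor A).eq_zero f hf, mul_zero]

/-- Alternation is built into the extension to tuples. The exchange relations are polynomials that
vanish on all Plücker vectors, hence on the whole zero locus. -/
theorem isPluckerFunction_tupleCoord {p : KSubset k m → ℂ}
    (hp : p ∈ zeroLocus ℂ (pluckerIdeal k m)) : IsPluckerFunction (tupleCoord p) := by
  refine ⟨fun f τ => ?_, fun f hf => tupleCoord_of_not_injective p hf, fun f g i => ?_⟩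
  · by_cases hf : Function.Injective f
    · obtain ⟨I, hI⟩ := exists_kSubset_of_injective hf
      rw [tupleCoord_of_mem p (hf.comp τ.injective) I fun i => hI _, tupleCoord_of_mem p hf I hI,
        tupleSign_comp_perm]
      push_cast
      ring
    · rw [tupleCoord_of_not_injective p hf, tupleCoord_of_not_injective, mul_zero]
      intro h
      apply hf
      have := h.comp τ.symm.injective
      rwa [Function.comp_assoc, Equiv.self_comp_symm, Function.comp_id] at this
  · have hmem : (tupleCoord X f * tupleCoord X g - ∑ j, tupleCoord X (Function.update f i (g j)) *
        tupleCoord X (Function.update g j (f i)) : MvPolynomial (KSubset k m) ℂ) ∈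
          pluckerIdeal k m := by
      rintro q ⟨W, hW⟩
      obtain ⟨A, c, hA⟩ := hW.tupleCoord_eq
      simp only [map_sub, map_mul, map_sum, aeval_tupleCoord, hA]
      have h : (A.submatrix id f).det * (A.submatrix id g).det = _ :=
        (isPluckerFunction_minor A).exchange f g i
      rw [mul_mul_mul_comm, h, Finset.mul_sum, sub_eq_zero]
      exact Finset.sum_congr rfl fun j _ => by ring
    have := hp _ hmem
    simp only [map_sub, map_mul, map_sum, aeval_tupleCoord] at this
    exact sub_eq_zero.1 this

/-- The nonzero points of the affine cone over the Grassmannian are Plücker vectors. -/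
theorem exists_isPluckerVector_of_mem_zeroLocus {p : KSubset k m → ℂ}
    (hp : p ∈ zeroLocus ℂ (pluckerIdeal k m)) (h0 : p ≠ 0) : ∃ W : Gr k m, IsPluckerVector W p := by
  obtain ⟨I, hI⟩ := Function.ne_iff.1 h0
  have h := (isPluckerFunction_tupleCoord hp).exists_isPluckerVector
    (g := I.1.orderEmbOfFin I.2) (by rw [tupleCoord_orderEmbOfFin]; exact hI)
  simpa only [tupleCoord_orderEmbOfFin] using h

/-- The origin is not itself claimed to be a Plücker vector. A polynomial of the ideal vanishes on
all nonzero multiples of one Plücker vector, so its constant term is zero; `k ≤ m` provides that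
vector. -/
theorem zero_mem_zeroLocus_pluckerIdeal (hkm : k ≤ m) :
    (0 : KSubset k m → ℂ) ∈ zeroLocus ℂ (pluckerIdeal k m) := by
  let A : Matrix (Fin k) (Fin m) ℂ := Matrix.of fun i j => if Fin.castLE hkm i = j then 1 else 0
  have hA : (A.submatrix id (Fin.castLE hkm)).det ≠ 0 := by
    have : A.submatrix id (Fin.castLE hkm) = 1 := by
      ext i j
      simp [A, Matrix.one_apply]
    rw [this, Matrix.det_one]
    exact one_ne_zero
  obtain ⟨W, B, hB, c, hc, h⟩ := (isPluckerFunction_minor A).exists_isPluckerVector hA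
  intro f hf
  have h1 := aeval_homogeneousComponent_eq_zero (f := f)
    (x := fun I : KSubset k m => (A.submatrix id (I.1.orderEmbOfFin I.2)).det) (Set.Infinite.mono
      (s := {0}ᶜ) (fun b hb => hf _ ⟨W, B, hB, b * c, mul_ne_zero hb hc, ?_⟩)
      (Set.finite_singleton 0).infinite_compl) 0
  · rw [homogeneousComponent_zero, aeval_C] at h1
    rw [aeval_zero, ← h1]
    rfl
  · rw [h]
    funext I
    simp [mul_assoc]

theorem IsPluckerFunction.mem_zeroLocus (hkm : k ≤ m) {P : (Fin k → Fin m) → ℂ}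
    (hP : IsPluckerFunction P) :
    (fun I : KSubset k m => P (I.1.orderEmbOfFin I.2)) ∈ zeroLocus ℂ (pluckerIdeal k m) := by
  by_cases h : ∃ I : KSubset k m, P (I.1.orderEmbOfFin I.2) ≠ 0
  · obtain ⟨I, hI⟩ := h
    intro f hf
    exact hf _ (hP.exists_isPluckerVector hI)
  · push Not at h
    have : (fun I : KSubset k m => P (I.1.orderEmbOfFin I.2)) = 0 := funext h
    rw [this]
    exact zero_mem_zeroLocus_pluckerIdeal hkm

theorem exists_eq_mul_of_span_row_le {A B : Matrix (Fin k) (Fin m) ℂ}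
    (h : Submodule.span ℂ (Set.range B.row) ≤ Submodule.span ℂ (Set.range A.row)) :
    ∃ G : Matrix (Fin k) (Fin k) ℂ, B = G * A := by
  have hmem : ∀ i, ∃ c : Fin k → ℂ, ∑ j, c j • A.row j = B.row i := fun i =>
    (Submodule.mem_span_range_iff_exists_fun ℂ).1 (h (Submodule.subset_span ⟨i, rfl⟩))
  choose G hG using hmem
  refine ⟨Matrix.of G, ?_⟩
  ext i a
  have := congrFun (hG i) a
  simp only [Finset.sum_apply, Pi.smul_apply, smul_eq_mul, Matrix.row] at this
  rw [Matrix.mul_apply, ← this]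
  rfl

/-- Plücker vectors are unique up to scaling. -/
theorem IsPluckerVector.exists_smul_eq {W : Gr k m} {p q : KSubset k m → ℂ}
    (hp : IsPluckerVector W p) (hq : IsPluckerVector W q) : ∃ c : ℂ, c ≠ 0 ∧ q = c • p := by
  obtain ⟨A, hA, a, ha, rfl⟩ := hp
  obtain ⟨B, hB, b, hb, rfl⟩ := hq
  obtain ⟨G, rfl⟩ := exists_eq_mul_of_span_row_le (A := A) (B := B) (by rw [hA, hB])
  obtain ⟨H, hH⟩ := exists_eq_mul_of_span_row_le (A := G * A) (B := A) (by rw [hA, hB])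
  have hli : LinearIndependent ℂ A.row := by
    rw [linearIndependent_iff_card_eq_finrank_span, Set.finrank, hA, W.2, Fintype.card_fin]
  -- The two bases of the same space are related by `G` and `H`; independence of the rows of `A`
  -- allows cancellation in `H * G * A = A`.
  have hHG : H * G = 1 := by
    have hinj := Matrix.vecMul_injective_iff.2 hli
    ext i j
    have : Matrix.vecMul ((H * G) i) A = Matrix.vecMul ((1 : Matrix (Fin k) (Fin k) ℂ) i) A := by
      rw [← Matrix.mul_apply_eq_vecMul, ← Matrix.mul_apply_eq_vecMul, Matrix.one_mul,
        Matrix.mul_assoc, ← hH]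
    exact congrFun (hinj this) j
  have hdet : G.det ≠ 0 := by
    intro h0
    have := congrArg Matrix.det hHG
    rw [Matrix.det_mul, h0, mul_zero, Matrix.det_one] at this
    exact zero_ne_one this
  refine ⟨b * G.det / a, by positivity, funext fun I => ?_⟩
  have : maxMinor (G * A) I = G.det * maxMinor A I := by
    rw [maxMinor, maxMinor, ← Matrix.det_mul]
    rfl
  rw [this, Pi.smul_apply, smul_eq_mul]
  field_simp

end PluckerIdeal

/-! ### The places of boundary vertices and dual vertices -/

section Places

variable {n : ℕ}

theorem place_cases (p : Fin (2 * n)) : (∃ x, p = oddPlace x) ∨ ∃ x, p = evenPlace x := by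
  rcases Nat.mod_two_eq_zero_or_one p.1 with h | h
  · exact Or.inl ⟨⟨p / 2, by omega⟩, Fin.ext (by simp only [oddPlace]; omega)⟩
  · exact Or.inr ⟨⟨p / 2, by omega⟩, Fin.ext (by simp only [evenPlace]; omega)⟩

/-- Definition of functions of a place by cases. -/
def placeElim {α : Sort*} (a b : Fin n → α) (p : Fin (2 * n)) : α :=
  if p.1 % 2 = 0 then a ⟨p / 2, by omega⟩ else b ⟨p / 2, by omega⟩

@[simp] theorem placeElim_oddPlace {α : Sort*} (a b : Fin n → α) (x : Fin n) :
    placeElim a b (oddPlace x) = a x := by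
  unfold placeElim oddPlace
  rw [if_pos (by simp)]
  congr 1
  exact Fin.ext (by simp)

@[simp] theorem placeElim_evenPlace {α : Sort*} (a b : Fin n → α) (x : Fin n) :
    placeElim a b (evenPlace x) = b x := by
  unfold placeElim evenPlace
  rw [if_neg (by simp)]
  congr 1
  exact Fin.ext (by simp only; omega)

theorem oddPlace_injective : Function.Injective (oddPlace (n := n)) := by
  intro x y h
  have := congrArg Fin.val h
  simp only [oddPlace] at this
  exact Fin.ext (by omega)

theorem evenPlace_injective : Function.Injective (evenPlace (n := n)) := by
  intro x y h
  have := congrArg Fin.val h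
  simp only [evenPlace] at this
  exact Fin.ext (by omega)

@[simp] theorem oddPlace_inj {x y : Fin n} : oddPlace x = oddPlace y ↔ x = y :=
  oddPlace_injective.eq_iff

@[simp] theorem evenPlace_inj {x y : Fin n} : evenPlace x = evenPlace y ↔ x = y :=
  evenPlace_injective.eq_iff

@[simp] theorem oddPlace_ne_evenPlace (x y : Fin n) : oddPlace x ≠ evenPlace y := by
  intro h
  have := congrArg Fin.val h
  simp only [evenPlace, oddPlace] at this
  omega

@[simp] theorem evenPlace_ne_oddPlace (x y : Fin n) : evenPlace x ≠ oddPlace y :=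
  (oddPlace_ne_evenPlace y x).symm

theorem sum_places {M : Type*} [AddCommMonoid M] (G : Fin (2 * n) → M) :
    ∑ p, G p = ∑ x, G (oddPlace x) + ∑ x, G (evenPlace x) := by
  have hb : Function.Bijective (Sum.elim (oddPlace (n := n)) evenPlace) := by
    constructor
    · rintro (x | x) (y | y) h <;> simp_all
    · intro p
      rcases place_cases p with ⟨x, rfl⟩ | ⟨x, rfl⟩
      · exact ⟨Sum.inl x, rfl⟩
      · exact ⟨Sum.inr x, rfl⟩
  rw [← Fintype.sum_bijective _ hb _ G (fun _ => rfl), Fintype.sum_sum_type]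
  rfl

/-- The partition of all places into the parts of `σ` and of its dual. -/
def placeSetoid (σ : Setoid (Fin n)) : Setoid (Fin (2 * n)) where
  r p q := placeElim (fun x => placeElim (σ x) (fun _ => False) q)
    (fun x => placeElim (fun _ => False) (dualPartition σ x) q) p
  iseqv :=
    { refl := fun p => by
        rcases place_cases p with ⟨x, rfl⟩ | ⟨x, rfl⟩
        · simp
        · simp
      symm := by
        intro p q
        rcases place_cases p with ⟨x, rfl⟩ | ⟨x, rfl⟩ <;>
          rcases place_cases q with ⟨y, rfl⟩ | ⟨y, rfl⟩ <;> simp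
        · exact fun h => σ.symm h
        · exact fun h => (dualPartition σ).symm h
      trans := by
        intro p q r
        rcases place_cases p with ⟨x, rfl⟩ | ⟨x, rfl⟩ <;>
          rcases place_cases q with ⟨y, rfl⟩ | ⟨y, rfl⟩ <;>
          rcases place_cases r with ⟨z, rfl⟩ | ⟨z, rfl⟩ <;> simp
        · exact fun h => σ.trans h
        · exact fun h => (dualPartition σ).trans h }

variable {σ : Setoid (Fin n)}

theorem placeSetoid_def (p q : Fin (2 * n)) : placeSetoid σ p q ↔
    placeElim (fun x => placeElim (σ x) (fun _ => False) q)
      (fun x => placeElim (fun _ => False) (dualPartition σ x) q) p := Iff.rfl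

@[simp] theorem placeSetoid_oddPlace (x y : Fin n) :
    placeSetoid σ (oddPlace x) (oddPlace y) ↔ σ x y := by simp [placeSetoid_def]

@[simp] theorem placeSetoid_evenPlace (x y : Fin n) :
    placeSetoid σ (evenPlace x) (evenPlace y) ↔ dualPartition σ x y := by simp [placeSetoid_def]

@[simp] theorem not_placeSetoid_odd_even (x y : Fin n) :
    ¬ placeSetoid σ (oddPlace x) (evenPlace y) := by simp [placeSetoid_def]

@[simp] theorem not_placeSetoid_even_odd (x y : Fin n) :
    ¬ placeSetoid σ (evenPlace x) (oddPlace y) := by simp [placeSetoid_def]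

/-- Both conditions of concordance become one: the complement of `I` is a transversal of
`placeSetoid σ`. -/
theorem concordant_iff (I : Finset (Fin (2 * n))) :
    Concordant I σ ↔ ∀ p, ∃! q, placeSetoid σ p q ∧ q ∉ I := by
  have key : ∀ (ρ : Setoid (Fin n)) (pl : Fin n → Fin (2 * n)),
      (∀ B ∈ ρ.classes, ∃! i, i ∈ B ∧ pl i ∉ I) ↔ ∀ x, ∃! i, ρ x i ∧ pl i ∉ I := by
    intro ρ pl
    constructor
    · intro h x
      obtain ⟨i, hi, hu⟩ := h {y | ρ y x} (ρ.mem_classes x)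
      exact ⟨i, ⟨ρ.symm hi.1, hi.2⟩, fun j hj => hu j ⟨ρ.symm hj.1, hj.2⟩⟩
    · rintro h _ ⟨x, rfl⟩
      obtain ⟨i, hi, hu⟩ := h x
      exact ⟨i, ⟨ρ.symm hi.1, hi.2⟩, fun j hj => hu j ⟨ρ.symm hj.1, hj.2⟩⟩
  unfold Concordant
  rw [key σ, key (dualPartition σ)]
  constructor
  · rintro ⟨h1, h2⟩ p
    rcases place_cases p with ⟨x, rfl⟩ | ⟨x, rfl⟩
    · obtain ⟨i, hi, hu⟩ := h1 x
      refine ⟨oddPlace i, by simpa using hi, fun q hq => ?_⟩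
      rcases place_cases q with ⟨y, rfl⟩ | ⟨y, rfl⟩
      · exact congrArg _ (hu y (by simpa using hq))
      · simp at hq
    · obtain ⟨i, hi, hu⟩ := h2 x
      refine ⟨evenPlace i, by simpa using hi, fun q hq => ?_⟩
      rcases place_cases q with ⟨y, rfl⟩ | ⟨y, rfl⟩
      · simp at hq
      · exact congrArg _ (hu y (by simpa using hq))
  · intro h
    refine ⟨fun x => ?_, fun x => ?_⟩
    · obtain ⟨q, hq, hu⟩ := h (oddPlace x)
      rcases place_cases q with ⟨y, rfl⟩ | ⟨y, rfl⟩
      · exact ⟨y, by simpa using hq, fun z hz =>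
          oddPlace_injective (hu (oddPlace z) (by simpa using hz))⟩
      · simp at hq
    · obtain ⟨q, hq, hu⟩ := h (evenPlace x)
      rcases place_cases q with ⟨y, rfl⟩ | ⟨y, rfl⟩
      · simp at hq
      · exact ⟨y, by simpa using hq, fun z hz =>
          evenPlace_injective (hu (evenPlace z) (by simpa using hz))⟩

/-- The noncrossing property of a partition. -/
def IsNoncrossing (σ : Setoid (Fin n)) : Prop :=
  ∀ a b c d : Fin n, a < b → b < c → c < d → σ a c → σ b d → σ a b

/-- The working form of noncrossing: a part that enters the interval between two elements of another
part stays inside it. -/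
theorem IsNoncrossing.between (h : IsNoncrossing σ) {a b c d : Fin n} (hac : σ a c) (hab : ¬ σ a b)
    (hbd : σ b d) (hb : a < b ∧ b < c) : a < d ∧ d < c := by
  by_contra hd
  have hda : d ≠ a := by rintro rfl; exact hab (σ.symm hbd)
  have hdc : d ≠ c := by rintro rfl; exact hab (σ.trans hac (σ.symm hbd))
  rcases lt_or_gt_of_ne hda with h1 | h1
  · exact hab (σ.trans (σ.symm (h d a b c h1 hb.1 hb.2 (σ.symm hbd) hac)) (σ.symm hbd))
  · rcases lt_or_gt_of_ne hdc with h2 | h2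
    · exact hd ⟨h1, h2⟩
    · exact hab (h a b c d hb.1 hb.2 h2 hac hbd)

theorem dualPartition_def (a b : Fin n) : dualPartition σ a b ↔
    ∀ i j, σ i j → ((i ≤ a ↔ i ≤ b) ↔ (j ≤ a ↔ j ≤ b)) := Iff.rfl

/-- For `a ≤ b` the arc cut off by the chord is the interval `(a, b]`, and the condition says that
it is a union of parts. -/
theorem dualPartition_iff {a b : Fin n} (hab : a ≤ b) : dualPartition σ a b ↔
    ∀ i j, σ i j → (a < i ∧ i ≤ b) → (a < j ∧ j ≤ b) := by
  rw [dualPartition_def]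
  constructor
  · intro h i j hij hi
    have := h i j hij
    omega
  · intro h i j hij
    have h1 := h i j hij
    have h2 := h j i (σ.symm hij)
    omega

/-- Unions of parts are closed under differences, and `(a, b]` is `(a, c]` without `(b, d]`; nothing
about `σ` is needed. -/
theorem isNoncrossing_dualPartition (σ : Setoid (Fin n)) : IsNoncrossing (dualPartition σ) := by
  intro a b c d hab hbc hcd hac hbd
  rw [dualPartition_iff (by omega)] at *
  intro i j hij hi
  have h1 := hac i j hij
  have h2 := hac j i (σ.symm hij)
  have h3 := hbd i j hij
  have h4 := hbd j i (σ.symm hij)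
  omega

theorem oddPlace_lt_oddPlace {x y : Fin n} : oddPlace x < oddPlace y ↔ x < y := by
  simp only [Fin.lt_def, oddPlace]; omega

theorem evenPlace_lt_evenPlace {x y : Fin n} : evenPlace x < evenPlace y ↔ x < y := by
  simp only [Fin.lt_def, evenPlace]; omega

theorem oddPlace_lt_evenPlace {x y : Fin n} : oddPlace x < evenPlace y ↔ x ≤ y := by
  simp only [Fin.lt_def, Fin.le_def, evenPlace, oddPlace]; omega

theorem evenPlace_lt_oddPlace {x y : Fin n} : evenPlace x < oddPlace y ↔ x < y := by
  simp only [Fin.lt_def, evenPlace, oddPlace]; omega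

/-- The parts of a noncrossing partition and of its dual do not cross each other. -/
theorem IsNoncrossing.placeSetoid_between (h : IsNoncrossing σ) {p q r s : Fin (2 * n)}
    (hpr : placeSetoid σ p r) (hpq : ¬ placeSetoid σ p q) (hqs : placeSetoid σ q s)
    (hq : p < q ∧ q < r) : p < s ∧ s < r := by
  rcases place_cases p with ⟨x, rfl⟩ | ⟨x, rfl⟩ <;>
    rcases place_cases r with ⟨z, rfl⟩ | ⟨z, rfl⟩ <;>
    rcases place_cases q with ⟨y, rfl⟩ | ⟨y, rfl⟩ <;>
    rcases place_cases s with ⟨w, rfl⟩ | ⟨w, rfl⟩ <;>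
    simp only [placeSetoid_oddPlace, placeSetoid_evenPlace, not_placeSetoid_even_odd,
      not_placeSetoid_odd_even, oddPlace_lt_oddPlace, evenPlace_lt_evenPlace,
      oddPlace_lt_evenPlace, evenPlace_lt_oddPlace] at *
  · exact h.between hpr hpq hqs hq
  · have := hqs x z hpr
    omega
  · rw [dualPartition_iff (by omega)] at hpr
    have := hpr y w hqs
    omega
  · exact (isNoncrossing_dualPartition σ).between hpr hpq hqs hq

end Places

/-! ### Regions around a part of a noncrossing partition -/

section Regions

variable {N : ℕ} {σ : Setoid (Fin (N + 1))}

/-- The dual points after `y` and before `x` are in the same part, for consecutive elements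
`y < x` of a part. -/
theorem IsNoncrossing.dualPartition_of_consecutive (h : IsNoncrossing σ) {y x : Fin (N + 1)}
    (hyx : y < x) (hσ : σ y x) (hc : ∀ z, y < z → z < x → ¬ σ y z) :
    dualPartition σ y (x - 1) := by
  have hx : ((x - 1 : Fin (N + 1)) : ℕ) = x - 1 := by
    rw [Fin.coe_sub_one, if_neg (Fin.ne_zero_of_lt hyx)]
  rw [dualPartition_iff (by rw [Fin.le_def, hx]; omega)]
  intro i j hij hi
  have hb : y < i ∧ i < x := by
    rw [Fin.le_def, hx] at hi
    rw [Fin.lt_def, Fin.lt_def]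
    rw [Fin.lt_def] at hi
    omega
  have := h.between hσ (hc i hb.1 hb.2) hij hb
  rw [Fin.le_def, hx]
  rw [Fin.lt_def, Fin.lt_def] at this
  rw [Fin.lt_def]
  omega

/-- The dual points before the least and after the greatest element of a part are in the same
part. -/
theorem IsNoncrossing.dualPartition_of_extremal (h : IsNoncrossing σ) {y x : Fin (N + 1)}
    (hσ : σ y x) (hy : ∀ z, σ y z → y ≤ z) (hx : ∀ z, σ y z → z ≤ x) :
    dualPartition σ (y - 1) x := by
  have hyx := hx y (σ.refl y)
  have key : ∀ i j, σ i j → y ≤ i ∧ i ≤ x → y ≤ j ∧ j ≤ x := by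
    intro i j hij hi
    by_cases hyi : σ y i
    · exact ⟨hy j (σ.trans hyi hij), hx j (σ.trans hyi hij)⟩
    · have hb : y < i ∧ i < x :=
        ⟨lt_of_le_of_ne hi.1 (by rintro rfl; exact hyi (σ.refl _)),
          lt_of_le_of_ne hi.2 (by rintro rfl; exact hyi hσ)⟩
      have := h.between hσ hyi hij hb
      exact ⟨this.1.le, this.2.le⟩
  rw [dualPartition_def]
  intro i j hij
  have h1 := key i j hij
  have h2 := key j i (σ.symm hij)
  have hc := Fin.coe_sub_one y
  simp only [Fin.le_def] at *
  have hi := i.2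
  have hj := j.2
  -- For `y = 0` the index `y - 1` wraps around to the last dual point.
  split_ifs at hc with h0
  · rw [h0] at h1 h2
    simp only [Fin.val_zero] at h1 h2
    rw [hc]
    omega
  · have : (y : ℕ) ≠ 0 := fun h => h0 (Fin.ext h)
    rw [hc]
    omega

theorem not_dualPartition_of_separated {a b i j : Fin (N + 1)} (hij : σ i j) (hi : a < i ∧ i ≤ b)
    (hj : ¬ (a < j ∧ j ≤ b)) : ¬ dualPartition σ a b := by
  intro h
  rw [dualPartition_iff (by omega)] at h
  exact hj (h i j hij hi)

/-- The dual point after an element of a part lies in the same region as the one before the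
cyclically next element. Passing to the next or the previous element exchanges the two sides. -/
theorem exists_dualPartition_iff (h : IsNoncrossing σ) (x₀ b₀ : Fin (N + 1)) :
    (∃ x, σ x₀ x ∧ dualPartition σ b₀ x) ↔ ∃ x, σ x₀ x ∧ dualPartition σ b₀ (x - 1) := by
  classical
  set s : Finset (Fin (N + 1)) := Finset.univ.filter fun z => σ x₀ z with hs
  have hmem : ∀ z, z ∈ s ↔ σ x₀ z := fun z => by simp [hs]
  have hne : s.Nonempty := ⟨x₀, (hmem _).2 (σ.refl _)⟩
  have hmin : dualPartition σ (s.min' hne - 1) (s.max' hne) := by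
    have h1 := (hmem _).1 (s.min'_mem hne)
    have h2 := (hmem _).1 (s.max'_mem hne)
    exact h.dualPartition_of_extremal (σ.trans (σ.symm h1) h2)
      (fun z hz => s.min'_le z ((hmem z).2 (σ.trans h1 hz)))
      (fun z hz => s.le_max' z ((hmem z).2 (σ.trans h1 hz)))
  constructor
  · rintro ⟨x, hx, hb⟩
    set t := s.filter fun z => x < z with ht
    by_cases hts : t.Nonempty
    · have hm := Finset.mem_filter.1 (t.min'_mem hts)
      refine ⟨t.min' hts, (hmem _).1 hm.1, (dualPartition σ).trans hb
        (h.dualPartition_of_consecutive hm.2 (σ.trans (σ.symm hx) ((hmem _).1 hm.1)) ?_)⟩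
      intro z hz hz' hσ
      exact absurd (t.min'_le z (Finset.mem_filter.2 ⟨(hmem z).2 (σ.trans hx hσ), hz⟩))
        (not_le.2 hz')
    · have hxm : x = s.max' hne := by
        refine le_antisymm (s.le_max' x ((hmem x).2 hx)) ?_
        by_contra hlt
        exact hts ⟨s.max' hne, Finset.mem_filter.2 ⟨s.max'_mem hne, not_le.1 hlt⟩⟩
      refine ⟨s.min' hne, (hmem _).1 (s.min'_mem hne), (dualPartition σ).trans hb ?_⟩
      rw [hxm]
      exact (dualPartition σ).symm hmin
  · rintro ⟨x, hx, hb⟩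
    set t := s.filter fun z => z < x with ht
    by_cases hts : t.Nonempty
    · have hm := Finset.mem_filter.1 (t.max'_mem hts)
      refine ⟨t.max' hts, (hmem _).1 hm.1, (dualPartition σ).trans hb ((dualPartition σ).symm
        (h.dualPartition_of_consecutive hm.2 (σ.trans (σ.symm ((hmem _).1 hm.1)) hx) ?_))⟩
      intro z hz hz' hσ
      exact absurd (t.le_max' z (Finset.mem_filter.2
        ⟨(hmem z).2 (σ.trans ((hmem _).1 hm.1) hσ), hz'⟩)) (not_le.2 hz)
    · have hxm : x = s.min' hne := by
        refine le_antisymm ?_ (s.min'_le x ((hmem x).2 hx))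
        by_contra hlt
        exact hts ⟨s.min' hne, Finset.mem_filter.2 ⟨s.min'_mem hne, not_le.1 hlt⟩⟩
      refine ⟨s.max' hne, (hmem _).1 (s.max'_mem hne), (dualPartition σ).trans hb ?_⟩
      rw [hxm]
      exact hmin

/-- Two distinct elements of one part separate the dual points that follow them, so a region occurs
at most once behind elements of a given part. -/
theorem eq_of_dualPartition_of_rel {x y : Fin (N + 1)} (hσ : σ x y) (hd : dualPartition σ x y) :
    x = y := by
  by_contra hne
  rcases lt_or_gt_of_ne hne with hlt | hlt
  · exact not_dualPartition_of_separated (σ.symm hσ) ⟨hlt, le_rfl⟩ (fun h => lt_irrefl _ h.1) hd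
  · exact not_dualPartition_of_separated hσ ⟨hlt, le_rfl⟩ (fun h => lt_irrefl _ h.1)
      ((dualPartition σ).symm hd)

theorem eq_of_dualPartition_sub_one_of_rel {x y : Fin (N + 1)} (hσ : σ x y)
    (hd : dualPartition σ (x - 1) (y - 1)) : x = y := by
  have key : ∀ x y : Fin (N + 1), x < y → σ x y → ¬ dualPartition σ (x - 1) (y - 1) := by
    intro x y hlt hσ hd
    have hy : ((y - 1 : Fin (N + 1)) : ℕ) = y - 1 := by
      rw [Fin.coe_sub_one, if_neg (Fin.ne_zero_of_lt hlt)]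
    have hx := Fin.coe_sub_one x
    have hx2 := x.2
    have hy2 := y.2
    rw [Fin.lt_def] at hlt
    rw [dualPartition_def] at hd
    have := hd x y hσ
    simp only [Fin.le_def, hy] at this
    split_ifs at hx with h0
    · have h0' : (x : ℕ) = 0 := by rw [h0]; rfl
      omega
    · have h0' : (x : ℕ) ≠ 0 := fun h => h0 (Fin.ext h)
      omega
  by_contra hne
  rcases lt_or_gt_of_ne hne with hlt | hlt
  · exact key x y hlt hσ hd
  · exact key y x hlt (σ.symm hσ) ((dualPartition σ).symm hd)

theorem sum_ite_of_unique {α : Type*} [Fintype α] (p : α → Prop) [DecidablePred p]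
    (h : ∀ x y, p x → p y → x = y) [Decidable (∃ x, p x)] :
    ∑ x, (if p x then (1 : ℂ) else 0) = if ∃ x, p x then 1 else 0 := by
  classical
  split_ifs with he
  · obtain ⟨x, hx⟩ := he
    rw [Finset.sum_eq_single x]
    · rw [if_pos hx]
    · exact fun y _ hy => if_neg fun hpy => hy (h y x hpy hx)
    · simp
  · push Not at he
    exact Finset.sum_eq_zero fun x _ => if_neg (he x)

open Classical in
/-- A part of `σ` meets the boundary of a region as often in front of a dual point of the region as
behind one. -/
theorem sum_boundary_region_eq_zero (h : IsNoncrossing σ) (x₀ b₀ : Fin (N + 1)) :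
    ∑ x with σ x₀ x, ((if dualPartition σ b₀ x then (1 : ℂ) else 0) -
      if dualPartition σ b₀ (x - 1) then 1 else 0) = 0 := by
  rw [Finset.sum_sub_distrib, Finset.sum_filter, Finset.sum_filter, sub_eq_zero]
  simp only [← ite_and]
  rw [sum_ite_of_unique _ fun x y hx hy => eq_of_dualPartition_of_rel
      (σ.trans (σ.symm hx.1) hy.1) ((dualPartition σ).trans ((dualPartition σ).symm hx.2) hy.2),
    sum_ite_of_unique _ fun x y hx hy => eq_of_dualPartition_sub_one_of_rel
      (σ.trans (σ.symm hx.1) hy.1) ((dualPartition σ).trans ((dualPartition σ).symm hx.2) hy.2)]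
  simp only [exists_dualPartition_iff h x₀ b₀]

end Regions

/-! ### Transversals of the parts of a noncrossing partition and its dual -/

section Transversals

/-- Each `A`-representative in `S` is sent injectively to the `B`-representative of its class. Used
in both directions, this makes transversals equally large inside suitable sets. -/
theorem Setoid.card_filter_le_of_transversal {α : Type*} [DecidableEq α] (τ : Setoid α)
    {A B : α → Prop} [DecidablePred A] [DecidablePred B] (hA : ∀ p, ∃! q, τ p q ∧ A q)
    (hB : ∀ p, ∃! q, τ p q ∧ B q) (S : Finset α)
    (hS : ∀ q ∈ S, A q → ∀ s, τ q s → B s → s ∈ S) :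
    (S.filter A).card ≤ (S.filter B).card := by
  choose φ hφ hu using hB
  refine Finset.card_le_card_of_injOn φ ?_ ?_
  · intro q hq
    have hq' := Finset.mem_filter.1 hq
    exact Finset.mem_filter.2 ⟨hS q hq'.1 hq'.2 _ (hφ q).1 (hφ q).2, (hφ q).2⟩
  · intro q hq r hr h
    have hq' := Finset.mem_filter.1 hq
    have hr' := Finset.mem_filter.1 hr
    have hqr : τ q r := τ.trans (hφ q).1 (by rw [h]; exact τ.symm (hφ r).1)
    exact (hA q).unique ⟨τ.refl q, hq'.2⟩ ⟨hqr, hr'.2⟩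

variable {N : ℕ} {σ : Setoid (Fin (N + 1))}

/-- A place is canonical if it is not the least one of its part (boundary vertices), or not the
greatest one (dual vertices). -/
def IsCanonicalPlace (σ : Setoid (Fin (N + 1))) (p : Fin (2 * (N + 1))) : Prop :=
  placeElim (fun x => ∃ y < x, σ x y) (fun x => ∃ y > x, dualPartition σ x y) p

@[simp] theorem isCanonicalPlace_oddPlace (x : Fin (N + 1)) :
    IsCanonicalPlace σ (oddPlace x) ↔ ∃ y < x, σ x y := by simp [IsCanonicalPlace]

@[simp] theorem isCanonicalPlace_evenPlace (x : Fin (N + 1)) :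
    IsCanonicalPlace σ (evenPlace x) ↔ ∃ y > x, dualPartition σ x y := by simp [IsCanonicalPlace]

theorem exists_least_of_part {n : ℕ} (ρ : Setoid (Fin n)) (x : Fin n) :
    ∃! y, ρ x y ∧ ¬ ∃ z < y, ρ y z := by
  classical
  set s : Finset (Fin n) := Finset.univ.filter fun z => ρ x z with hs
  have hmem : ∀ z, z ∈ s ↔ ρ x z := fun z => by simp [hs]
  have hne : s.Nonempty := ⟨x, (hmem _).2 (ρ.refl _)⟩
  have h1 := (hmem _).1 (s.min'_mem hne)
  refine ⟨s.min' hne, ⟨h1, ?_⟩, ?_⟩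
  · rintro ⟨z, hz, hr⟩
    exact absurd (s.min'_le z ((hmem z).2 (ρ.trans h1 hr))) (not_le.2 hz)
  · rintro y ⟨hy, hm⟩
    refine le_antisymm (not_lt.1 fun hlt => hm ⟨_, hlt, ρ.trans (ρ.symm hy) h1⟩)
      (s.min'_le y ((hmem y).2 hy))

theorem exists_greatest_of_part {n : ℕ} (ρ : Setoid (Fin n)) (x : Fin n) :
    ∃! y, ρ x y ∧ ¬ ∃ z > y, ρ y z := by
  classical
  set s : Finset (Fin n) := Finset.univ.filter fun z => ρ x z with hs
  have hmem : ∀ z, z ∈ s ↔ ρ x z := fun z => by simp [hs]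
  have hne : s.Nonempty := ⟨x, (hmem _).2 (ρ.refl _)⟩
  have h1 := (hmem _).1 (s.max'_mem hne)
  refine ⟨s.max' hne, ⟨h1, ?_⟩, ?_⟩
  · rintro ⟨z, hz, hr⟩
    exact absurd (s.le_max' z ((hmem z).2 (ρ.trans h1 hr))) (not_le.2 hz)
  · rintro y ⟨hy, hm⟩
    refine le_antisymm (s.le_max' y ((hmem y).2 hy))
      (not_lt.1 fun hlt => hm ⟨_, hlt, ρ.trans (ρ.symm hy) h1⟩)

theorem existsUnique_place {n : ℕ} {σ : Setoid (Fin n)} (A : Fin (2 * n) → Prop)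
    (h1 : ∀ x, ∃! y, σ x y ∧ A (oddPlace y))
    (h2 : ∀ x, ∃! y, dualPartition σ x y ∧ A (evenPlace y)) (p : Fin (2 * n)) :
    ∃! q, placeSetoid σ p q ∧ A q := by
  rcases place_cases p with ⟨x, rfl⟩ | ⟨x, rfl⟩
  · obtain ⟨y, hy, hu⟩ := h1 x
    refine ⟨oddPlace y, by simpa using hy, fun q hq => ?_⟩
    rcases place_cases q with ⟨z, rfl⟩ | ⟨z, rfl⟩
    · exact congrArg _ (hu z (by simpa using hq))
    · simp at hq
  · obtain ⟨y, hy, hu⟩ := h2 x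
    refine ⟨evenPlace y, by simpa using hy, fun q hq => ?_⟩
    rcases place_cases q with ⟨z, rfl⟩ | ⟨z, rfl⟩
    · simp at hq
    · exact congrArg _ (hu z (by simpa using hq))

theorem existsUnique_not_isCanonicalPlace (σ : Setoid (Fin (N + 1))) (p : Fin (2 * (N + 1))) :
    ∃! q, placeSetoid σ p q ∧ ¬ IsCanonicalPlace σ q :=
  existsUnique_place _ (fun x => by simpa using exists_least_of_part σ x)
    (fun x => by simpa using exists_greatest_of_part (dualPartition σ) x) p

/-- Of a boundary vertex and the dual vertex in front of it exactly one is canonical. -/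
theorem IsNoncrossing.isCanonicalPlace_castSucc_iff (h : IsNoncrossing σ) (k : Fin N) :
    IsCanonicalPlace σ (evenPlace k.castSucc) ↔ ¬ IsCanonicalPlace σ (oddPlace k.succ) := by
  have hlt : k.castSucc < k.succ := Fin.castSucc_lt_succ
  rw [isCanonicalPlace_evenPlace, isCanonicalPlace_oddPlace]
  constructor
  -- A partner of `k + 1` to its left and a dual partner of `k` to its right would cross.
  · rintro ⟨z, hz, hd⟩ ⟨y, hy, hσ⟩
    refine not_dualPartition_of_separated hσ ⟨hlt, ?_⟩ ?_ hd
    · rw [Fin.le_def]; rw [gt_iff_lt, Fin.lt_def] at hz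
      simp at hz ⊢; omega
    · intro hc
      have := hc.1
      rw [Fin.lt_def] at this hy
      simp at this hy
      omega
  · intro hmin
    obtain ⟨x, ⟨hx, hmax⟩, -⟩ := exists_greatest_of_part σ k.succ
    have hxk : k.succ ≤ x := by
      by_contra hc
      exact hmin ⟨x, not_le.1 hc, hx⟩
    -- If `k + 1` is least in its part, the dual point in front of it is joined to the one behind
    -- the greatest element `x`, a larger dual partner.
    have hd := h.dualPartition_of_extremal hx
      (fun z hz => not_lt.1 fun hlt => hmin ⟨z, hlt, hz⟩)
      (fun z hz => not_lt.1 fun hlt => hmax ⟨z, hlt, σ.trans (σ.symm hx) hz⟩)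
    have he : k.succ - 1 = k.castSucc := by
      rw [sub_eq_iff_eq_add, Fin.coeSucc_eq_succ]
    rw [he] at hd
    exact ⟨x, hlt.trans_le hxk, hd⟩

theorem not_isCanonicalPlace_zero : ¬ IsCanonicalPlace σ (oddPlace 0) := by
  rw [isCanonicalPlace_oddPlace]
  rintro ⟨y, hy, -⟩
  exact Fin.not_lt_zero y hy

theorem not_isCanonicalPlace_last : ¬ IsCanonicalPlace σ (evenPlace (Fin.last N)) := by
  rw [isCanonicalPlace_evenPlace]
  rintro ⟨y, hy, -⟩
  exact absurd (Fin.le_last y) (not_le.2 hy)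

open Classical in
/-- The increasing tuple of the canonical places. -/
noncomputable def canonicalTuple (σ : Setoid (Fin (N + 1))) (k : Fin N) : Fin (2 * (N + 1)) :=
  if IsCanonicalPlace σ (oddPlace k.succ) then oddPlace k.succ else evenPlace k.castSucc

theorem canonicalTuple_strictMono : StrictMono (canonicalTuple σ) := by
  intro k l hkl
  rw [Fin.lt_def] at hkl
  unfold canonicalTuple
  split_ifs <;> rw [Fin.lt_def] <;> simp only [oddPlace, evenPlace, Fin.val_succ,
    Fin.val_castSucc] <;> omega

theorem canonicalTuple_bounds (k : Fin N) :
    2 * (k : ℕ) + 1 ≤ canonicalTuple σ k ∧ (canonicalTuple σ k : ℕ) ≤ 2 * k + 2 := by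
  unfold canonicalTuple
  split_ifs <;> simp only [oddPlace, evenPlace, Fin.val_succ, Fin.val_castSucc] <;> omega

theorem IsNoncrossing.mem_range_canonicalTuple (h : IsNoncrossing σ) (p : Fin (2 * (N + 1))) :
    p ∈ Set.range (canonicalTuple σ) ↔ IsCanonicalPlace σ p := by
  constructor
  · rintro ⟨k, rfl⟩
    unfold canonicalTuple
    split_ifs with hk
    · exact hk
    · exact (h.isCanonicalPlace_castSucc_iff k).2 hk
  · intro hp
    rcases place_cases p with ⟨x, rfl⟩ | ⟨x, rfl⟩
    · rcases Fin.eq_zero_or_eq_succ x with rfl | ⟨k, rfl⟩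
      · exact absurd hp not_isCanonicalPlace_zero
      · exact ⟨k, if_pos hp⟩
    · rcases Fin.eq_castSucc_or_eq_last x with ⟨k, rfl⟩ | rfl
      · exact ⟨k, if_neg ((h.isCanonicalPlace_castSucc_iff k).1 hp)⟩
      · exact absurd hp not_isCanonicalPlace_last

/-- A tuple of distinct places whose complement is a transversal of the parts of `σ` and of its
dual. -/
structure IsConcordantTuple (σ : Setoid (Fin (N + 1))) (f : Fin N → Fin (2 * (N + 1))) :
    Prop where
  injective : Function.Injective f
  existsUnique : ∀ p, ∃! q, placeSetoid σ p q ∧ q ∉ Set.range f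

theorem IsNoncrossing.isConcordantTuple_canonicalTuple (h : IsNoncrossing σ) :
    IsConcordantTuple σ (canonicalTuple σ) := by
  refine ⟨canonicalTuple_strictMono.injective, fun p => ?_⟩
  simp only [h.mem_range_canonicalTuple]
  exact existsUnique_not_isCanonicalPlace σ p

theorem concordant_iff_isConcordantTuple (I : KSubset N (2 * (N + 1))) :
    Concordant I.1 σ ↔ IsConcordantTuple σ (I.1.orderEmbOfFin I.2) := by
  rw [concordant_iff]
  have hr : Set.range (I.1.orderEmbOfFin I.2) = I.1 := Finset.range_orderEmbOfFin _ _
  constructor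
  · intro h
    refine ⟨(Finset.orderEmbOfFin _ _).injective, ?_⟩
    rw [hr]
    exact h
  · rintro ⟨-, h⟩
    rw [hr] at h
    exact h

/-- Replacing `f k` by the missing place of its own part makes `f k` the missing place there; the
other parts are untouched. -/
theorem IsConcordantTuple.update {f : Fin N → Fin (2 * (N + 1))} (hf : IsConcordantTuple σ f)
    {k : Fin N} {p : Fin (2 * (N + 1))} (hp : p ∉ Set.range f) (hpk : placeSetoid σ (f k) p) :
    IsConcordantTuple σ (Function.update f k p) := by
  have hr : ∀ q, q ∈ Set.range (Function.update f k p) ↔ q = p ∨ (q ∈ Set.range f ∧ q ≠ f k) := by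
    intro q
    constructor
    · rintro ⟨j, rfl⟩
      rcases eq_or_ne j k with rfl | hj
      · left; simp
      · right
        rw [Function.update_of_ne hj]
        exact ⟨⟨j, rfl⟩, fun h => hj (hf.injective h)⟩
    · rintro (rfl | ⟨⟨j, rfl⟩, hq⟩)
      · exact ⟨k, by simp⟩
      · refine ⟨j, Function.update_of_ne ?_ _ _⟩
        rintro rfl; exact hq rfl
  refine ⟨?_, fun q => ?_⟩
  · intro i j hij
    by_cases hi : i = k <;> by_cases hj : j = k
    · rw [hi, hj]
    · rw [hi, Function.update_self, Function.update_of_ne hj] at hij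
      exact absurd ⟨j, hij.symm⟩ hp
    · rw [hj, Function.update_self, Function.update_of_ne hi] at hij
      exact absurd ⟨i, hij⟩ hp
    · rw [Function.update_of_ne hi, Function.update_of_ne hj] at hij
      exact hf.injective hij
  · simp only [hr]
    by_cases hq : placeSetoid σ q p
    · refine ⟨f k, ⟨(placeSetoid σ).trans hq ((placeSetoid σ).symm hpk), ?_⟩, ?_⟩
      · rintro (h | ⟨-, h⟩)
        · exact hp ⟨k, h⟩
        · exact h rfl
      · rintro r ⟨hr1, hr2⟩
        by_contra hne
        refine hr2 (Or.inr ⟨?_, hne⟩)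
        by_contra hrf
        exact hr2 (Or.inl ((hf.existsUnique q).unique ⟨hr1, hrf⟩ ⟨hq, hp⟩))
    · obtain ⟨r, ⟨hr1, hr2⟩, hu⟩ := hf.existsUnique q
      refine ⟨r, ⟨hr1, ?_⟩, ?_⟩
      · rintro (rfl | ⟨h, -⟩)
        · exact hq hr1
        · exact hr2 h
      · rintro s ⟨hs1, hs2⟩
        refine hu s ⟨hs1, fun hs => hs2 (Or.inr ⟨hs, ?_⟩)⟩
        rintro rfl
        exact hq ((placeSetoid σ).trans hs1 hpk)

theorem card_filter_tuple {m : ℕ} {f : Fin N → Fin m} (hf : Function.Injective f)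
    (S : Finset (Fin m)) [DecidablePred fun q => q ∉ Set.range f] :
    (Finset.univ.filter fun j => f j ∈ S).card + (S.filter fun q => q ∉ Set.range f).card =
      S.card := by
  classical
  rw [← Finset.card_filter_add_card_filter_not (s := S) (fun q => q ∈ Set.range f)]
  congr 1
  refine Finset.card_bij (fun j _ => f j) ?_ ?_ ?_
  · intro j hj
    exact Finset.mem_filter.2 ⟨(Finset.mem_filter.1 hj).2, j, rfl⟩
  · intro i _ j _ h
    exact hf h
  · intro q hq
    obtain ⟨hq1, j, rfl⟩ := Finset.mem_filter.1 hq
    exact ⟨j, Finset.mem_filter.2 ⟨Finset.mem_univ j, hq1⟩, rfl⟩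

/-- Two concordant tuples that miss the end points of the open interval `(a, b)` of places of the
same part have equally many places inside it. -/
theorem IsConcordantTuple.card_Ioo_eq (h : IsNoncrossing σ) {f g : Fin N → Fin (2 * (N + 1))}
    (hf : IsConcordantTuple σ f) (hg : IsConcordantTuple σ g) {a b : Fin (2 * (N + 1))}
    (hab : placeSetoid σ a b) (hfab : a ∉ Set.range f ∨ b ∉ Set.range f)
    (hgab : a ∉ Set.range g ∨ b ∉ Set.range g) :
    (Finset.univ.filter fun j => f j ∈ Finset.Ioo a b).card =
      (Finset.univ.filter fun j => g j ∈ Finset.Ioo a b).card := by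
  classical
  have key : ∀ {f g : Fin N → Fin (2 * (N + 1))}, IsConcordantTuple σ f → IsConcordantTuple σ g →
      (a ∉ Set.range f ∨ b ∉ Set.range f) →
      ((Finset.Ioo a b).filter fun q => q ∉ Set.range f).card ≤
        ((Finset.Ioo a b).filter fun q => q ∉ Set.range g).card := by
    intro f g hf hg hfab
    -- A place missing in `f` inside the interval is not in the part of `a` and `b`, whose missing
    -- place is an end point. The other parts that meet the interval stay in it.
    refine Setoid.card_filter_le_of_transversal (placeSetoid σ) hf.existsUnique hg.existsUnique _ ?_
    intro q hq hqf s hqs _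
    rw [Finset.mem_Ioo] at hq ⊢
    refine h.placeSetoid_between hab ?_ hqs hq
    intro haq
    rcases hfab with hf' | hf'
    · exact hq.1.ne ((hf.existsUnique a).unique ⟨(placeSetoid σ).refl a, hf'⟩ ⟨haq, hqf⟩)
    · exact hq.2.ne ((hf.existsUnique a).unique ⟨haq, hqf⟩ ⟨hab, hf'⟩)
  have h1 := card_filter_tuple hf.injective (Finset.Ioo a b)
  have h2 := card_filter_tuple hg.injective (Finset.Ioo a b)
  have h3 := le_antisymm (key hf hg hfab) (key hg hf hgab)
  omega

end Transversals

/-! ### Signs of updated tuples -/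

section TupleSignUpdate

theorem Int.sign_prod {α : Type*} (s : Finset α) (g : α → ℤ) :
    Int.sign (∏ i ∈ s, g i) = ∏ i ∈ s, Int.sign (g i) := by
  classical
  induction s using Finset.induction_on with
  | empty => simp
  | insert a s ha ih => rw [Finset.prod_insert ha, Finset.prod_insert ha, Int.sign_mul, ih]

/-- The Vandermonde factors that involve the first entry are split off. -/
theorem tupleSign_succ {k m : ℕ} (f : Fin (k + 1) → Fin m) :
    tupleSign f = (∏ j : Fin k, Int.sign (((f j.succ : ℕ) : ℤ) - (f 0 : ℕ))) *
      tupleSign (f ∘ Fin.succ) := by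
  unfold tupleSign
  rw [Matrix.det_vandermonde, Matrix.det_vandermonde, Fin.prod_univ_succ, Int.sign_mul,
    Fin.prod_Ioi_zero, Int.sign_prod]
  simp only [Fin.prod_Ioi_succ]
  rfl

/-- Replacing an entry of a tuple changes its sign for each entry in `S`, if `S` contains exactly
the other entries between the old and the new one. -/
theorem tupleSign_update {k m : ℕ} (f : Fin k → Fin m) (i : Fin k) (p : Fin m) (S : Finset (Fin m))
    (hi : f i ∉ S) (hS : ∀ j, j ≠ i → Int.sign (((f j : ℕ) : ℤ) - (p : ℕ)) =
      (if f j ∈ S then -1 else 1) * Int.sign (((f j : ℕ) : ℤ) - (f i : ℕ))) :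
    tupleSign (Function.update f i p) = (∏ j, if f j ∈ S then -1 else 1) * tupleSign f := by
  have key : ∀ (g : Fin k → Fin m) (h0 : 0 < k), g ⟨0, h0⟩ ∉ S →
      (∀ j, j ≠ ⟨0, h0⟩ → Int.sign (((g j : ℕ) : ℤ) - (p : ℕ)) =
        (if g j ∈ S then -1 else 1) * Int.sign (((g j : ℕ) : ℤ) - (g ⟨0, h0⟩ : ℕ))) →
      tupleSign (Function.update g ⟨0, h0⟩ p) =
        (∏ j, if g j ∈ S then -1 else 1) * tupleSign g := by
    intro g h0 hg hgS
    obtain ⟨k, rfl⟩ := Nat.exists_eq_succ_of_ne_zero h0.ne'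
    have hg0 : g 0 ∉ S := hg
    have hgS0 : ∀ j, j ≠ 0 → Int.sign (((g j : ℕ) : ℤ) - (p : ℕ)) =
        (if g j ∈ S then -1 else 1) * Int.sign (((g j : ℕ) : ℤ) - (g 0 : ℕ)) := hgS
    change tupleSign (Function.update g 0 p) = _
    rw [tupleSign_succ, tupleSign_succ g, Fin.prod_univ_succ, if_neg hg0, one_mul, ← mul_assoc,
      ← Finset.prod_mul_distrib]
    congr 1
    · refine Finset.prod_congr rfl fun j _ => ?_
      rw [Function.update_self, Function.update_of_ne (Fin.succ_ne_zero j),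
        hgS0 _ (Fin.succ_ne_zero j)]
  have hk : 0 < k := i.pos
  -- A swap brings the changed index to position 0; its sign appears on both sides and cancels.
  set z : Fin k := ⟨0, hk⟩ with hz
  have h := key (f ∘ Equiv.swap z i) hk (by simpa [← hz] using hi) (by
    intro j hj
    simp only [Function.comp, ← hz, Equiv.swap_apply_left]
    exact hS _ (by
      intro h
      apply hj
      rw [Equiv.swap_apply_eq_iff, Equiv.swap_apply_right] at h
      exact h))
  have hu : Function.update (f ∘ Equiv.swap z i) z p = Function.update f i p ∘ Equiv.swap z i := by
    have := Function.update_comp_equiv f (Equiv.swap z i) i p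
    rw [Equiv.symm_swap, Equiv.swap_apply_right] at this
    exact this.symm
  rw [hu, tupleSign_comp_perm, tupleSign_comp_perm] at h
  simp only [Function.comp] at h
  rw [Equiv.prod_comp (Equiv.swap z i) fun j => if f j ∈ S then (-1 : ℤ) else 1] at h
  rcases Int.units_eq_one_or (Equiv.Perm.sign (Equiv.swap z i)) with h1 | h1
  · rw [h1] at h; simpa using h
  · rw [h1] at h; simpa using h

theorem prod_ite_Ico_eq {N : ℕ} (a b : ℕ) (hb : b ≤ N) :
    ∏ k : Fin N, (if a ≤ (k : ℕ) ∧ (k : ℕ) < b then (-1 : ℤ) else 1) = (-1) ^ (b - a) := by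
  rw [Fin.prod_univ_eq_prod_range (fun k => if a ≤ k ∧ k < b then (-1 : ℤ) else 1) N,
    Finset.prod_ite, Finset.prod_const, Finset.prod_const_one, mul_one]
  congr 1
  have : (Finset.range N).filter (fun k => a ≤ k ∧ k < b) = Finset.Ico a b := by
    ext k
    simp only [Finset.mem_filter, Finset.mem_range, Finset.mem_Ico]
    omega
  rw [this, Nat.card_Ico]

end TupleSignUpdate

/-! ### The determinants of the forests of a noncrossing partition -/

section PartitionDet

variable {N : ℕ} {σ : Setoid (Fin (N + 1))}

/-- The element of the part of `x` that is missing in the tuple `f`. -/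
noncomputable def tupleRoot (σ : Setoid (Fin (N + 1))) (f : Fin N → Fin (2 * (N + 1)))
    (x : Fin (N + 1)) : Fin (N + 1) :=
  Classical.epsilon fun r => σ x r ∧ oddPlace r ∉ Set.range f

theorem IsConcordantTuple.existsUnique_odd {f : Fin N → Fin (2 * (N + 1))}
    (hf : IsConcordantTuple σ f) (x : Fin (N + 1)) : ∃! r, σ x r ∧ oddPlace r ∉ Set.range f := by
  obtain ⟨q, hq, hu⟩ := hf.existsUnique (oddPlace x)
  rcases place_cases q with ⟨y, rfl⟩ | ⟨y, rfl⟩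
  · exact ⟨y, by simpa using hq, fun z hz =>
      oddPlace_injective (hu (oddPlace z) (by simpa using hz))⟩
  · simp at hq

theorem IsConcordantTuple.tupleRoot_spec {f : Fin N → Fin (2 * (N + 1))}
    (hf : IsConcordantTuple σ f) (x : Fin (N + 1)) :
    σ x (tupleRoot σ f x) ∧ oddPlace (tupleRoot σ f x) ∉ Set.range f :=
  Classical.epsilon_spec (hf.existsUnique_odd x).exists

theorem IsConcordantTuple.tupleRoot_eq {f : Fin N → Fin (2 * (N + 1))}
    (hf : IsConcordantTuple σ f) {x r : Fin (N + 1)} (h1 : σ x r)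
    (h2 : oddPlace r ∉ Set.range f) : tupleRoot σ f x = r :=
  (hf.existsUnique_odd x).unique (hf.tupleRoot_spec x) ⟨h1, h2⟩

/-- The sign attached to a place. -/
def placeSign (p : Fin (2 * (N + 1))) : ℂ :=
  placeElim (fun x => (-1) ^ (x : ℕ)) (fun x => (-1) ^ (x : ℕ)) p

theorem placeSign_mul_self (p : Fin (2 * (N + 1))) : placeSign p * placeSign p = 1 := by
  unfold placeSign
  rcases place_cases p with ⟨x, rfl⟩ | ⟨x, rfl⟩ <;>
    simp [← mul_pow]

/-- The vector of a place: an edge of the boundary circle for a dual vertex, the edge to the root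
`r x` for a boundary vertex `x`. -/
noncomputable def placeVec (r : Fin (N + 1) → Fin (N + 1)) (p : Fin (2 * (N + 1))) :
    Fin (N + 1) → ℂ :=
  placeElim (fun x => Pi.single x 1 - Pi.single (r x) 1)
    (fun x => Pi.single x 1 - Pi.single (x + 1) 1) p

/-- The square matrix of the signed vectors of a tuple of places, and of a unit vector. -/
noncomputable def placeMatrix (r : Fin (N + 1) → Fin (N + 1)) (f : Fin N → Fin (2 * (N + 1))) :
    Matrix (Fin (N + 1)) (Fin (N + 1)) ℂ :=
  Matrix.of fun i j => Fin.cases (motive := fun _ => ℂ) (if i = 0 then 1 else 0)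
    (fun k => placeSign (f k) * placeVec r (f k) i) j

theorem placeMatrix_zero (r : Fin (N + 1) → Fin (N + 1)) (f : Fin N → Fin (2 * (N + 1)))
    (i : Fin (N + 1)) : placeMatrix r f i 0 = if i = 0 then 1 else 0 := rfl

theorem placeMatrix_succ (r : Fin (N + 1) → Fin (N + 1)) (f : Fin N → Fin (2 * (N + 1)))
    (i : Fin (N + 1)) (k : Fin N) :
    placeMatrix r f i k.succ = placeSign (f k) * placeVec r (f k) i := rfl

/-- Exchange of the missing boundary vertex of a part. -/
theorem IsConcordantTuple.det_placeMatrix_update_odd {f : Fin N → Fin (2 * (N + 1))}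
    (hf : IsConcordantTuple σ f) {k : Fin N} {x₀ x : Fin (N + 1)} (hk : f k = oddPlace x₀)
    (hx : oddPlace x ∉ Set.range f) (hσ : σ x₀ x) :
    (placeMatrix (tupleRoot σ (Function.update f k (oddPlace x)))
      (Function.update f k (oddPlace x))).det =
    -(placeSign (f k) * placeSign (oddPlace x)) * (placeMatrix (tupleRoot σ f) f).det := by
  classical
  have hf' : IsConcordantTuple σ (Function.update f k (oddPlace x)) :=
    hf.update hx (by rw [hk]; simpa using hσ)
  have hx0 : oddPlace x₀ ∉ Set.range (Function.update f k (oddPlace x)) := by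
    rintro ⟨j, hj⟩
    by_cases hjk : j = k
    · rw [hjk, Function.update_self] at hj
      exact hx ⟨k, by rw [hk, ← hj]⟩
    · rw [Function.update_of_ne hjk, ← hk] at hj
      exact hjk (hf.injective hj)
  have hr1 : ∀ a, σ a x → tupleRoot σ f a = x := fun a ha => hf.tupleRoot_eq ha hx
  have hr2 : ∀ a, σ a x → tupleRoot σ (Function.update f k (oddPlace x)) a = x₀ := fun a ha =>
    hf'.tupleRoot_eq (σ.trans ha (σ.symm hσ)) hx0
  have hr3 : ∀ a, ¬ σ a x → tupleRoot σ (Function.update f k (oddPlace x)) a = tupleRoot σ f a := by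
    intro a ha
    have hs := hf.tupleRoot_spec a
    refine hf'.tupleRoot_eq hs.1 ?_
    rintro ⟨j, hj⟩
    by_cases hjk : j = k
    · rw [hjk, Function.update_self] at hj
      apply ha
      rw [oddPlace_injective hj]
      exact hs.1
    · rw [Function.update_of_ne hjk] at hj
      exact hs.2 ⟨j, hj⟩
  set f' := Function.update f k (oddPlace x) with hf'def
  set B := (placeMatrix (tupleRoot σ f) f).updateCol k.succ
    ((-(placeSign (f k) * placeSign (oddPlace x))) • fun i => placeMatrix (tupleRoot σ f) f i k.succ)
    with hB
  have hBdet : B.det =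
      -(placeSign (f k) * placeSign (oddPlace x)) * (placeMatrix (tupleRoot σ f) f).det := by
    rw [hB, Matrix.det_updateCol_smul]
    congr 2
    exact Matrix.updateCol_eq_self _ _
  rw [← hBdet]
  -- The root of the part changes from `x` to `x₀`. Up to its sign, each other column of this part
  -- changes by `e_x - e_{x₀}`, a multiple of column `k`, so the determinant is that of `B`.
  let c : Fin (N + 1) → ℂ := fun j => Fin.cases (motive := fun _ => ℂ) 0 (fun l => if l = k then 0 else
    placeElim (fun a => if σ a x then placeSign (f l) * placeSign (oddPlace x) else 0)
      (fun _ => 0) (f l)) j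
  rw [← Matrix.det_transpose, ← Matrix.det_transpose B]
  refine Matrix.det_eq_of_forall_row_eq_smul_add_const c k.succ (by simp [c]) ?_
  intro j i
  rw [Matrix.transpose_apply, Matrix.transpose_apply, Matrix.transpose_apply]
  have hBk : B i k.succ = placeSign (oddPlace x) *
      ((Pi.single x (1 : ℂ) : Fin (N + 1) → ℂ) i - (Pi.single x₀ (1 : ℂ) : Fin (N + 1) → ℂ) i) := by
    rw [hB, Matrix.updateCol_self, Pi.smul_apply, placeMatrix_succ, hk]
    simp only [placeVec, placeElim_oddPlace, Pi.sub_apply, hr1 x₀ hσ, smul_eq_mul]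
    have := placeSign_mul_self (oddPlace x₀)
    linear_combination (-(placeSign (oddPlace x)) *
      ((Pi.single x₀ 1 : Fin (N + 1) → ℂ) i - (Pi.single x 1 : Fin (N + 1) → ℂ) i)) * this
  rcases Fin.eq_zero_or_eq_succ j with rfl | ⟨l, rfl⟩
  · rw [hB, Matrix.updateCol_ne (Fin.succ_ne_zero k).symm]
    simp [c, placeMatrix_zero]
  · by_cases hl : l = k
    · rw [hl, hBk, placeMatrix_succ, hf'def, Function.update_self, ← hf'def]
      simp [c, placeVec, hr2 x (σ.refl x)]
    · have hBl : B i l.succ = placeMatrix (tupleRoot σ f) f i l.succ := by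
        rw [hB, Matrix.updateCol_ne]
        exact fun h => hl (Fin.succ_injective _ h)
      rw [hBl, hBk, placeMatrix_succ, placeMatrix_succ, hf'def, Function.update_of_ne hl, ← hf'def]
      simp only [c, Fin.cases_succ, if_neg hl]
      rcases place_cases (f l) with ⟨a, ha⟩ | ⟨a, ha⟩
      · rw [ha]
        simp only [placeVec, placeElim_oddPlace, Pi.sub_apply]
        by_cases hax : σ a x
        · rw [if_pos hax, hr1 a hax, hr2 a hax]
          have := placeSign_mul_self (oddPlace x)
          linear_combination (-(placeSign (oddPlace a)) *
            ((Pi.single x 1 : Fin (N + 1) → ℂ) i - (Pi.single x₀ 1 : Fin (N + 1) → ℂ) i)) * this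
        · rw [if_neg hax, hr3 a hax]
          ring
      · rw [ha]
        simp [placeVec]

open Classical in
-- A linear relation between place vectors for each region. The circle edges of the region telescope
-- to the weight `w`. On the left the root terms cancel because `w` has sum zero on every part, and
-- `w` remains.
theorem IsNoncrossing.sum_region_eq (h : IsNoncrossing σ) (r : Fin (N + 1) → Fin (N + 1))
    (hr : ∀ x, σ x (r x)) (hrr : ∀ x y, σ x y → r x = r y) (b₀ : Fin (N + 1)) :
    ∑ x, ((if dualPartition σ b₀ x then (1 : ℂ) else 0) -
      if dualPartition σ b₀ (x - 1) then 1 else 0) • placeVec r (oddPlace x) =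
    ∑ b, (if dualPartition σ b₀ b then (1 : ℂ) else 0) • placeVec r (evenPlace b) := by
  set w : Fin (N + 1) → ℂ := fun x => (if dualPartition σ b₀ x then (1 : ℂ) else 0) -
      if dualPartition σ b₀ (x - 1) then 1 else 0 with hw
  have hR : ∑ b, (if dualPartition σ b₀ b then (1 : ℂ) else 0) • placeVec r (evenPlace b) = w := by
    funext i
    simp only [placeVec, placeElim_evenPlace, Finset.sum_apply, Pi.smul_apply, Pi.sub_apply,
      smul_eq_mul, mul_sub, Finset.sum_sub_distrib]
    rw [Finset.sum_eq_single i, Finset.sum_eq_single (i - 1)]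
    · simp [hw]
    · intro b _ hb
      rw [Pi.single_eq_of_ne, mul_zero]
      rintro rfl
      exact hb (by simp)
    · simp
    · intro b _ hb
      rw [Pi.single_eq_of_ne hb.symm, mul_zero]
    · simp
  rw [hR]
  funext i
  simp only [placeVec, placeElim_oddPlace, Finset.sum_apply, Pi.smul_apply, Pi.sub_apply,
    smul_eq_mul, mul_sub, Finset.sum_sub_distrib]
  have h1 : ∑ x, w x * (Pi.single x (1 : ℂ) : Fin (N + 1) → ℂ) i = w i := by
    rw [Finset.sum_eq_single i]
    · simp
    · intro b _ hb
      rw [Pi.single_eq_of_ne hb.symm, mul_zero]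
    · simp
  have h2 : ∑ x, w x * (Pi.single (r x) (1 : ℂ) : Fin (N + 1) → ℂ) i = 0 := by
    by_cases hi : r i = i
    · rw [← sum_boundary_region_eq_zero h i b₀, Finset.sum_filter]
      refine Finset.sum_congr rfl fun x _ => ?_
      by_cases hx : σ i x
      · rw [if_pos hx, ← hrr i x hx, hi]
        simp [hw]
      · rw [if_neg hx, Pi.single_eq_of_ne, mul_zero]
        rintro rfl
        exact hx (σ.symm (hr x))
    · refine Finset.sum_eq_zero fun x _ => ?_
      rw [Pi.single_eq_of_ne, mul_zero]
      rintro rfl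
      exact hi (hrr _ _ (σ.symm (hr x)))
  rw [h1, h2, sub_zero]

/-- Exchange of the missing dual vertex of a region. -/
theorem IsConcordantTuple.det_placeMatrix_update_even (h : IsNoncrossing σ)
    {f : Fin N → Fin (2 * (N + 1))}
    (hf : IsConcordantTuple σ f) {k : Fin N} {y₀ y : Fin (N + 1)} (hk : f k = evenPlace y₀)
    (hy : evenPlace y ∉ Set.range f) (hσ : dualPartition σ y₀ y) :
    (placeMatrix (tupleRoot σ (Function.update f k (evenPlace y)))
      (Function.update f k (evenPlace y))).det =
    -(placeSign (f k) * placeSign (evenPlace y)) * (placeMatrix (tupleRoot σ f) f).det := by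
  classical
  have hf' : IsConcordantTuple σ (Function.update f k (evenPlace y)) :=
    hf.update hy (by rw [hk]; simpa using hσ)
  have hroot : tupleRoot σ (Function.update f k (evenPlace y)) = tupleRoot σ f := by
    funext a
    have hs := hf.tupleRoot_spec a
    refine hf'.tupleRoot_eq hs.1 ?_
    rintro ⟨j, hj⟩
    by_cases hjk : j = k
    · rw [hjk, Function.update_self] at hj
      simp at hj
    · rw [Function.update_of_ne hjk] at hj
      exact hs.2 ⟨j, hj⟩
  rw [hroot]
  set r := tupleRoot σ f with hr
  have hreg := h.sum_region_eq r (fun x => (hf.tupleRoot_spec x).1)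
    (fun x x' hx => (hf.tupleRoot_eq (σ.trans hx (hf.tupleRoot_spec x').1)
      (hf.tupleRoot_spec x').2)) y
  -- Coefficients of the relation of the region of `y`.
  let d : Fin (2 * (N + 1)) → ℂ := placeElim (fun x => (if dualPartition σ y x then (1 : ℂ) else 0) -
      if dualPartition σ y (x - 1) then 1 else 0) (fun b => -if dualPartition σ y b then 1 else 0)
  have hsum : ∑ q, d q • placeVec r q = 0 := by
    rw [sum_places]
    simp only [d, placeElim_oddPlace, placeElim_evenPlace, neg_smul, Finset.sum_neg_distrib]
    rw [hreg, add_neg_cancel]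
  -- Of the missing places only `y` matters: a missing boundary vertex is its own root and has
  -- vector zero, and a missing dual vertex of another region has coefficient zero.
  have hvec : placeVec r (evenPlace y) = ∑ j, d (f j) • placeVec r (f j) := by
    have hS : ∑ q ∈ insert (evenPlace y) (Finset.univ.image f), d q • placeVec r q = 0 := by
      rw [← hsum]
      refine Finset.sum_subset (Finset.subset_univ _) fun q _ hq => ?_
      have hq1 : q ≠ evenPlace y := fun hh => hq (Finset.mem_insert.2 (Or.inl hh))
      have hq2 : q ∉ Set.range f := by
        rintro ⟨j, rfl⟩
        exact hq (Finset.mem_insert.2 (Or.inr (Finset.mem_image_of_mem _ (Finset.mem_univ j))))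
      rcases place_cases q with ⟨x, rfl⟩ | ⟨x, rfl⟩
      · have : r x = x := hf.tupleRoot_eq (σ.refl x) hq2
        simp [placeVec, this]
      · have : ¬ dualPartition σ y x := fun hd => hq1
          ((hf.existsUnique (evenPlace y)).unique ⟨by simpa using hd, hq2⟩ ⟨by simp, hy⟩)
        simp [d, this]
    rw [Finset.sum_insert (by
      simp only [Finset.mem_image, Finset.mem_univ, true_and]
      rintro ⟨j, hj⟩; exact hy ⟨j, hj⟩), Finset.sum_image fun i _ j _ hij => hf.injective hij] at hS
    have hd : d (evenPlace y) = -1 := by simp [d]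
    rw [hd, neg_one_smul, neg_add_eq_zero] at hS
    exact hS
  let c : Fin (N + 1) → ℂ := fun j => Fin.cases (motive := fun _ => ℂ) 0
    (fun l => placeSign (evenPlace y) * d (f l) * placeSign (f l)) j
  have hM : placeMatrix r (Function.update f k (evenPlace y)) =
      (placeMatrix r f).updateCol k.succ (fun i => ∑ j, c j • placeMatrix r f i j) := by
    ext i j
    rcases Fin.eq_zero_or_eq_succ j with rfl | ⟨l, rfl⟩
    · rw [Matrix.updateCol_ne (Fin.succ_ne_zero k).symm]
      rfl
    · by_cases hl : l = k
      · rw [hl, Matrix.updateCol_self, placeMatrix_succ, Function.update_self, Fin.sum_univ_succ,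
          hvec, Finset.sum_apply, Finset.mul_sum]
        simp only [c, Fin.cases_zero, Fin.cases_succ, zero_mul, zero_add, placeMatrix_succ,
          Pi.smul_apply, smul_eq_mul]
        refine Finset.sum_congr rfl fun l _ => ?_
        have := placeSign_mul_self (f l)
        linear_combination (-(placeSign (evenPlace y)) * d (f l) * placeVec r (f l) i) * this
      · rw [Matrix.updateCol_ne fun hh => hl (Fin.succ_injective _ hh), placeMatrix_succ,
          placeMatrix_succ, Function.update_of_ne hl]
  rw [hM, Matrix.det_updateCol_sum]
  -- Column `k` becomes a combination of all old columns, and only the coefficient of the old column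
  -- `k` affects the determinant.
  have hdk : d (f k) = -1 := by
    rw [hk]
    simp only [d, placeElim_evenPlace]
    rw [if_pos ((dualPartition σ).symm hσ)]
  simp only [c, Fin.cases_succ, hdk, smul_eq_mul]
  ring

end PartitionDet

/-! ### The sign of the determinant of a concordant tuple -/

section SignTheorem

variable {N : ℕ} {σ : Setoid (Fin (N + 1))}

/-- The `k`-th canonical place is `2 * k + 1` or `2 * k + 2`. For `k = x - 1` it is the right end
point itself, hence excluded. -/
theorem canonicalTuple_mem_Ioo_oddPlace {x₀ x : Fin (N + 1)} (hx : IsCanonicalPlace σ (oddPlace x))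
    (k : Fin N) :
    canonicalTuple σ k ∈ Finset.Ioo (oddPlace x₀) (oddPlace x) ↔
      (x₀ : ℕ) ≤ k ∧ (k : ℕ) < x - 1 := by
  have hb := canonicalTuple_bounds (σ := σ) k
  have hx0 : (x : ℕ) ≠ 0 := by
    intro h0
    exact not_isCanonicalPlace_zero (σ := σ) (by
      rwa [show x = 0 from Fin.ext h0] at hx)
  rw [Finset.mem_Ioo, Fin.lt_def, Fin.lt_def]
  by_cases hk : (k : ℕ) + 1 = x
  · have : k.succ = x := Fin.ext hk
    rw [canonicalTuple, if_pos (by rwa [this])]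
    simp only [oddPlace, Fin.val_succ]
    omega
  · simp only [oddPlace]
    omega

theorem IsNoncrossing.canonicalTuple_mem_Ioo_evenPlace (h : IsNoncrossing σ) {y y₀ : Fin (N + 1)}
    (hy : IsCanonicalPlace σ (evenPlace y)) (k : Fin N) :
    canonicalTuple σ k ∈ Finset.Ioo (evenPlace y) (evenPlace y₀) ↔
      (y : ℕ) + 1 ≤ k ∧ (k : ℕ) < y₀ := by
  have hb := canonicalTuple_bounds (σ := σ) k
  rw [Finset.mem_Ioo, Fin.lt_def, Fin.lt_def]
  by_cases hk : (k : ℕ) = y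
  · have : k.castSucc = y := Fin.ext hk
    rw [canonicalTuple, if_neg ((h.isCanonicalPlace_castSucc_iff k).1 (by rwa [this]))]
    simp only [evenPlace, Fin.val_castSucc]
    omega
  · simp only [evenPlace]
    omega

theorem prod_ite_congr_card {α : Type*} [Fintype α] {A B : α → Prop} [DecidablePred A]
    [DecidablePred B] (h : (Finset.univ.filter A).card = (Finset.univ.filter B).card) :
    (∏ j, if A j then (-1 : ℤ) else 1) = ∏ j, if B j then (-1 : ℤ) else 1 := by
  rw [Finset.prod_ite, Finset.prod_ite, Finset.prod_const, Finset.prod_const, h]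
  simp

theorem Int.sign_sub_eq_ite {a b c : ℕ} {P : Prop} [Decidable P] (ha : c ≠ a) (hb : c ≠ b)
    (hP : P ↔ a < c ∧ c < b ∨ b < c ∧ c < a) :
    Int.sign ((c : ℤ) - b) = (if P then -1 else 1) * Int.sign ((c : ℤ) - a) := by
  by_cases h : P
  · rw [if_pos h]
    rcases hP.1 h with h | h
    · rw [Int.sign_eq_neg_one_of_neg (by omega), Int.sign_eq_one_of_pos (by omega)]; rfl
    · rw [Int.sign_eq_one_of_pos (by omega), Int.sign_eq_neg_one_of_neg (by omega)]; rfl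
  · rw [if_neg h, one_mul]
    rw [hP] at h
    rcases lt_or_gt_of_ne ha with e | e
    · rw [Int.sign_eq_neg_one_of_neg (by omega), Int.sign_eq_neg_one_of_neg (by omega)]
    · rw [Int.sign_eq_one_of_pos (by omega), Int.sign_eq_one_of_pos (by omega)]

/-- The sign changes once for each entry strictly between the old and the new place. Their number
agrees with that for the canonical tuple, where it is the difference of the vertex indices minus
one. -/
theorem IsConcordantTuple.tupleSign_update_canonical (h : IsNoncrossing σ)
    {f : Fin N → Fin (2 * (N + 1))} (hf : IsConcordantTuple σ f) {k : Fin N}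
    {p : Fin (2 * (N + 1))} (hp : p ∉ Set.range f) (hpk : placeSetoid σ (f k) p)
    (hk : ¬ IsCanonicalPlace σ (f k)) :
    (tupleSign (Function.update f k p) : ℂ) =
      -(placeSign (f k) * placeSign p) * tupleSign f := by
  classical
  have hne : p ≠ f k := fun hh => hp ⟨k, hh.symm⟩
  have hpc : IsCanonicalPlace σ p := by
    by_contra hh
    exact hne ((existsUnique_not_isCanonicalPlace σ (f k)).unique ⟨hpk, hh⟩
      ⟨(placeSetoid σ).refl _, hk⟩)
  have hcan : f k ∉ Set.range (canonicalTuple σ) := by rwa [h.mem_range_canonicalTuple]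
  have hj1 : ∀ j, j ≠ k → ((f j : ℕ) ≠ f k) := fun j hj hh => hj (hf.injective (Fin.ext hh))
  have hj2 : ∀ j, ((f j : ℕ) ≠ p) := fun j hh => hp ⟨j, Fin.ext hh⟩
  have hc := h.isConcordantTuple_canonicalTuple
  have main : ∀ q, f k = q → (tupleSign (Function.update f k p) : ℂ) =
      -(placeSign q * placeSign p) * tupleSign f := by
    intro q hq
    rcases place_cases q with ⟨x₀, rfl⟩ | ⟨y₀, rfl⟩
    · rcases place_cases p with ⟨x, rfl⟩ | ⟨y, rfl⟩
      swap
      · rw [hq] at hpk; simp at hpk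
      have hlt : x₀ < x := by
        rw [hq] at hk hpk
        rw [isCanonicalPlace_oddPlace] at hk
        rcases lt_trichotomy x₀ x with hl | hl | hl
        · exact hl
        · exact absurd (by rw [hq, hl]) hne
        · exact absurd ⟨x, hl, by simpa using hpk⟩ hk
      rw [Fin.lt_def] at hlt
      rw [tupleSign_update f k (oddPlace x) (Finset.Ioo (oddPlace x₀) (oddPlace x)) (by simp [hq]) ?_,
        prod_ite_congr_card (hf.card_Ioo_eq h hc (by rw [← hq]; exact hpk) (Or.inr hp)
          (Or.inl (by rw [← hq]; exact hcan)))]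
      · simp only [canonicalTuple_mem_Ioo_oddPlace hpc]
        rw [prod_ite_Ico_eq _ _ (by omega)]
        push_cast
        congr 1
        simp only [placeSign, placeElim_oddPlace]
        obtain ⟨d, hd⟩ : ∃ d, (x : ℕ) = x₀ + 1 + d := ⟨x - (x₀ + 1), by omega⟩
        rw [hd, show (x₀ : ℕ) + 1 + d - 1 - x₀ = d by omega, pow_add, pow_add]
        have : ((-1 : ℂ) ^ (x₀ : ℕ)) * (-1) ^ (x₀ : ℕ) = 1 := by rw [← mul_pow]; simp
        linear_combination (-(-1 : ℂ) ^ d) * this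
      · intro j hj
        have e1 := hj1 j hj
        have e2 := hj2 j
        rw [hq] at e1 ⊢
        refine Int.sign_sub_eq_ite e1 e2 ?_
        rw [Finset.mem_Ioo, Fin.lt_def, Fin.lt_def]
        simp only [oddPlace]
        omega
    · rcases place_cases p with ⟨x, rfl⟩ | ⟨y, rfl⟩
      · rw [hq] at hpk; simp at hpk
      have hlt : y < y₀ := by
        rw [hq] at hk hpk
        rw [isCanonicalPlace_evenPlace] at hk
        rcases lt_trichotomy y y₀ with hl | hl | hl
        · exact hl
        · exact absurd (by rw [hq, hl]) hne
        · exact absurd ⟨y, hl, by simpa using hpk⟩ hk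
      rw [Fin.lt_def] at hlt
      rw [tupleSign_update f k (evenPlace y) (Finset.Ioo (evenPlace y) (evenPlace y₀))
          (by simp [hq]) ?_,
        prod_ite_congr_card (hf.card_Ioo_eq h hc
          (by rw [← hq]; exact (placeSetoid σ).symm hpk) (Or.inl hp)
          (Or.inr (by rw [← hq]; exact hcan)))]
      · simp only [h.canonicalTuple_mem_Ioo_evenPlace hpc]
        rw [prod_ite_Ico_eq _ _ (by omega)]
        push_cast
        congr 1
        simp only [placeSign, placeElim_evenPlace]
        obtain ⟨d, hd⟩ : ∃ d, (y₀ : ℕ) = y + 1 + d := ⟨y₀ - (y + 1), by omega⟩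
        rw [hd, show (y : ℕ) + 1 + d - (y + 1) = d by omega, pow_add, pow_add]
        have : ((-1 : ℂ) ^ (y : ℕ)) * (-1) ^ (y : ℕ) = 1 := by rw [← mul_pow]; simp
        linear_combination (-(-1 : ℂ) ^ d) * this
      · intro j hj
        have e1 := hj1 j hj
        have e2 := hj2 j
        rw [hq] at e1 ⊢
        refine Int.sign_sub_eq_ite e1 e2 ?_
        rw [Finset.mem_Ioo, Fin.lt_def, Fin.lt_def]
        simp only [evenPlace]
        omega
  exact main _ rfl

/-- Determinant and tuple sign change by the same factor, and this factor squares to 1. -/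
theorem IsConcordantTuple.det_mul_tupleSign_update (h : IsNoncrossing σ)
    {f : Fin N → Fin (2 * (N + 1))} (hf : IsConcordantTuple σ f) {k : Fin N}
    {p : Fin (2 * (N + 1))} (hp : p ∉ Set.range f) (hpk : placeSetoid σ (f k) p)
    (hk : ¬ IsCanonicalPlace σ (f k)) :
    (placeMatrix (tupleRoot σ (Function.update f k p)) (Function.update f k p)).det *
        tupleSign (Function.update f k p) =
      (placeMatrix (tupleRoot σ f) f).det * tupleSign f := by
  have hdet : (placeMatrix (tupleRoot σ (Function.update f k p)) (Function.update f k p)).det =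
      -(placeSign (f k) * placeSign p) * (placeMatrix (tupleRoot σ f) f).det := by
    obtain ⟨q, hq⟩ : ∃ q, f k = q := ⟨_, rfl⟩
    rcases place_cases q with ⟨x₀, rfl⟩ | ⟨y₀, rfl⟩ <;>
      rcases place_cases p with ⟨x, rfl⟩ | ⟨y, rfl⟩
    · exact hf.det_placeMatrix_update_odd hq hp (by rw [hq] at hpk; simpa using hpk)
    · rw [hq] at hpk; simp at hpk
    · rw [hq] at hpk; simp at hpk
    · exact hf.det_placeMatrix_update_even h hq hp (by rw [hq] at hpk; simpa using hpk)
  rw [hdet, hf.tupleSign_update_canonical h hp hpk hk]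
  have h1 := placeSign_mul_self (f k)
  have h2 := placeSign_mul_self p
  linear_combination ((placeMatrix (tupleRoot σ f) f).det * tupleSign f) *
    (placeSign (f k) * placeSign (f k) * h2 + h1)

/-- The missing boundary vertices are the least elements of their parts, so every root precedes its
vertex and the matrix is upper triangular. A dual column `k` contributes `(-1) ^ k` times its entry
`-1`, a boundary column `k + 1` contributes `(-1) ^ (k + 1)`. -/
theorem IsNoncrossing.det_placeMatrix_canonicalTuple (h : IsNoncrossing σ) :
    (placeMatrix (tupleRoot σ (canonicalTuple σ)) (canonicalTuple σ)).det =
      ∏ k : Fin N, (-1) ^ ((k : ℕ) + 1) := by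
  have hc := h.isConcordantTuple_canonicalTuple
  have hroot : ∀ x, IsCanonicalPlace σ (oddPlace x) → tupleRoot σ (canonicalTuple σ) x < x := by
    intro x hx
    obtain ⟨h1, h2⟩ := hc.tupleRoot_spec x
    rw [h.mem_range_canonicalTuple] at h2
    rcases lt_trichotomy (tupleRoot σ (canonicalTuple σ) x) x with hl | hl | hl
    · exact hl
    · rw [hl] at h2; exact absurd hx h2
    · rw [isCanonicalPlace_oddPlace] at h2
      exact absurd ⟨x, hl, σ.symm h1⟩ h2
  rw [Matrix.det_of_isUpperTriangular, Fin.prod_univ_succ]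
  · rw [placeMatrix_zero, if_pos rfl, one_mul]
    refine Finset.prod_congr rfl fun k _ => ?_
    rw [placeMatrix_succ, canonicalTuple]
    split_ifs with hk
    · have := hroot _ hk
      simp only [placeSign, placeVec, placeElim_oddPlace, Pi.sub_apply, Pi.single_eq_same,
        Fin.val_succ]
      rw [Pi.single_eq_of_ne this.ne', sub_zero, mul_one]
    · simp only [placeSign, placeVec, placeElim_evenPlace, Pi.sub_apply, Fin.val_castSucc]
      rw [Pi.single_eq_of_ne (Fin.castSucc_lt_succ).ne',
        show k.castSucc + 1 = k.succ by simp, Pi.single_eq_same]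
      ring
  · intro i j hij
    simp only [id] at hij
    rcases Fin.eq_zero_or_eq_succ j with rfl | ⟨k, rfl⟩
    · rw [placeMatrix_zero, if_neg hij.ne']
    · rw [placeMatrix_succ, canonicalTuple]
      split_ifs with hk
      · have := hroot _ hk
        simp only [placeVec, placeElim_oddPlace, Pi.sub_apply]
        rw [Pi.single_eq_of_ne hij.ne', Pi.single_eq_of_ne (this.trans hij).ne', sub_zero,
          mul_zero]
      · simp only [placeVec, placeElim_evenPlace, Pi.sub_apply]
        rw [show k.castSucc + 1 = k.succ by simp, Pi.single_eq_of_ne hij.ne',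
          Pi.single_eq_of_ne (Fin.castSucc_lt_succ.trans hij).ne', sub_zero, mul_zero]

theorem tupleRoot_congr {f g : Fin N → Fin (2 * (N + 1))} (h : Set.range f = Set.range g) :
    tupleRoot σ f = tupleRoot σ g := by
  funext x
  rw [tupleRoot, tupleRoot, h]

theorem det_placeMatrix_comp_perm (r : Fin (N + 1) → Fin (N + 1)) (f : Fin N → Fin (2 * (N + 1)))
    (e : Equiv.Perm (Fin N)) :
    (placeMatrix r (f ∘ e)).det = (Equiv.Perm.sign e : ℤ) * (placeMatrix r f).det := by
  exact (isPluckerFunction_det (fun f => placeMatrix r f) (Fin.succEmb N)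
    (fun p i => placeSign p * placeVec r p i) (fun f i s => rfl) (by
      intro f g s j hj
      rcases Fin.eq_zero_or_eq_succ j with rfl | ⟨k, rfl⟩
      · rfl
      · exact absurd ⟨k, rfl⟩ hj)).comp_perm f e

/-- Exchanging a noncanonical entry with the missing place of its part keeps the product and lowers
the number of noncanonical entries, down to a permutation of the canonical tuple. The resulting sign
depends neither on `σ` nor on `f`. -/
theorem IsConcordantTuple.det_mul_tupleSign (h : IsNoncrossing σ)
    {f : Fin N → Fin (2 * (N + 1))} (hf : IsConcordantTuple σ f) :
    (placeMatrix (tupleRoot σ f) f).det * tupleSign f = ∏ k : Fin N, (-1) ^ ((k : ℕ) + 1) := by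
  classical
  induction hm : (Finset.univ.filter fun j => ¬ IsCanonicalPlace σ (f j)).card using
    Nat.strong_induction_on generalizing f with
  | _ m ih =>
    by_cases hall : ∀ j, IsCanonicalPlace σ (f j)
    · have hmem : ∀ j, ∃ l, canonicalTuple σ l = f j := fun j =>
        (h.mem_range_canonicalTuple _).2 (hall j)
      choose e he using hmem
      have hinj : Function.Injective e := fun i j hij => hf.injective (by rw [← he, ← he, hij])
      have hbij : Function.Bijective e := Finite.injective_iff_bijective.1 hinj
      set e' := Equiv.ofBijective e hbij with he'
      have hfe : f = canonicalTuple σ ∘ e' := funext fun j => (he j).symm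
      rw [hfe, tupleRoot_congr (g := canonicalTuple σ) (by
        rw [Set.range_comp, e'.surjective.range_eq, Set.image_univ]),
        det_placeMatrix_comp_perm, tupleSign_comp_perm,
        tupleSign_of_strictMono canonicalTuple_strictMono, h.det_placeMatrix_canonicalTuple]
      have : (((Equiv.Perm.sign e' : ℤˣ) : ℤ) : ℂ) * ((Equiv.Perm.sign e' : ℤˣ) : ℤ) = 1 := by
        rw [← Int.cast_mul, ← Units.val_mul, Int.units_mul_self]; simp
      push_cast
      linear_combination (∏ k : Fin N, (-1 : ℂ) ^ ((k : ℕ) + 1)) * this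
    · push Not at hall
      obtain ⟨k, hk⟩ := hall
      obtain ⟨p, ⟨hpk, hp⟩, -⟩ := hf.existsUnique (f k)
      rw [← hf.det_mul_tupleSign_update h hp hpk hk]
      have hpc : IsCanonicalPlace σ p := by
        by_contra hh
        exact hp ⟨k, (existsUnique_not_isCanonicalPlace σ (f k)).unique
          ⟨(placeSetoid σ).refl _, hk⟩ ⟨hpk, hh⟩⟩
      refine ih _ ?_ (hf.update hp hpk) rfl
      rw [← hm]
      refine Finset.card_lt_card (Finset.ssubset_iff_of_subset ?_ |>.2 ⟨k, by simpa using hk, by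
        simpa using hpc⟩)
      intro j hj
      by_cases hjk : j = k
      · rw [hjk]; simpa using hk
      · simpa [Function.update_of_ne hjk] using hj

end SignTheorem

/-! ### A noncrossing partition is determined by the least and the greatest elements of its parts -/

section MinMax

theorem exists_predecessor {n : ℕ} (σ : Setoid (Fin n)) {a b : Fin n} (hab : a < b) (h : σ a b) :
    ∃ p, a ≤ p ∧ p < b ∧ σ p b ∧ ∀ c, p < c → c < b → ¬ σ c b := by
  classical
  set s : Finset (Fin n) := Finset.univ.filter fun z => z < b ∧ σ z b with hs
  have hmem : ∀ z, z ∈ s ↔ z < b ∧ σ z b := fun z => by simp [hs]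
  have ha : a ∈ s := (hmem _).2 ⟨hab, h⟩
  have hm := (hmem _).1 (s.max'_mem ⟨a, ha⟩)
  exact ⟨s.max' ⟨a, ha⟩, s.le_max' _ ha, hm.1, hm.2, fun c hc hcb hσ =>
    absurd (s.le_max' c ((hmem _).2 ⟨hcb, hσ⟩)) (not_le.2 hc)⟩

theorem exists_successor {n : ℕ} (σ : Setoid (Fin n)) {a b : Fin n} (hab : a < b) (h : σ a b) :
    ∃ p, a < p ∧ σ a p ∧ ∀ c, a < c → c < p → ¬ σ a c := by
  classical
  set s : Finset (Fin n) := Finset.univ.filter fun z => a < z ∧ σ a z with hs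
  have hmem : ∀ z, z ∈ s ↔ a < z ∧ σ a z := fun z => by simp [hs]
  have hb : b ∈ s := (hmem _).2 ⟨hab, h⟩
  have hm := (hmem _).1 (s.min'_mem ⟨b, hb⟩)
  exact ⟨s.min' ⟨b, hb⟩, hm.1, hm.2, fun c hc hcb hσ =>
    absurd (s.min'_le c ((hmem _).2 ⟨hc, hσ⟩)) (not_le.2 hcb)⟩

/-- As with matching parentheses, knowing which points have earlier and which have later partners
determines a noncrossing partition. For consecutive elements `a < b` of a `σ`-part, induction on the
distance shows that the `ρ`-predecessor `p` of `b` is `a`. -/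
theorem IsNoncrossing.rel_of_min_max {n : ℕ} {σ ρ : Setoid (Fin n)} (hσ : IsNoncrossing σ)
    (hρ : IsNoncrossing ρ) (hmin : ∀ x, (∃ y < x, σ x y) ↔ ∃ y < x, ρ x y)
    (hmax : ∀ x, (∃ y > x, σ x y) ↔ ∃ y > x, ρ x y) {a b : Fin n} (hab : σ a b) : ρ a b := by
  have cons : ∀ d : ℕ, ∀ a b : Fin n, (b : ℕ) = a + d → a < b → σ a b →
      (∀ c, a < c → c < b → ¬ σ a c) → ρ a b := by
    intro d
    induction d using Nat.strong_induction_on with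
    | _ d ih =>
      intro a b hd hlt hab hc
      obtain ⟨y, hy, hyb⟩ := (hmin b).1 ⟨a, hlt, σ.symm hab⟩
      obtain ⟨p, -, hpb, hρpb, hp⟩ := exists_predecessor ρ hy (ρ.symm hyb)
      rcases lt_trichotomy a p with h | h | h
      -- If `a < p`, the `σ`-successor of `p` lies before `b`; by induction it is `ρ`-related to
      -- `p`, hence to `b`, against the choice of `p`.
      · exfalso
        obtain ⟨z, hz, hpz⟩ := (hmax p).2 ⟨b, hpb, hρpb⟩
        obtain ⟨c, hpc, hσpc, hcc⟩ := exists_successor σ hz hpz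
        have hbet := hσ.between hab (hc p h hpb) hσpc ⟨h, hpb⟩
        rw [Fin.lt_def] at *
        exact hp c hpc hbet.2 (ρ.trans (ρ.symm
          (ih (c - p) (by rw [Fin.lt_def] at hbet; omega) p c (by omega) hpc hσpc hcc)) hρpb)
      · rw [h]; exact hρpb
      -- If `p < a`, the `ρ`-successor `c'` of `a` lies before `b`. Its `σ`-predecessor lies after
      -- `a` and by induction is `ρ`-related to `c'`, against the choice of `c'`.
      · exfalso
        obtain ⟨z, hz, haz⟩ := (hmax a).1 ⟨b, hlt, hab⟩
        obtain ⟨c', hac', hρac', hc'⟩ := exists_successor ρ hz haz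
        have hpa : ¬ ρ p a := fun hpa => hp a h hlt (ρ.trans (ρ.symm hpa) hρpb)
        have hbet := hρ.between hρpb hpa hρac' ⟨h, hlt⟩
        obtain ⟨w, hw, hc'w⟩ := (hmin c').2 ⟨a, hac', ρ.symm hρac'⟩
        obtain ⟨c, -, hcc', hσcc', hcm⟩ := exists_predecessor σ hw (σ.symm hc'w)
        have hb2 := hσ.between hab (hc c' hac' hbet.2) (σ.symm hσcc') ⟨hac', hbet.2⟩
        have : ρ c c' := ih (c' - c) (by
            have := hb2.1; have := hbet.2; rw [Fin.lt_def] at *; omega) c c'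
          (by rw [Fin.lt_def] at *; omega) hcc' hσcc'
          fun e he1 he2 he => hcm e he1 he2 (σ.trans (σ.symm he) hσcc')
        exact hc' c hb2.1 hcc' (ρ.trans hρac' (ρ.symm this))
  have main : ∀ m : ℕ, ∀ a b : Fin n, (b : ℕ) = m → a < b → σ a b → ρ a b := by
    intro m
    induction m using Nat.strong_induction_on with
    | _ m ih =>
      intro a b hm hlt hab
      obtain ⟨p, hap, hpb, hσpb, hp⟩ := exists_predecessor σ hlt hab
      have h1 : ρ p b := cons (b - p) p b (by rw [Fin.lt_def] at hpb; omega) hpb hσpb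
        fun c hc1 hc2 hc => hp c hc1 hc2 (σ.trans (σ.symm hc) hσpb)
      rcases eq_or_lt_of_le hap with rfl | h
      · exact h1
      · exact ρ.trans (ih p (by rw [Fin.lt_def] at hpb; omega) a p rfl h
          (σ.trans hab (σ.symm hσpb))) h1
  rcases lt_trichotomy a b with h | h | h
  · exact main b a b rfl h hab
  · rw [h]
  · exact ρ.symm (main a b a rfl h (σ.symm hab))

end MinMax

/-! ### The vector of concordant sums determines the grove vector -/

section Injectivity

variable {N : ℕ} {σ ρ : Setoid (Fin (N + 1))}

/-- The last place if it is in the part, the least place of the part otherwise. -/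
def IsLeadingPlace (σ : Setoid (Fin (N + 1))) (p : Fin (2 * (N + 1))) : Prop :=
  p = evenPlace (Fin.last N) ∨ (¬ placeSetoid σ p (evenPlace (Fin.last N)) ∧
    ∀ q, placeSetoid σ p q → p ≤ q)

theorem existsUnique_isLeadingPlace (σ : Setoid (Fin (N + 1))) (p : Fin (2 * (N + 1))) :
    ∃! q, placeSetoid σ p q ∧ IsLeadingPlace σ q := by
  by_cases hp : placeSetoid σ p (evenPlace (Fin.last N))
  · refine ⟨_, ⟨hp, Or.inl rfl⟩, ?_⟩
    rintro q ⟨hq, rfl | ⟨hq', -⟩⟩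
    · rfl
    · exact absurd ((placeSetoid σ).trans ((placeSetoid σ).symm hq) hp) hq'
  · obtain ⟨q, ⟨hq, hq'⟩, -⟩ := exists_least_of_part (placeSetoid σ) p
    refine ⟨q, ⟨hq, Or.inr ⟨fun hl => hp ((placeSetoid σ).trans hq hl), fun r hr => ?_⟩⟩, ?_⟩
    · by_contra hlt
      exact hq' ⟨r, not_le.1 hlt, hr⟩
    · rintro r ⟨hr, rfl | ⟨-, hr'⟩⟩
      · exact absurd hr hp
      · have hrq := (placeSetoid σ).trans ((placeSetoid σ).symm hr) hq
        refine le_antisymm (hr' q hrq) ?_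
        by_contra hlt
        exact hq' ⟨r, not_le.1 hlt, (placeSetoid σ).symm hrq⟩

open Classical in
/-- The set of leading places. -/
noncomputable def leadingPlaces (σ : Setoid (Fin (N + 1))) : Finset (Fin (2 * (N + 1))) :=
  Finset.univ.filter (IsLeadingPlace σ)

theorem mem_leadingPlaces {p : Fin (2 * (N + 1))} : p ∈ leadingPlaces σ ↔ IsLeadingPlace σ p := by
  simp [leadingPlaces]

/-- The leading places and the noncanonical places are transversals of the same equivalence
relation, and there are exactly `N` canonical places. -/
theorem IsNoncrossing.card_compl_leadingPlaces (h : IsNoncrossing σ) :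
    (leadingPlaces σ)ᶜ.card = N := by
  classical
  have hc := h.isConcordantTuple_canonicalTuple
  have h1 := card_filter_tuple hc.injective Finset.univ
  have h2 := Setoid.card_filter_le_of_transversal (placeSetoid σ) (existsUnique_isLeadingPlace σ)
    hc.existsUnique Finset.univ (fun _ _ _ _ _ _ => Finset.mem_univ _)
  have h3 := Setoid.card_filter_le_of_transversal (placeSetoid σ) hc.existsUnique
    (existsUnique_isLeadingPlace σ) Finset.univ (fun _ _ _ _ _ _ => Finset.mem_univ _)
  have h4 : (leadingPlaces σ).card = (Finset.univ.filter (IsLeadingPlace σ)).card := by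
    congr 1
  rw [Finset.card_compl, h4, Fintype.card_fin, le_antisymm h2 h3]
  simp only [Finset.mem_univ, Finset.filter_true, Finset.card_univ, Fintype.card_fin] at h1
  omega

/-- Moving each leading place of `σ` to the leading place of its `ρ`-part never moves it to the
right: the last place is leading for both partitions, so the exceptional `ρ`-part is represented by
it already. -/
theorem leadingPlaces_eq_or_sum_lt
    (h : ∀ p, ∃! q, placeSetoid ρ p q ∧ q ∈ leadingPlaces σ) :
    leadingPlaces ρ = leadingPlaces σ ∨
      ∑ p ∈ leadingPlaces ρ, (p : ℕ) < ∑ p ∈ leadingPlaces σ, (p : ℕ) := by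
  classical
  choose φ hφ hu using existsUnique_isLeadingPlace ρ
  have hle : ∀ p ∈ leadingPlaces σ, φ p ≤ p := by
    intro p hp
    obtain ⟨h1, h2⟩ := hφ p
    rcases h2 with h2 | ⟨-, h2⟩
    · have hlast : IsLeadingPlace σ (evenPlace (Fin.last N)) := Or.inl rfl
      rw [h2] at h1
      rw [h2, (h p).unique ⟨(placeSetoid ρ).refl p, hp⟩ ⟨h1, mem_leadingPlaces.2 hlast⟩]
    · exact h2 p ((placeSetoid ρ).symm h1)
  have hinj : Set.InjOn φ (leadingPlaces σ) := by
    intro p hp q hq hpq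
    refine (h p).unique ⟨(placeSetoid ρ).refl p, hp⟩ ⟨?_, hq⟩
    refine (placeSetoid ρ).trans (hφ p).1 ?_
    rw [hpq]
    exact (placeSetoid ρ).symm (hφ q).1
  have himg : (leadingPlaces σ).image φ = leadingPlaces ρ := by
    ext q
    rw [Finset.mem_image, mem_leadingPlaces]
    constructor
    · rintro ⟨p, -, rfl⟩
      exact (hφ p).2
    · intro hq
      obtain ⟨p, ⟨h1, h2⟩, -⟩ := h q
      exact ⟨p, h2, (hu p q ⟨(placeSetoid ρ).symm h1, hq⟩).symm⟩
  have hsum : ∑ p ∈ leadingPlaces ρ, (p : ℕ) = ∑ p ∈ leadingPlaces σ, (φ p : ℕ) := by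
    rw [← himg, Finset.sum_image hinj]
  by_cases hall : ∀ p ∈ leadingPlaces σ, φ p = p
  · left
    rw [← himg]
    ext q
    rw [Finset.mem_image]
    constructor
    · rintro ⟨p, hp, rfl⟩
      rw [hall p hp]; exact hp
    · exact fun hq => ⟨q, hq, hall q hq⟩
  · right
    push Not at hall
    obtain ⟨p, hp, hne⟩ := hall
    rw [hsum]
    exact Finset.sum_lt_sum (fun q hq => hle q hq) ⟨p, hp, Fin.lt_def.1 (lt_of_le_of_ne (hle p hp) hne)⟩

theorem isLeadingPlace_oddPlace (x : Fin (N + 1)) :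
    IsLeadingPlace σ (oddPlace x) ↔ ¬ ∃ y < x, σ x y := by
  unfold IsLeadingPlace
  simp only [not_placeSetoid_odd_even, not_false_iff, true_and, not_exists, not_and]
  constructor
  · rintro (h | h) y hy hσ
    · exact absurd h (by simp)
    · exact absurd (h (oddPlace y) (by simpa using hσ)) (not_le.2 (oddPlace_lt_oddPlace.2 hy))
  · intro h
    right
    intro q hq
    rcases place_cases q with ⟨y, rfl⟩ | ⟨y, rfl⟩
    · by_contra hlt
      exact h y (oddPlace_lt_oddPlace.1 (not_le.1 hlt)) (by simpa using hq)
    · simp at hq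

/-- If `x` has a larger partner, their part separates the dual point `x` from the earlier ones and
from the last one. If `x` is greatest in its part, the region also contains the dual point before
the least element, which is smaller or, after wrapping around, the last one. -/
theorem IsNoncrossing.isLeadingPlace_evenPlace (h : IsNoncrossing σ) {x : Fin (N + 1)}
    (hx : x ≠ Fin.last N) : IsLeadingPlace σ (evenPlace x) ↔ ∃ y > x, σ x y := by
  have hlast : evenPlace x ≠ evenPlace (Fin.last N) := fun hh => hx (evenPlace_injective hh)
  unfold IsLeadingPlace
  simp only [hlast, false_or, placeSetoid_evenPlace]
  constructor
  · rintro ⟨h1, h2⟩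
    by_contra hmax
    push Not at hmax
    obtain ⟨y, ⟨hxy, hy⟩, -⟩ := exists_least_of_part σ x
    push Not at hy
    have hd : dualPartition σ (y - 1) x := h.dualPartition_of_extremal (σ.symm hxy)
      (fun z hz => not_lt.1 fun hlt => hy z hlt hz)
      (fun z hz => not_lt.1 fun hlt => hmax z hlt (σ.trans hxy hz))
    by_cases hy0 : y = 0
    · refine h1 ((dualPartition σ).symm ?_)
      rw [hy0] at hd
      rwa [show (0 : Fin (N + 1)) - 1 = Fin.last N from by
        rw [sub_eq_iff_eq_add]; exact (Fin.last_add_one N).symm] at hd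
    · have h3 := h2 (evenPlace (y - 1)) (by
        rw [placeSetoid_evenPlace]; exact (dualPartition σ).symm hd)
      refine absurd h3 (not_le.2 (evenPlace_lt_evenPlace.2 ?_))
      have hle : y ≤ x := not_lt.1 fun hlt => hmax y hlt hxy
      rw [Fin.lt_def, Fin.coe_sub_one, if_neg hy0]
      rw [Fin.le_def] at hle
      have : (y : ℕ) ≠ 0 := fun h0 => hy0 (Fin.ext h0)
      omega
  · rintro ⟨y, hy, hσ⟩
    refine ⟨?_, ?_⟩
    · exact not_dualPartition_of_separated (σ.symm hσ) ⟨hy, Fin.le_last y⟩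
        fun hh => lt_irrefl _ hh.1
    · intro q hq
      rcases place_cases q with ⟨z, rfl⟩ | ⟨z, rfl⟩
      · simp at hq
      · rw [placeSetoid_evenPlace] at hq
        by_contra hlt
        have hlt := evenPlace_lt_evenPlace.1 (not_le.1 hlt)
        exact not_dualPartition_of_separated hσ ⟨hlt, le_rfl⟩ (fun hh => absurd hh.2 (not_le.2 hy))
          ((dualPartition σ).symm hq)

theorem IsNoncrossing.eq_of_leadingPlaces_eq (hσ : IsNoncrossing σ) (hρ : IsNoncrossing ρ)
    (h : leadingPlaces σ = leadingPlaces ρ) : σ = ρ := by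
  have hl : ∀ p, IsLeadingPlace σ p ↔ IsLeadingPlace ρ p := fun p => by
    rw [← mem_leadingPlaces, ← mem_leadingPlaces, h]
  have hmin : ∀ x, (∃ y < x, σ x y) ↔ ∃ y < x, ρ x y := fun x => by
    have := hl (oddPlace x)
    rwa [isLeadingPlace_oddPlace, isLeadingPlace_oddPlace, not_iff_not] at this
  have hmax : ∀ x, (∃ y > x, σ x y) ↔ ∃ y > x, ρ x y := fun x => by
    by_cases hx : x = Fin.last N
    · subst hx
      constructor <;> rintro ⟨y, hy, -⟩ <;> exact absurd (Fin.le_last y) (not_le.2 hy)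
    · have := hl (evenPlace x)
      rwa [hσ.isLeadingPlace_evenPlace hx, hρ.isLeadingPlace_evenPlace hx] at this
  exact Setoid.ext fun a b => ⟨fun hab => hσ.rel_of_min_max hρ hmin hmax hab,
    fun hab => hρ.rel_of_min_max hσ (fun x => (hmin x).symm) (fun x => (hmax x).symm) hab⟩

/-- Triangularity: in the support of `v` take `σ` with the smallest sum of leading places, and let
`I` be the complement of these places. Any other `ρ` concordant with `I` has a smaller sum, so only
`v σ` survives. -/
theorem eq_zero_of_sum_concordantSet_eq_zero (v : NCPartition (N + 1) → ℂ)
    (h : ∀ I : KSubset N (2 * (N + 1)), ∑ σ ∈ concordantSet (n := N + 1) I, v σ = 0) : v = 0 := by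
  classical
  by_contra hv
  obtain ⟨σ₁, hσ₁⟩ := Function.ne_iff.1 hv
  obtain ⟨σ, hσ, hmin⟩ := Finset.exists_min_image (Finset.univ.filter fun σ => v σ ≠ 0)
    (fun σ => ∑ p ∈ leadingPlaces σ.1, (p : ℕ)) ⟨σ₁, by simpa using hσ₁⟩
  have hσ0 : v σ ≠ 0 := by simpa using hσ
  have hnc : ∀ ρ : NCPartition (N + 1), IsNoncrossing ρ.1 := fun ρ => ρ.2
  have hmem : ∀ ρ : NCPartition (N + 1),
      ρ ∈ concordantSet (n := N + 1) ⟨(leadingPlaces σ.1)ᶜ, (hnc σ).card_compl_leadingPlaces⟩ ↔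
        ∀ p, ∃! q, placeSetoid ρ.1 p q ∧ q ∈ leadingPlaces σ.1 := fun ρ => by
    rw [concordantSet, Finset.mem_filter, concordant_iff]
    simp
  apply hσ0
  rw [← h ⟨(leadingPlaces σ.1)ᶜ, (hnc σ).card_compl_leadingPlaces⟩]
  refine (Finset.sum_eq_single σ ?_ ?_).symm
  · intro ρ hρ hne
    by_contra hρ0
    rcases leadingPlaces_eq_or_sum_lt ((hmem ρ).1 hρ) with heq | hlt
    · exact hne (Subtype.ext ((hnc ρ).eq_of_leadingPlaces_eq (hnc σ) heq))
    · exact absurd (hmin ρ (by simpa using hρ0)) (not_le.2 hlt)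
  · intro hn
    refine absurd ((hmem σ).2 fun p => ?_) hn
    simp only [mem_leadingPlaces]
    exact existsUnique_isLeadingPlace σ.1 p

end Injectivity

/-! ### The Cauchy–Binet formula -/

section CauchyBinet

variable {n m R : Type*} [Fintype n] [DecidableEq n] [Fintype m] [CommRing R]

/-- Multilinear expansion, each column of the product being a combination of columns of `A`. -/
theorem Matrix.det_mul_eq_sum_fun (A : Matrix n m R) (B : Matrix m n R) :
    (A * B).det = ∑ φ : n → m, (∏ i, B (φ i) i) * (A.submatrix id φ).det := by
  rw [← Matrix.det_transpose]
  have h1 : (A * B).transpose = fun i => ∑ k, B k i • A.transpose k := by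
    ext i j
    simp [Matrix.mul_apply, mul_comm]
  have h2 := (Matrix.detRowAlternating (n := n) (R := R)).toMultilinearMap.map_sum
    (fun i (k : m) => B k i • A.transpose k)
  rw [h1]
  refine h2.trans (Finset.sum_congr rfl fun φ _ => ?_)
  rw [MultilinearMap.map_smul_univ, smul_eq_mul, ← Matrix.det_transpose (A.submatrix id φ)]
  rfl

/-- The Cauchy–Binet formula. -/
theorem Matrix.det_mul_eq_sum_powersetCard [DecidableEq m] (A : Matrix n m R) (B : Matrix m n R)
    (g : Finset m → n → m) (hg : ∀ S : Finset m, S.card = Fintype.card n →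
      Function.Injective (g S) ∧ ∀ i, g S i ∈ S) :
    (A * B).det = ∑ S ∈ Finset.powersetCard (Fintype.card n) Finset.univ,
      (A.submatrix id (g S)).det * (B.submatrix (g S) id).det := by
  -- Noninjective `φ` give equal columns; the injective ones are grouped by image and differ from
  -- the enumeration `g S` by a permutation.
  rw [Matrix.det_mul_eq_sum_fun, ← Finset.sum_subset (Finset.subset_univ
    (Finset.univ.filter fun φ : n → m => Function.Injective φ)),
    ← Finset.sum_fiberwise_of_maps_to (g := fun φ => Finset.univ.image φ)
      (t := Finset.powersetCard (Fintype.card n) Finset.univ)]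
  · refine Finset.sum_congr rfl fun S hS => ?_
    obtain ⟨hinj, hmem⟩ := hg S (Finset.mem_powersetCard.1 hS).2
    have himg : Finset.univ.image (g S) = S := by
      refine Finset.eq_of_subset_of_card_le ?_ ?_
      · intro s hs
        obtain ⟨i, -, rfl⟩ := Finset.mem_image.1 hs
        exact hmem i
      · rw [Finset.card_image_of_injective _ hinj, Finset.card_univ,
          (Finset.mem_powersetCard.1 hS).2]
    rw [Matrix.det_apply (B.submatrix (g S) id), Finset.mul_sum]
    refine (Finset.sum_bij (fun (π : Equiv.Perm n) _ => g S ∘ π) ?_ ?_ ?_ ?_).symm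
    · intro π _
      simp only [Finset.mem_filter, Finset.mem_univ, true_and]
      refine ⟨hinj.comp π.injective, ?_⟩
      conv_rhs => rw [← himg]
      ext s
      simp only [Finset.mem_image, Finset.mem_univ, true_and, Function.comp_apply]
      exact ⟨fun ⟨i, hi⟩ => ⟨π i, hi⟩, fun ⟨i, hi⟩ => ⟨π.symm i, by simpa using hi⟩⟩
    · intro π _ π' _ h
      ext i
      exact hinj (congrFun h i)
    · intro φ hφ
      simp only [Finset.mem_filter, Finset.mem_univ, true_and] at hφ
      have hφS : ∀ i, ∃ j, g S j = φ i := by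
        intro i
        have : φ i ∈ Finset.univ.image (g S) := by
          rw [himg, ← hφ.2]
          exact Finset.mem_image_of_mem _ (Finset.mem_univ _)
        simpa using this
      choose π hπ using hφS
      have hπi : Function.Injective π := fun i j hij => hφ.1 (by rw [← hπ, ← hπ, hij])
      exact ⟨Equiv.ofBijective π (Finite.injective_iff_bijective.1 hπi), Finset.mem_univ _,
        funext hπ⟩
    · intro π _
      have hA : (A.submatrix id (g S ∘ π)).det =
          ((Equiv.Perm.sign π : ℤˣ) : ℤ) * (A.submatrix id (g S)).det := by
        rw [← Matrix.det_permute' π]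
        rfl
      rw [hA, Units.smul_def, zsmul_eq_mul]
      simp only [Matrix.submatrix_apply, id, Function.comp_apply]
      ring
  · intro φ hφ
    rw [Finset.mem_powersetCard]
    exact ⟨Finset.subset_univ _, Finset.card_image_of_injective _ (Finset.mem_filter.1 hφ).2⟩
  · intro φ _ hφ
    simp only [Finset.mem_filter, Finset.mem_univ, true_and] at hφ
    rw [Function.Injective] at hφ
    push Not at hφ
    obtain ⟨i, j, hij, hne⟩ := hφ
    rw [Matrix.det_zero_of_column_eq hne, mul_zero]
    intro k
    simp [hij]

end CauchyBinet

/-! ### Rooted forests and determinants -/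

namespace ElectricalNetwork

variable {n : ℕ} (Γ : ElectricalNetwork n)

open Classical in
/-- The boundary of an edge. -/
noncomputable def edgeVec (e : Γ.E) (v : Γ.V) : ℤ :=
  (if v = Γ.src e then 1 else 0) - if v = Γ.tgt e then 1 else 0

/-- A spanning forest each of whose components contains exactly one vertex of `Z`. -/
structure IsRootedForest (F : Finset Γ.E) (Z : Set Γ.V) : Prop where
  acyclic : ∀ e ∈ F, ∀ F' : Finset Γ.E, (∀ x, x ∈ F' ↔ x ∈ F ∧ x ≠ e) →
    ¬ Γ.conn F' (Γ.src e) (Γ.tgt e)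
  existsUnique_root : ∀ v, ∃! r, Γ.conn F v r ∧ r ∈ Z

variable {Γ}

open Classical in
-- A path in `F`, read as an integral 1-chain, has boundary `a - b`.
theorem exists_edge_chain {F : Finset Γ.E} {a b : Γ.V} (h : Γ.conn F a b) :
    ∃ y : Γ.E → ℤ, (∀ e ∉ F, y e = 0) ∧
      ∀ v, ∑ e, y e * Γ.edgeVec e v = (if v = a then 1 else 0) - if v = b then 1 else 0 := by
  have h' : Relation.EqvGen (fun u v => ∃ e ∈ F, Γ.src e = u ∧ Γ.tgt e = v) a b := h
  clear h
  induction h' with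
  | rel a b h =>
    obtain ⟨e, he, rfl, rfl⟩ := h
    refine ⟨fun e' => if e' = e then 1 else 0, fun e' he' => if_neg ?_, fun v => ?_⟩
    · rintro rfl; exact he' he
    · simp only [ite_mul, one_mul, zero_mul, Finset.sum_ite_eq', Finset.mem_univ, if_true]
      rfl
  | refl a => exact ⟨0, by simp, by simp⟩
  | symm a b _ ih =>
    obtain ⟨y, h1, h2⟩ := ih
    refine ⟨-y, fun e he => by simp [h1 e he], fun v => ?_⟩
    simp only [Pi.neg_apply, neg_mul, Finset.sum_neg_distrib, h2]
    ring
  | trans a b c _ _ ih1 ih2 =>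
    obtain ⟨y, h1, h2⟩ := ih1
    obtain ⟨z, h3, h4⟩ := ih2
    refine ⟨y + z, fun e he => by simp [h1 e he, h3 e he], fun v => ?_⟩
    simp only [Pi.add_apply, add_mul, Finset.sum_add_distrib, h2, h4]
    ring

open Classical in
theorem sum_conn_edgeVec {F : Finset Γ.E} {e : Γ.E} (a : Γ.V) :
    ∑ v with Γ.conn F a v, Γ.edgeVec e v =
      (if Γ.conn F a (Γ.src e) then 1 else 0) - if Γ.conn F a (Γ.tgt e) then 1 else 0 := by
  unfold edgeVec
  rw [Finset.sum_sub_distrib, Finset.sum_ite_eq', Finset.sum_ite_eq']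
  simp

theorem conn_src_iff_conn_tgt {F : Finset Γ.E} {e : Γ.E} (he : e ∈ F) (a : Γ.V) :
    Γ.conn F a (Γ.src e) ↔ Γ.conn F a (Γ.tgt e) :=
  ⟨fun h => (Γ.conn F).trans h (conn_src_tgt he),
    fun h => (Γ.conn F).trans h ((Γ.conn F).symm (conn_src_tgt he))⟩

/-- Chains in a rooted forest are determined by their boundary away from the roots. -/
theorem IsRootedForest.eq_zero_of_boundary {F : Finset Γ.E} {Z : Set Γ.V}
    (hF : Γ.IsRootedForest F Z) (y : Γ.E → ℤ) (hy : ∀ e ∉ F, y e = 0)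
    (h : ∀ v ∉ Z, ∑ e, y e * Γ.edgeVec e v = 0) : y = 0 := by
  classical
  have hsum : ∀ (F' : Finset Γ.E) a, ∑ v with Γ.conn F' a v, ∑ e, y e * Γ.edgeVec e v =
      ∑ e, y e * ((if Γ.conn F' a (Γ.src e) then 1 else 0) -
        if Γ.conn F' a (Γ.tgt e) then 1 else 0) := by
    intro F' a
    rw [Finset.sum_comm]
    refine Finset.sum_congr rfl fun e _ => ?_
    rw [← Finset.mul_sum, sum_conn_edgeVec]
  have hzero : ∀ v, ∑ e, y e * Γ.edgeVec e v = 0 := by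
    intro r
    by_cases hr : r ∈ Z
    -- The boundary has sum zero on the component of `r`, and `r` is the only root there.
    · have h1 := hsum F r
      rw [Finset.sum_eq_single r] at h1
      · rw [h1]
        refine Finset.sum_eq_zero fun e _ => ?_
        by_cases he : e ∈ F
        · simp [conn_src_iff_conn_tgt he r]
        · simp [hy e he]
      · intro v hv hne
        refine h v fun hvZ => hne ?_
        exact (hF.existsUnique_root r).unique ⟨(Finset.mem_filter.1 hv).2, hvZ⟩
          ⟨(Γ.conn F).refl r, hr⟩
      · intro hn
        exact absurd (Finset.mem_filter.2 ⟨Finset.mem_univ _, (Γ.conn F).refl r⟩) hn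
    · exact h r hr
  funext e
  by_cases he : e ∈ F
  -- Without `e` its ends lie in different components, so summation over that of `src e` isolates `y
  -- e`.
  · have h1 := hsum (F.erase e) (Γ.src e)
    rw [Finset.sum_eq_zero fun v _ => hzero v, Finset.sum_eq_single e] at h1
    · rw [if_pos ((Γ.conn _).refl _), if_neg (hF.acyclic e he _ fun x => by
        rw [Finset.mem_erase, and_comm])] at h1
      simpa using h1.symm
    · intro e' _ hne
      by_cases he' : e' ∈ F
      · simp [conn_src_iff_conn_tgt (Finset.mem_erase.2 ⟨hne, he'⟩)]
      · simp [hy e' he']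
    · simp
  · exact hy e he

end ElectricalNetwork

/-! ### Coefficient matrices of rooted forests -/

namespace ElectricalNetwork

variable {n : ℕ} {Γ : ElectricalNetwork n}

open Classical in
/-- The coefficients of the columns of a mixed matrix: a column `c` with `P c` is a combination of
the boundaries of the edges at the vertex `u c`, any other column is free. -/
noncomputable def mixedCoeff (P : Γ.V → Prop) (u : Γ.V → Γ.V) :
    Matrix (Γ.E ⊕ Γ.V) Γ.V ℤ :=
  Matrix.of fun s c => Sum.elim (fun e => if P c then Γ.edgeVec e (u c) else 0)
    (fun c' => if c' = c ∧ ¬ P c then 1 else 0) s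

theorem mixedCoeff_inl (P : Γ.V → Prop) [DecidablePred P] (u : Γ.V → Γ.V) (e : Γ.E) (c : Γ.V) :
    mixedCoeff P u (Sum.inl e) c = if P c then Γ.edgeVec e (u c) else 0 := by
  simp [mixedCoeff]

theorem mixedCoeff_inr (P : Γ.V → Prop) [DecidablePred P] [DecidableEq Γ.V] (u : Γ.V → Γ.V)
    (c' c : Γ.V) : mixedCoeff P u (Sum.inr c') c = if c' = c ∧ ¬ P c then 1 else 0 := by
  simp [mixedCoeff]

/-- The columns that are combined by `mixedCoeff`. -/
noncomputable def mixedGen (x : Γ.V → Γ.V → ℂ) : Matrix Γ.V (Γ.E ⊕ Γ.V) ℂ :=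
  Matrix.of fun v s => Sum.elim (fun e => (Γ.edgeVec e v : ℂ)) (fun c => x c v) s

/-- The vertices that are not of the form `u c` with `P c`. -/
def rootSet (P : Γ.V → Prop) (u : Γ.V → Γ.V) : Set Γ.V := {v | ∀ c, P c → u c ≠ v}

open Classical in
/-- The index set of the edges of `F` and the free columns. -/
noncomputable def mixedIndex (P : Γ.V → Prop) (F : Finset Γ.E) : Finset (Γ.E ⊕ Γ.V) :=
  F.disjSum (Finset.univ.filter fun c => ¬ P c)

theorem inl_mem_mixedIndex {P : Γ.V → Prop} {F : Finset Γ.E} {e : Γ.E} :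
    Sum.inl e ∈ mixedIndex P F ↔ e ∈ F := by simp [mixedIndex]

theorem inr_mem_mixedIndex {P : Γ.V → Prop} {F : Finset Γ.E} {c : Γ.V} :
    Sum.inr c ∈ mixedIndex P F ↔ ¬ P c := by simp [mixedIndex]

section

variable {P : Γ.V → Prop} {u : Γ.V → Γ.V} {F : Finset Γ.E}

theorem sum_mul_mixedCoeff [DecidablePred P] [DecidableEq Γ.V]
    (y : Γ.E ⊕ Γ.V → ℤ) (c : Γ.V) :
    ∑ s, y s * mixedCoeff P u s c =
      if P c then ∑ e, y (Sum.inl e) * Γ.edgeVec e (u c) else y (Sum.inr c) := by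
  rw [Fintype.sum_sum_type]
  simp only [mixedCoeff_inl, mixedCoeff_inr]
  by_cases hc : P c
  · simp [hc]
  · simp [hc]

open Classical in
/-- For a rooted forest the coefficient matrix has a left inverse. -/
theorem IsRootedForest.exists_chain (hu : ∀ c c', P c → P c' → u c = u c' → c = c')
    (hF : Γ.IsRootedForest F (rootSet P u)) (c : Γ.V) : ∃ y : Γ.E ⊕ Γ.V → ℤ,
      (∀ s ∉ mixedIndex P F, y s = 0) ∧
        ∀ c', ∑ s, y s * mixedCoeff P u s c' = if c' = c then 1 else 0 := by
  by_cases hc : P c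
  · obtain ⟨r, ⟨hr1, hr2⟩, -⟩ := hF.existsUnique_root (u c)
    obtain ⟨y, hy1, hy2⟩ := exists_edge_chain hr1
    have hy : ∀ s ∉ mixedIndex P F, Sum.elim y 0 s = 0 := by
      rintro (e | c') hs
      · exact hy1 e fun he => hs (inl_mem_mixedIndex.2 he)
      · rfl
    refine ⟨Sum.elim y 0, hy, fun c' => ?_⟩
    rw [sum_mul_mixedCoeff]
    by_cases hc' : P c'
    · simp only [hc', if_true, Sum.elim_inl, hy2, if_neg (hr2 c' hc'), sub_zero]
      by_cases h : c' = c
      · simp [h]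
      · rw [if_neg h, if_neg fun hh => h (hu _ _ hc' hc hh)]
    · rw [if_neg hc', if_neg (by rintro rfl; exact hc' hc)]
      rfl
  · have hy : ∀ s ∉ mixedIndex P F, Sum.elim (0 : Γ.E → ℤ) (fun c' => if c' = c then 1 else 0) s = 0 := by
      rintro (e | c') hs
      · rfl
      · refine if_neg ?_
        rintro rfl
        exact hs (inr_mem_mixedIndex.2 hc)
    refine ⟨Sum.elim 0 fun c' => if c' = c then 1 else 0, hy, fun c' => ?_⟩
    rw [sum_mul_mixedCoeff]
    by_cases hc' : P c'
    · rw [if_pos hc', if_neg (by rintro rfl; exact hc hc')]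
      simp
    · rw [if_neg hc']
      rfl

/-- Restricted to the rows of `mixedIndex P F`, the coefficient matrix is invertible over `ℤ`:
`eq_zero_of_boundary` gives injectivity and `exists_chain` surjectivity. Hence it is square. -/
theorem IsRootedForest.card_mixedIndex (hu : ∀ c c', P c → P c' → u c = u c' → c = c')
    (hF : Γ.IsRootedForest F (rootSet P u)) :
    (mixedIndex P F).card = Fintype.card Γ.V := by
  classical
  let K : (mixedIndex P F → ℤ) →ₗ[ℤ] (Γ.V → ℤ) :=
    ((mixedCoeff P u).submatrix (Subtype.val : mixedIndex P F → Γ.E ⊕ Γ.V) id).vecMulLinear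
  have hK : ∀ (y : Γ.E ⊕ Γ.V → ℤ), (∀ s ∉ mixedIndex P F, y s = 0) → ∀ c,
      K (fun s => y s) c = ∑ s, y s * mixedCoeff P u s c := by
    intro y hy c
    have h1 : K (fun s => y s) c = ∑ s : mixedIndex P F, y s * mixedCoeff P u s c := rfl
    rw [h1, Finset.sum_coe_sort (mixedIndex P F) fun s => y s * mixedCoeff P u s c]
    exact Finset.sum_subset (Finset.subset_univ _) fun s _ hs => by rw [hy s hs, zero_mul]
  have hinj : Function.Injective K := by
    rw [injective_iff_map_eq_zero]
    intro y hy
    set z : Γ.E ⊕ Γ.V → ℤ := fun s => if h : s ∈ mixedIndex P F then y ⟨s, h⟩ else 0 with hz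
    have hz0 : ∀ s ∉ mixedIndex P F, z s = 0 := fun s hs => dif_neg hs
    have hzy : (fun s : mixedIndex P F => z s) = y := funext fun s => dif_pos s.2
    have hsum : ∀ c, (if P c then ∑ e, z (Sum.inl e) * Γ.edgeVec e (u c) else z (Sum.inr c)) = 0 := by
      intro c
      rw [← sum_mul_mixedCoeff z, ← hK z hz0, hzy, hy]
      rfl
    have hE := hF.eq_zero_of_boundary (fun e => z (Sum.inl e))
      (fun e he => hz0 _ fun h => he (inl_mem_mixedIndex.1 h)) (by
        intro v hv
        simp only [rootSet, Set.mem_ofPred_eq, not_forall] at hv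
        obtain ⟨c, hc, hcv⟩ := hv
        have := hsum c
        rw [if_pos hc, not_not.1 hcv] at this
        exact this)
    funext s
    rw [← hzy]
    obtain ⟨e | c, hs⟩ := s
    · exact congrFun hE e
    · have := hsum c
      rwa [if_neg (inr_mem_mixedIndex.1 hs)] at this
  have hsurj : Function.Surjective K := by
    choose y hy1 hy2 using hF.exists_chain hu
    intro x
    refine ⟨∑ c, x c • fun s : mixedIndex P F => y c s, ?_⟩
    rw [map_sum]
    funext c'
    rw [Finset.sum_apply, Finset.sum_eq_single c']
    · rw [map_smul, Pi.smul_apply, hK _ (hy1 c'), hy2, if_pos rfl, smul_eq_mul, mul_one]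
    · intro c _ hc
      rw [map_smul, Pi.smul_apply, hK _ (hy1 c), hy2, if_neg hc.symm, smul_zero]
    · simp
  have := (LinearEquiv.ofBijective K ⟨hinj, hsurj⟩).finrank_eq
  rw [Module.finrank_fintype_fun_eq_card, Module.finrank_fintype_fun_eq_card,
    Fintype.card_coe] at this
  exact this

theorem sum_comp_eq_sum_of_bij {M ι κ : Type*} [Fintype ι] [Fintype κ] [AddCommMonoid M]
    {S : Finset κ} (hS : S.card = Fintype.card ι) {g : ι → κ} (hg : Function.Injective g)
    (hgS : ∀ i, g i ∈ S) (G : κ → M) (hG : ∀ s ∉ S, G s = 0) : ∑ i, G (g i) = ∑ s, G s := by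
  classical
  have himg : Finset.univ.image g = S := by
    refine Finset.eq_of_subset_of_card_le ?_ ?_
    · intro s hs
      obtain ⟨i, -, rfl⟩ := Finset.mem_image.1 hs
      exact hgS i
    · rw [Finset.card_image_of_injective _ hg, Finset.card_univ, hS]
  rw [← Finset.sum_subset (Finset.subset_univ S) fun s _ hs => hG s hs, ← himg,
    Finset.sum_image fun i _ j _ h => hg h]

open Classical in
-- The chains form an integral left inverse, so the determinant is a unit of `ℤ`. Only its square is
-- needed, so the order of the rows is irrelevant.
theorem IsRootedForest.det_mixedCoeff_sq (hu : ∀ c c', P c → P c' → u c = u c' → c = c')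
    (hF : Γ.IsRootedForest F (rootSet P u)) {g : Γ.V → Γ.E ⊕ Γ.V} (hg : Function.Injective g)
    (hgS : ∀ i, g i ∈ mixedIndex P F) :
    ((mixedCoeff P u).submatrix g id).det * ((mixedCoeff P u).submatrix g id).det = 1 := by
  choose y hy1 hy2 using hF.exists_chain hu
  have h1 : (Matrix.of fun c i => y c (g i)) * (mixedCoeff P u).submatrix g id = 1 := by
    ext c c'
    rw [Matrix.mul_apply]
    simp only [Matrix.of_apply, Matrix.submatrix_apply, id]
    rw [sum_comp_eq_sum_of_bij (hF.card_mixedIndex hu) hg hgS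
      (fun s => y c s * mixedCoeff P u s c') (fun s hs => by rw [hy1 c s hs, zero_mul]), hy2,
      Matrix.one_apply]
    exact if_congr eq_comm rfl rfl
  have h2 := congrArg Matrix.det h1
  rw [Matrix.det_mul, Matrix.det_one] at h2
  rcases Int.isUnit_iff.1 (IsUnit.of_mul_eq_one_right _ h2) with h | h <;> rw [h] <;> rfl

open Classical in
/-- The matrix of the vectors from the roots to the vertices `u c`, and of the free columns. -/
noncomputable def rootMatrix (P : Γ.V → Prop) (u : Γ.V → Γ.V) (x : Γ.V → Γ.V → ℂ)
    (ρ : Γ.V → Γ.V) : Matrix Γ.V Γ.V ℂ :=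
  Matrix.of fun v c => if P c then (if v = u c then 1 else 0) - (if v = ρ (u c) then 1 else 0)
    else x c v

open Classical in
-- Both ends of an edge of the forest have the same root, so its boundary is the difference of two
-- vectors from the root. These are columns of `rootMatrix`, or zero at a root.
theorem IsRootedForest.mixedGen_eq (hu : ∀ c c', P c → P c' → u c = u c' → c = c')
    (hF : Γ.IsRootedForest F (rootSet P u)) {ρ : Γ.V → Γ.V}
    (hρ : ∀ v, Γ.conn F v (ρ v) ∧ ρ v ∈ rootSet P u) (x : Γ.V → Γ.V → ℂ) (v : Γ.V)
    {s : Γ.E ⊕ Γ.V} (hs : s ∈ mixedIndex P F) :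
    mixedGen x v s = ∑ c, rootMatrix P u x ρ v c * (mixedCoeff P u s c : ℂ) := by
  have hvert : ∀ a : Γ.V, (if v = a then (1 : ℂ) else 0) - (if v = ρ a then 1 else 0) =
      ∑ c, rootMatrix P u x ρ v c * (if P c then (if u c = a then 1 else 0) else 0) := by
    intro a
    by_cases ha : a ∈ rootSet P u
    · have : ρ a = a := (hF.existsUnique_root a).unique (hρ a) ⟨(Γ.conn F).refl a, ha⟩
      rw [this, sub_self]
      refine (Finset.sum_eq_zero fun c _ => ?_).symm
      by_cases hc : P c
      · rw [if_pos hc, if_neg (ha c hc), mul_zero]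
      · rw [if_neg hc, mul_zero]
    · simp only [rootSet, Set.mem_ofPred_eq, not_forall] at ha
      obtain ⟨c, hc, hca⟩ := ha
      have hca := not_not.1 hca
      rw [Finset.sum_eq_single c]
      · rw [if_pos hc, if_pos hca, mul_one, rootMatrix, Matrix.of_apply, if_pos hc, hca]
      · intro c' _ hne
        by_cases hc' : P c'
        · rw [if_pos hc', if_neg fun hh => hne (hu _ _ hc' hc (hh.trans hca.symm)), mul_zero]
        · rw [if_neg hc', mul_zero]
      · simp
  rcases s with e | c
  · have he := inl_mem_mixedIndex.1 hs
    have hρe : ρ (Γ.src e) = ρ (Γ.tgt e) := (hF.existsUnique_root (Γ.src e)).unique (hρ _)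
      ⟨(Γ.conn F).trans (conn_src_tgt he) (hρ _).1, (hρ _).2⟩
    have h1 := hvert (Γ.src e)
    have h2 := hvert (Γ.tgt e)
    rw [hρe] at h1
    have h3 : mixedGen x v (Sum.inl e) =
        (if v = Γ.src e then (1 : ℂ) else 0) - if v = Γ.tgt e then 1 else 0 := by
      simp [mixedGen, edgeVec]
    rw [h3, ← sub_sub_sub_cancel_right _ _ (if v = ρ (Γ.tgt e) then (1 : ℂ) else 0), h1, h2,
      ← Finset.sum_sub_distrib]
    refine Finset.sum_congr rfl fun c _ => ?_
    rw [mixedCoeff_inl]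
    by_cases hc : P c
    · simp [hc, edgeVec, mul_sub]
    · simp [hc]
  · have hc := inr_mem_mixedIndex.1 hs
    rw [Finset.sum_eq_single c]
    · simp [mixedGen, rootMatrix, mixedCoeff_inr, hc]
    · intro c' _ hne
      simp [mixedCoeff_inr, hne.symm]
    · simp

end

end ElectricalNetwork

/-! ### The mixed matrix-tree theorem -/

namespace ElectricalNetwork

variable {n : ℕ} {Γ : ElectricalNetwork n} {P : Γ.V → Prop} {u : Γ.V → Γ.V}

/-- Only rooted forests contribute to Cauchy–Binet. A wrong set of free columns gives a zero row or
column of coefficients, and a cycle gives a relation between edge boundaries. A component without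
root gives a right kernel vector of the coefficients, its indicator; one with two roots gives a left
kernel vector, a chain between them. -/
theorem exists_forest_of_det_ne_zero (hu : ∀ c c', P c → P c' → u c = u c' → c = c')
    {S : Finset (Γ.E ⊕ Γ.V)} (hS : S.card = Fintype.card Γ.V) {g : Γ.V → Γ.E ⊕ Γ.V}
    (hg : Function.Injective g) (hgS : ∀ i, g i ∈ S) [DecidableEq Γ.V] {x : Γ.V → Γ.V → ℂ}
    (hA : ((mixedGen x).submatrix id g).det ≠ 0)
    (hC : ((mixedCoeff P u).submatrix g id).det ≠ 0) :
    ∃ F, S = mixedIndex P F ∧ Γ.IsRootedForest F (rootSet P u) := by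
  classical
  have hgsurj : ∀ s ∈ S, ∃ i, g i = s := by
    have himg : Finset.univ.image g = S := by
      refine Finset.eq_of_subset_of_card_le ?_ ?_
      · intro s hs
        obtain ⟨i, -, rfl⟩ := Finset.mem_image.1 hs
        exact hgS i
      · rw [Finset.card_image_of_injective _ hg, Finset.card_univ, hS]
    intro s hs
    rw [← himg] at hs
    simpa using hs
  have hsum : ∀ {M : Type} [AddCommMonoid M] (G : Γ.E ⊕ Γ.V → M), (∀ s ∉ S, G s = 0) →
      ∑ i, G (g i) = ∑ s, G s := fun G hG => sum_comp_eq_sum_of_bij hS hg hgS G hG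
  have hker : ∀ z : Γ.V → ℤ, (∀ s ∈ S, ∑ c, mixedCoeff P u s c * z c = 0) → z = 0 := by
    intro z hz
    by_contra hne
    exact hC (Matrix.exists_mulVec_eq_zero_iff.1 ⟨z, hne, funext fun i => hz (g i) (hgS i)⟩)
  have hcoker : ∀ z : Γ.E ⊕ Γ.V → ℤ, (∀ s ∉ S, z s = 0) →
      (∀ c, ∑ s, z s * mixedCoeff P u s c = 0) → z = 0 := by
    intro z hzS hz
    by_contra hne
    refine hC (Matrix.exists_vecMul_eq_zero_iff.1 ⟨fun i => z (g i), ?_, funext fun c => ?_⟩)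
    · intro h0
      apply hne
      funext s
      by_cases hs : s ∈ S
      · obtain ⟨i, rfl⟩ := hgsurj s hs
        exact congrFun h0 i
      · exact hzS s hs
    · exact (hsum (fun s => z s * mixedCoeff P u s c) fun s hs => by rw [hzS s hs, zero_mul]).trans
        (hz c)
  have hgen : ∀ z : Γ.E ⊕ Γ.V → ℂ, (∀ s ∉ S, z s = 0) →
      (∀ v, ∑ s, mixedGen x v s * z s = 0) → z = 0 := by
    intro z hzS hz
    by_contra hne
    refine hA (Matrix.exists_mulVec_eq_zero_iff.1 ⟨fun i => z (g i), ?_, funext fun v => ?_⟩)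
    · intro h0
      apply hne
      funext s
      by_cases hs : s ∈ S
      · obtain ⟨i, rfl⟩ := hgsurj s hs
        exact congrFun h0 i
      · exact hzS s hs
    · exact (hsum (fun s => mixedGen x v s * z s) fun s hs => by rw [hzS s hs, mul_zero]).trans
        (hz v)
  have hinr : ∀ c, Sum.inr c ∈ S ↔ ¬ P c := by
    intro c
    constructor
    · intro hc hP
      have h0 := hcoker (Sum.elim 0 fun c' => if c' = c then 1 else 0) (by
        rintro (e | c') hs
        · rfl
        · refine if_neg ?_
          rintro rfl
          exact hs hc) (fun c' => by
        rw [sum_mul_mixedCoeff]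
        by_cases hc' : P c'
        · simp [hc']
        · rw [if_neg hc', Sum.elim_inr, if_neg (by rintro rfl; exact hc' hP)])
      have := congrFun h0 (Sum.inr c)
      simp at this
    · intro hP
      by_contra hc
      have h0 := hker (fun c' => if c' = c then 1 else 0) (by
        intro s hs
        rw [Finset.sum_eq_single c (fun c' _ hne => by rw [if_neg hne, mul_zero]) (by simp),
          if_pos rfl, mul_one]
        rcases s with e | c'
        · rw [mixedCoeff_inl, if_neg hP]
        · rw [mixedCoeff_inr, if_neg]
          rintro ⟨rfl, -⟩
          exact hc hs)
      have := congrFun h0 c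
      simp at this
  have hF : ∀ e, e ∈ S.toLeft ↔ Sum.inl e ∈ S := fun e => Finset.mem_toLeft
  refine ⟨S.toLeft, ?_, ?_, ?_⟩
  · ext (e | c)
    · rw [inl_mem_mixedIndex, hF]
    · rw [inr_mem_mixedIndex, hinr]
  · intro e he F' hF' hconn
    obtain ⟨y, hy1, hy2⟩ := exists_edge_chain hconn
    have hey : y e = 0 := hy1 e fun h => ((hF' e).1 h).2 rfl
    have h0 := hgen (Sum.elim (fun e' => ((y e' - if e' = e then 1 else 0 : ℤ) : ℂ)) 0) (by
      rintro (e' | c) hs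
      · have h1 : y e' = 0 := hy1 e' fun h => hs ((hF e').1 ((hF' e').1 h).1)
        have h2 : e' ≠ e := by rintro rfl; exact hs ((hF _).1 he)
        simp [h1, h2]
      · rfl) (by
      intro v
      rw [Fintype.sum_sum_type]
      simp only [Sum.elim_inl, Sum.elim_inr, Pi.zero_apply, mul_zero, Finset.sum_const_zero,
        add_zero]
      have h1 : ∑ e', y e' * Γ.edgeVec e' v - Γ.edgeVec e v = 0 := by
        rw [hy2]
        exact sub_self _
      have h2 : ∑ e', mixedGen x v (Sum.inl e') * ((y e' - if e' = e then 1 else 0 : ℤ) : ℂ) =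
          ((∑ e', y e' * Γ.edgeVec e' v - Γ.edgeVec e v : ℤ) : ℂ) := by
        push_cast
        simp only [mul_sub, Finset.sum_sub_distrib, mul_ite, mul_one, mul_zero,
          Finset.sum_ite_eq', Finset.mem_univ, if_true]
        congr 1
        exact Finset.sum_congr rfl fun e' _ => mul_comm _ _
      rw [h2, h1, Int.cast_zero])
    have := congrFun h0 (Sum.inl e)
    simp [hey] at this
  · intro v
    have hex : ∃ r, Γ.conn S.toLeft v r ∧ r ∈ rootSet P u := by
      by_contra hno
      push Not at hno
      have hno' : ∀ r, Γ.conn S.toLeft v r → ∃ c, P c ∧ u c = r := by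
        intro r hr
        have := hno r hr
        simp only [rootSet, Set.mem_ofPred_eq, not_forall, not_not] at this
        obtain ⟨c, hc, hcr⟩ := this
        exact ⟨c, hc, hcr⟩
      have h0 := hker (fun c => if P c ∧ Γ.conn S.toLeft v (u c) then 1 else 0) (by
        rintro (e | c') hs
        · have he := (hF e).2 hs
          have h1 := sum_conn_edgeVec (F := S.toLeft) (e := e) v
          rw [if_congr (conn_src_iff_conn_tgt he v) rfl rfl, sub_self] at h1
          refine Eq.trans ?_ h1
          simp only [mixedCoeff_inl]
          rw [← Finset.sum_filter_add_sum_filter_not Finset.univ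
            (fun c => P c ∧ Γ.conn S.toLeft v (u c)), Finset.sum_eq_zero (s := Finset.univ.filter
              fun c => ¬ (P c ∧ Γ.conn S.toLeft v (u c))) (fun c hc => by
                rw [if_neg (Finset.mem_filter.1 hc).2, mul_zero]), add_zero]
          refine Finset.sum_bij (fun c _ => u c) ?_ ?_ ?_ ?_
          · intro c hc
            exact Finset.mem_filter.2 ⟨Finset.mem_univ _, (Finset.mem_filter.1 hc).2.2⟩
          · intro c hc c' hc' h
            exact hu _ _ (Finset.mem_filter.1 hc).2.1 (Finset.mem_filter.1 hc').2.1 h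
          · intro r hr
            have hr' := (Finset.mem_filter.1 hr).2
            obtain ⟨c, hc, rfl⟩ := hno' r hr'
            exact ⟨c, Finset.mem_filter.2 ⟨Finset.mem_univ _, hc, hr'⟩, rfl⟩
          · intro c hc
            have hc' := (Finset.mem_filter.1 hc).2
            rw [if_pos hc'.1, if_pos hc', mul_one]
        · refine Finset.sum_eq_zero fun c _ => ?_
          rw [mixedCoeff_inr]
          by_cases hc : P c
          · simp [hc]
          · simp [hc])
      obtain ⟨c, hc, hcv⟩ := hno' v ((Γ.conn _).refl v)
      have := congrFun h0 c
      simp only [hcv, hc, (Γ.conn S.toLeft).refl v, and_self, if_true] at this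
      exact one_ne_zero this
    obtain ⟨r, hr, hrZ⟩ := hex
    refine ⟨r, ⟨hr, hrZ⟩, ?_⟩
    rintro r' ⟨hr', hrZ'⟩
    by_contra hne
    obtain ⟨y, hy1, hy2⟩ := exists_edge_chain ((Γ.conn _).trans ((Γ.conn _).symm hr) hr')
    have h0 := hcoker (Sum.elim y 0) (by
      rintro (e | c) hs
      · exact hy1 e fun h => hs ((hF e).1 h)
      · rfl) (by
      intro c
      rw [sum_mul_mixedCoeff]
      by_cases hc : P c
      · rw [if_pos hc]
        simp only [Sum.elim_inl]
        rw [hy2, if_neg (hrZ c hc), if_neg (hrZ' c hc), sub_zero]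
      · rw [if_neg hc]; rfl)
    have h1 := hy2 r
    have h2 : ∀ e, y e = 0 := fun e => congrFun h0 (Sum.inl e)
    simp only [h2, zero_mul, Finset.sum_const_zero, if_true, if_neg (Ne.symm hne)] at h1
    norm_num at h1

open Classical in
/-- A mixed matrix-tree theorem: some columns are columns of the weighted Laplacian, the other
columns are arbitrary. -/
theorem det_mixed_eq_sum (hu : ∀ c c', P c → P c' → u c = u c' → c = c') (x : Γ.V → Γ.V → ℂ)
    (w : Γ.E → ℂ) (ρ : Finset Γ.E → Γ.V → Γ.V) (hρ : ∀ F, Γ.IsRootedForest F (rootSet P u) →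
      ∀ v, Γ.conn F v (ρ F v) ∧ ρ F v ∈ rootSet P u) :
    (Matrix.of fun v c => if P c then ∑ e, w e * Γ.edgeVec e (u c) * Γ.edgeVec e v
      else x c v).det = ∑ F with Γ.IsRootedForest F (rootSet P u),
        (∏ e ∈ F, w e) * (rootMatrix P u x (ρ F)).det := by
  set wt : Γ.E ⊕ Γ.V → ℂ := Sum.elim w 1 with hwt
  set B : Matrix (Γ.E ⊕ Γ.V) Γ.V ℂ := Matrix.of fun s c => wt s * mixedCoeff P u s c with hB
  have hM : (Matrix.of fun v c => if P c then ∑ e, w e * Γ.edgeVec e (u c) * Γ.edgeVec e v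
      else x c v) = mixedGen x * B := by
    ext v c
    rw [Matrix.mul_apply, Fintype.sum_sum_type, Matrix.of_apply]
    simp only [hB, Matrix.of_apply, hwt, Sum.elim_inl, Sum.elim_inr, mixedCoeff_inl,
      mixedCoeff_inr, mixedGen]
    by_cases hc : P c
    · simp only [hc, if_true, not_true, and_false, if_false, Int.cast_zero, mul_zero,
        Finset.sum_const_zero, add_zero]
      exact Finset.sum_congr rfl fun e _ => by ring
    · simp [hc]
  have hg : ∀ S : Finset (Γ.E ⊕ Γ.V), ∃ g : Γ.V → Γ.E ⊕ Γ.V, S.card = Fintype.card Γ.V →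
      Function.Injective g ∧ ∀ i, g i ∈ S := by
    intro S
    by_cases hS : S.card = Fintype.card Γ.V
    · have e : Γ.V ≃ S := Fintype.equivOfCardEq (by rw [Fintype.card_coe, hS])
      exact ⟨fun i => e i, fun _ => ⟨Subtype.val_injective.comp e.injective, fun i => (e i).2⟩⟩
    · exact ⟨fun v => Sum.inr v, fun h => absurd h hS⟩
  choose g hg using hg
  rw [hM, Matrix.det_mul_eq_sum_powersetCard (mixedGen x) B g hg]
  have hBdet : ∀ S, (B.submatrix (g S) id).det =
      (∏ i, wt (g S i)) * (((mixedCoeff P u).submatrix (g S) id).det : ℂ) := by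
    intro S
    have : B.submatrix (g S) id = Matrix.of fun i c => wt (g S i) *
        ((mixedCoeff P u).submatrix (g S) id).map (Int.castRingHom ℂ) i c := rfl
    rw [this, Matrix.det_mul_column, ← RingHom.mapMatrix_apply, ← RingHom.map_det]
    rfl
  have hinj : Set.InjOn (mixedIndex P) (Finset.univ.filter fun F =>
      Γ.IsRootedForest F (rootSet P u) : Set (Finset Γ.E)) := by
    intro F _ F' _ h
    ext e
    rw [← inl_mem_mixedIndex (P := P), h, inl_mem_mixedIndex]
  rw [← Finset.sum_subset (s₁ := (Finset.univ.filter fun F =>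
      Γ.IsRootedForest F (rootSet P u)).image (mixedIndex P)), Finset.sum_image hinj]
  · refine Finset.sum_congr rfl fun F hF => ?_
    have hF := (Finset.mem_filter.1 hF).2
    have hcard := hF.card_mixedIndex hu
    obtain ⟨hg1, hg2⟩ := hg _ hcard
    have hA : (mixedGen x).submatrix id (g (mixedIndex P F)) = rootMatrix P u x (ρ F) *
        (((mixedCoeff P u).submatrix (g (mixedIndex P F)) id).map
          (Int.castRingHom ℂ)).transpose := by
      ext v i
      exact hF.mixedGen_eq hu (hρ F hF) x v (hg2 i)
    have hprod : ∏ i, wt (g (mixedIndex P F) i) = ∏ e ∈ F, w e := by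
      have h1 : ∏ i, wt (g (mixedIndex P F) i) = ∏ s ∈ mixedIndex P F, wt s := by
        have himg : Finset.univ.image (g (mixedIndex P F)) = mixedIndex P F := by
          refine Finset.eq_of_subset_of_card_le ?_ ?_
          · intro s hs
            obtain ⟨i, -, rfl⟩ := Finset.mem_image.1 hs
            exact hg2 i
          · rw [Finset.card_image_of_injective _ hg1, Finset.card_univ, hcard]
        conv_rhs => rw [← himg]
        rw [Finset.prod_image fun i _ j _ h => hg1 h]
      rw [h1, mixedIndex, Finset.prod_disjSum]
      simp [hwt]
    have hsq := hF.det_mixedCoeff_sq hu hg1 hg2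
    rw [hBdet, hA, Matrix.det_mul, Matrix.det_transpose, ← RingHom.mapMatrix_apply,
      ← RingHom.map_det, hprod]
    have hsq' := congrArg (Int.castRingHom ℂ) hsq
    rw [map_mul, map_one] at hsq'
    simp only [eq_intCast] at hsq' ⊢
    linear_combination ((∏ e ∈ F, w e) * (rootMatrix P u x (ρ F)).det) * hsq'
  · intro S hS
    obtain ⟨F, hF, rfl⟩ := Finset.mem_image.1 hS
    exact Finset.mem_powersetCard.2 ⟨Finset.subset_univ _,
      (Finset.mem_filter.1 hF).2.card_mixedIndex hu⟩
  · intro S hS hnot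
    have hcard := (Finset.mem_powersetCard.1 hS).2
    by_contra hne
    obtain ⟨F, rfl, hF⟩ := exists_forest_of_det_ne_zero hu hcard (hg S hcard).1 (hg S hcard).2
      (left_ne_zero_of_mul hne) (fun h0 => by
        refine hne ?_
        rw [hBdet, h0, Int.cast_zero, mul_zero, mul_zero])
    exact hnot (Finset.mem_image_of_mem _ (Finset.mem_filter.2 ⟨Finset.mem_univ _, hF⟩))

end ElectricalNetwork

/-! ### Tuples that miss no region -/

section Regions

variable {N : ℕ} {σ : Setoid (Fin (N + 1))}

/-- By comparison with the canonical tuple, as many places are missing as there are parts; if every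
part misses one, each misses exactly one. -/
theorem IsNoncrossing.isConcordantTuple_of_exists (h : IsNoncrossing σ)
    {f : Fin N → Fin (2 * (N + 1))} (hf : Function.Injective f)
    (hex : ∀ p, ∃ q, placeSetoid σ p q ∧ q ∉ Set.range f) : IsConcordantTuple σ f := by
  classical
  have hc := h.isConcordantTuple_canonicalTuple
  have h1 := card_filter_tuple hc.injective Finset.univ
  have h2 := card_filter_tuple hf Finset.univ
  simp only [Finset.mem_univ, Finset.filter_true, Finset.card_univ, Fintype.card_fin] at h1 h2
  choose φ hφ using hex
  have hinj : Set.InjOn φ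
      (Finset.univ.filter fun q => q ∉ Set.range (canonicalTuple σ) : Set _) := by
    intro p hp q hq hpq
    refine (hc.existsUnique p).unique ⟨(placeSetoid σ).refl p, (Finset.mem_filter.1 hp).2⟩
      ⟨?_, (Finset.mem_filter.1 hq).2⟩
    refine (placeSetoid σ).trans (hφ p).1 ?_
    rw [hpq]
    exact (placeSetoid σ).symm (hφ q).1
  have himg : (Finset.univ.filter fun q => q ∉ Set.range (canonicalTuple σ)).image φ =
      Finset.univ.filter fun q => q ∉ Set.range f := by
    refine Finset.eq_of_subset_of_card_le ?_ ?_
    · intro q hq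
      obtain ⟨p, -, rfl⟩ := Finset.mem_image.1 hq
      exact Finset.mem_filter.2 ⟨Finset.mem_univ _, (hφ p).2⟩
    · rw [Finset.card_image_of_injOn hinj]
      omega
  have hpre : ∀ q, q ∉ Set.range f → ∃ p, p ∉ Set.range (canonicalTuple σ) ∧ φ p = q := by
    intro q hq
    have : q ∈ (Finset.univ.filter fun q => q ∉ Set.range (canonicalTuple σ)).image φ := by
      rw [himg]
      exact Finset.mem_filter.2 ⟨Finset.mem_univ _, hq⟩
    obtain ⟨p, hp, rfl⟩ := Finset.mem_image.1 this
    exact ⟨p, (Finset.mem_filter.1 hp).2, rfl⟩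
  refine ⟨hf, fun p => ⟨φ p, hφ p, fun q hq => ?_⟩⟩
  obtain ⟨p₁, hp₁, rfl⟩ := hpre q hq.2
  obtain ⟨p₂, hp₂, h₂⟩ := hpre (φ p) (hφ p).2
  have h3 : placeSetoid σ p p₁ := (placeSetoid σ).trans hq.1 ((placeSetoid σ).symm (hφ p₁).1)
  have h4 : placeSetoid σ p p₂ := by
    refine (placeSetoid σ).trans (hφ p).1 ?_
    rw [← h₂]
    exact (placeSetoid σ).symm (hφ p₂).1
  rw [(hc.existsUnique p).unique ⟨h3, hp₁⟩ ⟨h4, hp₂⟩, h₂]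

/-- The determinant vanishes if all dual vertices of a region are in the tuple. -/
theorem IsNoncrossing.det_placeMatrix_eq_zero (h : IsNoncrossing σ)
    {f : Fin N → Fin (2 * (N + 1))} {r : Fin (N + 1) → Fin (N + 1)} (hr : ∀ x, σ x (r x))
    (hrr : ∀ x y, σ x y → r x = r y) (hrf : ∀ x, oddPlace x ∉ Set.range f → r x = x)
    (hf : Function.Injective f) {b : Fin (N + 1)}
    (hb : ∀ y, dualPartition σ b y → evenPlace y ∈ Set.range f) :
    (placeMatrix r f).det = 0 := by
  classical
  let d : Fin (2 * (N + 1)) → ℂ := placeElim (fun x => (if dualPartition σ b x then (1 : ℂ) else 0) -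
      if dualPartition σ b (x - 1) then 1 else 0) (fun y => -if dualPartition σ b y then 1 else 0)
  have hsum : ∑ q, d q • placeVec r q = 0 := by
    rw [sum_places]
    simp only [d, placeElim_oddPlace, placeElim_evenPlace, neg_smul, Finset.sum_neg_distrib]
    rw [h.sum_region_eq r hr hrr b, add_neg_cancel]
  have hS : ∑ j, d (f j) • placeVec r (f j) = 0 := by
    rw [← Finset.sum_image (s := Finset.univ) (g := f) (f := fun q => d q • placeVec r q)
      fun i _ j _ hij => hf hij, ← hsum]
    refine Finset.sum_subset (Finset.subset_univ _) fun q _ hq => ?_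
    have hq2 : q ∉ Set.range f := by
      rintro ⟨j, rfl⟩
      exact hq (Finset.mem_image_of_mem _ (Finset.mem_univ j))
    rcases place_cases q with ⟨x, rfl⟩ | ⟨x, rfl⟩
    · simp [placeVec, hrf x hq2]
    · have : ¬ dualPartition σ b x := fun hd => hq2 (hb x hd)
      simp [d, this]
  -- The relation of the region now involves only columns of the tuple, and it is nontrivial because
  -- `b` has coefficient `-1`.
  obtain ⟨k, hk⟩ := hb b ((dualPartition σ).refl b)
  refine Matrix.exists_mulVec_eq_zero_iff.1 ⟨fun j => Fin.cases (motive := fun _ => ℂ) 0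
    (fun l => d (f l) * placeSign (f l)) j, ?_, ?_⟩
  · intro h0
    have h1 := congrFun h0 k.succ
    simp only [Fin.cases_succ, Pi.zero_apply, hk] at h1
    have h2 := placeSign_mul_self (N := N) (evenPlace b)
    have h3 : d (evenPlace b) = -1 := by simp [d]
    rw [h3, neg_one_mul, neg_eq_zero] at h1
    rw [h1, mul_zero] at h2
    exact zero_ne_one h2
  · funext i
    have h1 := congrFun hS i
    rw [Finset.sum_apply] at h1
    rw [Matrix.mulVec, dotProduct, Fin.sum_univ_succ]
    refine Eq.trans ?_ h1
    simp only [Fin.cases_zero, mul_zero, zero_add, Fin.cases_succ, placeMatrix_succ, Pi.smul_apply,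
      smul_eq_mul]
    refine Finset.sum_congr rfl fun l _ => ?_
    linear_combination (d (f l) * placeVec r (f l) i) * placeSign_mul_self (f l)

end Regions

/-! ### The concordant sums of the grove measurements are Plücker coordinates -/

theorem IsPluckerFunction.const_mul {k m : ℕ} {P : (Fin k → Fin m) → ℂ} (hP : IsPluckerFunction P)
    (c : ℂ) : IsPluckerFunction fun f => c * P f where
  comp_perm f τ := by rw [hP.comp_perm]; ring
  eq_zero f hf := by rw [hP.eq_zero f hf, mul_zero]
  exchange f g i := by
    rw [mul_mul_mul_comm, hP.exchange f g i, Finset.mul_sum]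
    exact Finset.sum_congr rfl fun j _ => by ring

namespace ElectricalNetwork

section Network

variable {N : ℕ} {Γ : ElectricalNetwork (N + 1)}

/-- Either an interior vertex or a boundary vertex. -/
theorem vertex_cases (v : Γ.V) : v ∉ Set.range Γ.bdry ∨ v = Γ.bdry 0 ∨ ∃ k : Fin N, v = Γ.bdry k.succ := by
  by_cases h : v ∈ Set.range Γ.bdry
  · obtain ⟨i, rfl⟩ := h
    rcases Fin.eq_zero_or_eq_succ i with rfl | ⟨k, rfl⟩
    · exact Or.inr (Or.inl rfl)
    · exact Or.inr (Or.inr ⟨k, rfl⟩)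
  · exact Or.inl h

variable (Γ)

open Classical in
/-- A function of the vertices given by its values at the interior vertices, at the first boundary
vertex and at the other boundary vertices. -/
noncomputable def vertexElim {M : Type*} (a : Γ.V → M) (b : M) (c : Fin N → M) (v : Γ.V) : M :=
  if h : ∃ i, Γ.bdry i = v then Fin.cases (motive := fun _ => M) b c h.choose else a v

variable {Γ}

theorem vertexElim_interior {M : Type*} (a : Γ.V → M) (b : M) (c : Fin N → M) {v : Γ.V}
    (hv : v ∉ Set.range Γ.bdry) : Γ.vertexElim a b c v = a v := dif_neg hv

theorem vertexElim_bdry {M : Type*} (a : Γ.V → M) (b : M) (c : Fin N → M) (i : Fin (N + 1)) :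
    Γ.vertexElim a b c (Γ.bdry i) = Fin.cases (motive := fun _ => M) b c i := by
  have h : ∃ j, Γ.bdry j = Γ.bdry i := ⟨i, rfl⟩
  rw [vertexElim, dif_pos h, bdry_injective h.choose_spec]

@[simp] theorem vertexElim_bdry_zero {M : Type*} (a : Γ.V → M) (b : M) (c : Fin N → M) :
    Γ.vertexElim a b c (Γ.bdry 0) = b := vertexElim_bdry a b c 0

@[simp] theorem vertexElim_bdry_succ {M : Type*} (a : Γ.V → M) (b : M) (c : Fin N → M) (k : Fin N) :
    Γ.vertexElim a b c (Γ.bdry k.succ) = c k := vertexElim_bdry a b c k.succ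

theorem bdry_eq_bdry_iff {i j : Fin (N + 1)} : Γ.bdry i = Γ.bdry j ↔ i = j :=
  bdry_injective.eq_iff

variable (Γ)

/-- The column of the weighted Laplacian at a vertex. -/
noncomputable def laplaceColumn (a v : Γ.V) : ℂ :=
  ∑ e, (Γ.wt e : ℂ) * Γ.edgeVec e a * Γ.edgeVec e v

open Classical in
/-- The current out of a boundary vertex `x` for a potential at `x`, or from `x` to `x + 1`. -/
noncomputable def placeColumn (p : Fin (2 * (N + 1))) (v : Γ.V) : ℂ :=
  placeSign p * placeElim (fun x => Γ.laplaceColumn (Γ.bdry x) v)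
    (fun x => (if v = Γ.bdry x then 1 else 0) - if v = Γ.bdry (x + 1) then 1 else 0) p

open Classical in
/-- The mixed matrix of a tuple of places. -/
noncomputable def networkMatrix (f : Fin N → Fin (2 * (N + 1))) : Matrix Γ.V Γ.V ℂ :=
  Matrix.of fun v c => Γ.vertexElim (fun a => Γ.laplaceColumn a v)
    (if v = Γ.bdry 0 then 1 else 0) (fun k => Γ.placeColumn (f k) v) c

open Classical in
-- The entry `f k` affects only the column at `Γ.bdry k.succ`; all other columns are fixed.
theorem isPluckerFunction_det_networkMatrix :
    IsPluckerFunction fun f : Fin N → Fin (2 * (N + 1)) => (Γ.networkMatrix f).det := by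
  refine isPluckerFunction_det _ ⟨fun k : Fin N => Γ.bdry k.succ, fun i j h =>
    Fin.succ_injective _ (bdry_injective h)⟩ Γ.placeColumn (fun f i r => ?_) fun f g r s hs => ?_
  · exact vertexElim_bdry_succ (fun a => Γ.laplaceColumn a r) (if r = Γ.bdry 0 then 1 else 0)
      (fun k => Γ.placeColumn (f k) r) i
  · rcases vertex_cases s with h | rfl | ⟨k, rfl⟩
    · simp only [networkMatrix, Matrix.of_apply, vertexElim_interior _ _ _ h]
    · simp [networkMatrix]
    · exact absurd ⟨k, rfl⟩ hs

/-- The columns of the network matrix that are columns of the Laplacian. -/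
def IsPotential (f : Fin N → Fin (2 * (N + 1))) : Γ.V → Prop :=
  Γ.vertexElim (fun _ => True) False fun k => ∃ x, f k = oddPlace x

/-- The vertex of the column of the Laplacian. -/
noncomputable def potentialVertex (f : Fin N → Fin (2 * (N + 1))) : Γ.V → Γ.V :=
  Γ.vertexElim (fun v => v) (Γ.bdry 0) fun k => placeElim (fun x => Γ.bdry x) (fun x => Γ.bdry x) (f k)

open Classical in
/-- The other columns. -/
noncomputable def freeColumn (f : Fin N → Fin (2 * (N + 1))) : Γ.V → Γ.V → ℂ :=
  Γ.vertexElim (fun _ => 0) (fun v => if v = Γ.bdry 0 then 1 else 0) fun k =>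
    placeElim (fun _ => 0)
      (fun x v => (if v = Γ.bdry x then 1 else 0) - if v = Γ.bdry (x + 1) then 1 else 0) (f k)

variable {Γ}

theorem potentialVertex_injOn {f : Fin N → Fin (2 * (N + 1))} (hf : Function.Injective f)
    (c c' : Γ.V) (hc : Γ.IsPotential f c) (hc' : Γ.IsPotential f c')
    (h : Γ.potentialVertex f c = Γ.potentialVertex f c') : c = c' := by
  unfold IsPotential potentialVertex at *
  rcases vertex_cases c with h1 | rfl | ⟨k, rfl⟩ <;>
    rcases vertex_cases c' with h2 | rfl | ⟨l, rfl⟩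
  · rwa [vertexElim_interior _ _ _ h1, vertexElim_interior _ _ _ h2] at h
  · simp at hc'
  · rw [vertexElim_bdry_succ] at hc'
    obtain ⟨x, hx⟩ := hc'
    rw [vertexElim_interior _ _ _ h1, vertexElim_bdry_succ, hx, placeElim_oddPlace] at h
    exact absurd ⟨x, h.symm⟩ h1
  · simp at hc
  · rfl
  · simp at hc
  · rw [vertexElim_bdry_succ] at hc
    obtain ⟨x, hx⟩ := hc
    rw [vertexElim_interior _ _ _ h2, vertexElim_bdry_succ, hx, placeElim_oddPlace] at h
    exact absurd ⟨x, h⟩ h2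
  · simp at hc'
  · rw [vertexElim_bdry_succ] at hc hc'
    obtain ⟨x, hx⟩ := hc
    obtain ⟨y, hy⟩ := hc'
    rw [vertexElim_bdry_succ, vertexElim_bdry_succ, hx, hy, placeElim_oddPlace,
      placeElim_oddPlace, bdry_eq_bdry_iff] at h
    rw [hf (hx.trans ((congrArg _ h).trans hy.symm))]

/-- Interior vertices always carry a Laplacian column, so the roots are the boundary vertices whose
places are missing in `f`. -/
theorem rootSet_eq (f : Fin N → Fin (2 * (N + 1))) :
    rootSet (Γ.IsPotential f) (Γ.potentialVertex f) =
      {v | ∃ x, v = Γ.bdry x ∧ oddPlace x ∉ Set.range f} := by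
  ext v
  simp only [rootSet, Set.mem_ofPred_eq]
  constructor
  · intro h
    rcases vertex_cases v with h1 | h1
    · refine absurd (vertexElim_interior _ _ _ h1) (h v ?_)
      rw [IsPotential, vertexElim_interior _ _ _ h1]
      trivial
    · have hx : ∃ x, v = Γ.bdry x := by
        rcases h1 with rfl | ⟨k, rfl⟩
        · exact ⟨_, rfl⟩
        · exact ⟨_, rfl⟩
      obtain ⟨x, rfl⟩ := hx
      refine ⟨x, rfl, ?_⟩
      rintro ⟨k, hk⟩
      refine h (Γ.bdry k.succ) ?_ ?_
      · rw [IsPotential, vertexElim_bdry_succ]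
        exact ⟨x, hk⟩
      · rw [potentialVertex, vertexElim_bdry_succ, hk, placeElim_oddPlace]
  · rintro ⟨x, rfl, hx⟩ c hc h
    rcases vertex_cases c with h1 | rfl | ⟨k, rfl⟩
    · rw [potentialVertex, vertexElim_interior _ _ _ h1] at h
      exact h1 ⟨x, h.symm⟩
    · simp [IsPotential] at hc
    · rw [IsPotential, vertexElim_bdry_succ] at hc
      obtain ⟨y, hy⟩ := hc
      rw [potentialVertex, vertexElim_bdry_succ, hy, placeElim_oddPlace, bdry_eq_bdry_iff] at h
      exact hx ⟨k, by rw [hy, h]⟩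

/-- The sign of a column of the network matrix. -/
noncomputable def columnSign (Γ : ElectricalNetwork (N + 1)) (f : Fin N → Fin (2 * (N + 1))) :
    Γ.V → ℂ :=
  Γ.vertexElim (fun _ => 1) 1 fun k => placeSign (f k)

open Classical in
theorem networkMatrix_eq (f : Fin N → Fin (2 * (N + 1))) :
    Γ.networkMatrix f = Matrix.of fun v c => Γ.columnSign f c *
      (Matrix.of fun v c => if Γ.IsPotential f c then
        ∑ e, (Γ.wt e : ℂ) * Γ.edgeVec e (Γ.potentialVertex f c) * Γ.edgeVec e v
        else Γ.freeColumn f c v : Matrix Γ.V Γ.V ℂ) v c := by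
  ext v c
  simp only [networkMatrix, Matrix.of_apply]
  rcases vertex_cases c with h | rfl | ⟨k, rfl⟩
  · simp only [columnSign, IsPotential, potentialVertex, vertexElim_interior _ _ _ h, if_true,
      one_mul]
    rfl
  · simp [columnSign, IsPotential, freeColumn]
  · simp only [columnSign, IsPotential, potentialVertex, freeColumn, vertexElim_bdry_succ]
    rcases place_cases (f k) with ⟨x, hx⟩ | ⟨x, hx⟩
    · rw [if_pos ⟨x, hx⟩, hx]
      simp [placeColumn, laplaceColumn]
    · rw [if_neg (by rintro ⟨y, hy⟩; rw [hx] at hy; simp at hy), hx]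
      simp [placeColumn]

open Classical in
/-- Elimination of the interior vertices. -/
theorem det_columnSign_mul_rootMatrix (f : Fin N → Fin (2 * (N + 1))) (ρ : Γ.V → Γ.V)
    (r : Fin (N + 1) → Fin (N + 1)) (hr : ∀ x, ρ (Γ.bdry x) = Γ.bdry (r x))
    (hρ : ∀ v, ρ v ∈ Set.range Γ.bdry) :
    (Matrix.of fun v c => Γ.columnSign f c * rootMatrix (Γ.IsPotential f) (Γ.potentialVertex f)
      (Γ.freeColumn f) ρ v c).det = (placeMatrix r f).det := by
  set M : Matrix Γ.V Γ.V ℂ := Matrix.of fun v c => Γ.columnSign f c *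
    rootMatrix (Γ.IsPotential f) (Γ.potentialVertex f) (Γ.freeColumn f) ρ v c with hM
  have hint : ∀ v c, c ∉ Set.range Γ.bdry →
      M v c = (if v = c then 1 else 0) - if v = ρ c then 1 else 0 := by
    intro v c hc
    simp only [hM, rootMatrix, Matrix.of_apply, columnSign, IsPotential, potentialVertex,
      vertexElim_interior _ _ _ hc, if_true, one_mul]
  have hzero : ∀ v, M v (Γ.bdry 0) = if v = Γ.bdry 0 then 1 else 0 := by
    intro v
    simp [hM, rootMatrix, columnSign, IsPotential, freeColumn]
  have hodd : ∀ v k x, f k = oddPlace x → M v (Γ.bdry k.succ) = placeSign (f k) *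
      ((if v = Γ.bdry x then 1 else 0) - if v = Γ.bdry (r x) then 1 else 0) := by
    intro v k x hx
    simp [hM, rootMatrix, columnSign, IsPotential, potentialVertex, hx, hr]
  have heven : ∀ v k x, f k = evenPlace x → M v (Γ.bdry k.succ) = placeSign (f k) *
      ((if v = Γ.bdry x then 1 else 0) - if v = Γ.bdry (x + 1) then 1 else 0) := by
    intro v k x hx
    simp [hM, rootMatrix, columnSign, IsPotential, freeColumn, hx]
  -- Boundary columns vanish at interior vertices, and the interior block is the identity because
  -- all roots lie on the boundary.
  rw [M.twoBlockTriangular_det (fun v => v ∈ Set.range Γ.bdry)]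
  · have h1 : M.toSquareBlockProp (fun v => ¬ v ∈ Set.range Γ.bdry) = 1 := by
      ext ⟨v, hv⟩ ⟨c, hc⟩
      have hvc : v ≠ ρ c := fun h => hv (h.symm ▸ hρ c)
      rw [Matrix.toSquareBlockProp_def, Matrix.of_apply, hint _ _ hc, Matrix.one_apply,
        if_neg hvc, sub_zero]
      simp
    have h2 : (M.toSquareBlockProp fun v => v ∈ Set.range Γ.bdry).submatrix
        (Equiv.ofInjective Γ.bdry bdry_injective) (Equiv.ofInjective Γ.bdry bdry_injective) =
        placeMatrix r f := by
      ext i j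
      rw [Matrix.submatrix_apply, Matrix.toSquareBlockProp_def, Matrix.of_apply,
        Equiv.ofInjective_apply, Equiv.ofInjective_apply]
      rcases Fin.eq_zero_or_eq_succ j with rfl | ⟨k, rfl⟩
      · rw [hzero, placeMatrix_zero]
        exact if_congr bdry_eq_bdry_iff rfl rfl
      · rw [placeMatrix_succ]
        rcases place_cases (f k) with ⟨x, hx⟩ | ⟨x, hx⟩
        · rw [hodd _ k x hx, hx]
          simp [placeVec, bdry_eq_bdry_iff, Pi.single_apply]
        · rw [heven _ k x hx, hx]
          simp [placeVec, bdry_eq_bdry_iff, Pi.single_apply]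
    rw [h1, Matrix.det_one, mul_one, ← h2]
    convert (Matrix.det_submatrix_equiv_self _ _).symm
  · rintro v hv c ⟨i, rfl⟩
    have hne : ∀ j, v ≠ Γ.bdry j := fun j h => hv ⟨j, h.symm⟩
    rcases Fin.eq_zero_or_eq_succ i with rfl | ⟨k, rfl⟩
    · rw [hzero, if_neg (hne 0)]
    · rcases place_cases (f k) with ⟨x, hx⟩ | ⟨x, hx⟩
      · rw [hodd _ k x hx, if_neg (hne _), if_neg (hne _), sub_zero, mul_zero]
      · rw [heven _ k x hx, if_neg (hne _), if_neg (hne _), sub_zero, mul_zero]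

end Network

end ElectricalNetwork

/-! ### Concordant sums of grove measurements as determinants -/

namespace ElectricalNetwork

section GroveVector

variable {N : ℕ} {Γ : ElectricalNetwork (N + 1)}

theorem isNoncrossing_boundaryPartition (F : Finset Γ.E) :
    IsNoncrossing (Γ.boundaryPartition F) := boundaryPartition_noncrossing F

theorem IsRootedForest.isGrove {F : Finset Γ.E} {f : Fin N → Fin (2 * (N + 1))}
    (hF : Γ.IsRootedForest F (rootSet (Γ.IsPotential f) (Γ.potentialVertex f))) : Γ.IsGrove F := by
  rw [isGrove_iff]
  refine ⟨hF.acyclic, fun v => ?_⟩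
  obtain ⟨r, ⟨hr, hrZ⟩, -⟩ := hF.existsUnique_root v
  rw [rootSet_eq] at hrZ
  obtain ⟨x, rfl, -⟩ := hrZ
  exact ⟨x, hr⟩

/-- Concordance on the boundary vertices says that each component of the grove has exactly one
vertex missing in `f`. -/
theorem IsGrove.isRootedForest {F : Finset Γ.E} {f : Fin N → Fin (2 * (N + 1))}
    (hF : Γ.IsGrove F) (hc : IsConcordantTuple (Γ.boundaryPartition F) f) :
    Γ.IsRootedForest F (rootSet (Γ.IsPotential f) (Γ.potentialVertex f)) := by
  rw [isGrove_iff] at hF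
  refine ⟨hF.1, fun v => ?_⟩
  rw [rootSet_eq]
  obtain ⟨i, hi⟩ := hF.2 v
  obtain ⟨r, ⟨hr, hrf⟩, hu⟩ := hc.existsUnique_odd i
  refine ⟨Γ.bdry r, ⟨(Γ.conn F).trans hi hr, r, rfl, hrf⟩, ?_⟩
  rintro _ ⟨hv, x, rfl, hx⟩
  rw [hu x ⟨(Γ.conn F).trans ((Γ.conn F).symm hi) hv, hx⟩]

theorem IsRootedForest.exists_root {F : Finset Γ.E} {f : Fin N → Fin (2 * (N + 1))}
    (hF : Γ.IsRootedForest F (rootSet (Γ.IsPotential f) (Γ.potentialVertex f))) (v : Γ.V) :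
    ∃ x, Γ.conn F v (Γ.bdry x) ∧ oddPlace x ∉ Set.range f := by
  obtain ⟨r, ⟨hr, hrZ⟩, -⟩ := hF.existsUnique_root v
  rw [rootSet_eq] at hrZ
  obtain ⟨x, rfl, hx⟩ := hrZ
  exact ⟨x, hr, hx⟩

theorem IsRootedForest.root_unique {F : Finset Γ.E} {f : Fin N → Fin (2 * (N + 1))}
    (hF : Γ.IsRootedForest F (rootSet (Γ.IsPotential f) (Γ.potentialVertex f))) {v : Γ.V}
    {x y : Fin (N + 1)} (hx : Γ.conn F v (Γ.bdry x)) (hxf : oddPlace x ∉ Set.range f)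
    (hy : Γ.conn F v (Γ.bdry y)) (hyf : oddPlace y ∉ Set.range f) : x = y := by
  refine bdry_injective ((hF.existsUnique_root v).unique ⟨hx, ?_⟩ ⟨hy, ?_⟩) <;> rw [rootSet_eq]
  · exact ⟨x, rfl, hxf⟩
  · exact ⟨y, rfl, hyf⟩

open Classical in
/-- The contribution of a rooted forest to the determinant of the network matrix. -/
theorem IsRootedForest.det_placeMatrix {F : Finset Γ.E} {f : Fin N → Fin (2 * (N + 1))}
    (hf : Function.Injective f)
    (hF : Γ.IsRootedForest F (rootSet (Γ.IsPotential f) (Γ.potentialVertex f)))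
    {r : Fin (N + 1) → Fin (N + 1)}
    (hr : ∀ x, Γ.conn F (Γ.bdry x) (Γ.bdry (r x)) ∧ oddPlace (r x) ∉ Set.range f) :
    (placeMatrix r f).det = if IsConcordantTuple (Γ.boundaryPartition F) f then
      (∏ k : Fin N, (-1) ^ ((k : ℕ) + 1)) * (tupleSign f : ℂ) else 0 := by
  have hnc := isNoncrossing_boundaryPartition F
  split_ifs with hc
  · have hroot : r = tupleRoot (Γ.boundaryPartition F) f :=
      funext fun x => (hc.tupleRoot_eq (hr x).1 (hr x).2).symm
    have hsq : (tupleSign f : ℂ) * tupleSign f = 1 := by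
      rw [← Int.cast_mul, tupleSign_mul_self hf, Int.cast_one]
    rw [hroot, ← hc.det_mul_tupleSign hnc, mul_assoc, hsq, mul_one]
  -- Some part has no missing place. It is not a part of boundary vertices, since these have roots;
  -- so it is a region, and the determinant vanishes.
  · have hno : ∃ p, ∀ q, placeSetoid (Γ.boundaryPartition F) p q → q ∈ Set.range f := by
      by_contra hno
      push Not at hno
      exact hc (hnc.isConcordantTuple_of_exists hf hno)
    obtain ⟨p, hp⟩ := hno
    rcases place_cases p with ⟨x, rfl⟩ | ⟨b, rfl⟩
    · exact absurd (hp (oddPlace (r x)) ((placeSetoid_oddPlace _ _).2 (hr x).1)) (hr x).2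
    · exact hnc.det_placeMatrix_eq_zero (fun x => (hr x).1)
        (fun x y hxy => hF.root_unique (hr x).1 (hr x).2 ((Γ.conn F).trans hxy (hr y).1) (hr y).2)
        (fun x hx => hF.root_unique (hr x).1 (hr x).2 ((Γ.conn F).refl _) hx) hf
        (fun y hy => hp _ ((placeSetoid_evenPlace _ _).2 hy))

open Classical in
theorem det_networkMatrix {f : Fin N → Fin (2 * (N + 1))} (hf : Function.Injective f) :
    (Γ.networkMatrix f).det = (∏ k : Fin N, (-1) ^ ((k : ℕ) + 1)) * (tupleSign f : ℂ) *
      ∑ F : Finset Γ.E with Γ.IsGrove F ∧ IsConcordantTuple (Γ.boundaryPartition F) f,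
        ∏ e ∈ F, (Γ.wt e : ℂ) := by
  have hex : ∀ (F : Finset Γ.E) (v : Γ.V), ∃ x : Fin (N + 1),
      Γ.IsRootedForest F (rootSet (Γ.IsPotential f) (Γ.potentialVertex f)) →
        Γ.conn F v (Γ.bdry x) ∧ oddPlace x ∉ Set.range f := by
    intro F v
    by_cases hF : Γ.IsRootedForest F (rootSet (Γ.IsPotential f) (Γ.potentialVertex f))
    · obtain ⟨x, hx⟩ := hF.exists_root v
      exact ⟨x, fun _ => hx⟩
    · exact ⟨0, fun h => absurd h hF⟩
  choose ρ hρ using hex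
  rw [networkMatrix_eq, Matrix.det_mul_row, det_mixed_eq_sum (potentialVertex_injOn hf)
    (Γ.freeColumn f) (fun e => (Γ.wt e : ℂ)) (fun F v => Γ.bdry (ρ F v)) (fun F hF v => by
      rw [rootSet_eq]
      exact ⟨(hρ F v hF).1, _, rfl, (hρ F v hF).2⟩), Finset.mul_sum, Finset.mul_sum]
  have hterm : ∀ F, Γ.IsRootedForest F (rootSet (Γ.IsPotential f) (Γ.potentialVertex f)) →
      (∏ c, Γ.columnSign f c) * ((∏ e ∈ F, (Γ.wt e : ℂ)) *
        (rootMatrix (Γ.IsPotential f) (Γ.potentialVertex f) (Γ.freeColumn f)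
          fun v => Γ.bdry (ρ F v)).det) =
      if IsConcordantTuple (Γ.boundaryPartition F) f then
        (∏ k : Fin N, (-1) ^ ((k : ℕ) + 1)) * (tupleSign f : ℂ) * ∏ e ∈ F, (Γ.wt e : ℂ) else 0 := by
    intro F hF
    rw [mul_left_comm, ← Matrix.det_mul_row, det_columnSign_mul_rootMatrix f _
      (fun x => ρ F (Γ.bdry x)) (fun x => rfl) (fun v => ⟨_, rfl⟩),
      hF.det_placeMatrix hf fun x => hρ F _ hF]
    split_ifs <;> ring
  rw [Finset.sum_congr rfl fun F hF => hterm F (Finset.mem_filter.1 hF).2, ← Finset.sum_filter,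
    Finset.filter_filter]
  refine Finset.sum_congr (Finset.filter_congr fun F _ => ?_) fun _ _ => rfl
  exact ⟨fun h => ⟨h.1.isGrove, h.2⟩, fun h => ⟨h.1.isRootedForest h.2, h.2⟩⟩

open Classical in
-- Groves are grouped by boundary partition; planarity ensures that each such partition is an
-- `NCPartition`.
theorem sum_concordantSet_groveMeasurement (I : KSubset N (2 * (N + 1))) :
    ∑ σ ∈ concordantSet (n := N + 1) I, (Γ.groveMeasurement σ : ℂ) =
      ∑ F : Finset Γ.E with Γ.IsGrove F ∧
        IsConcordantTuple (Γ.boundaryPartition F) (I.1.orderEmbOfFin I.2),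
          ∏ e ∈ F, (Γ.wt e : ℂ) := by
  rw [← Finset.sum_fiberwise_of_maps_to (g := fun F => Γ.ncBoundaryPartition F)
    (t := concordantSet (n := N + 1) I)]
  · refine Finset.sum_congr rfl fun σ hσ => ?_
    have hσ' := (Finset.mem_filter.1 hσ).2
    rw [concordant_iff_isConcordantTuple] at hσ'
    unfold groveMeasurement
    push_cast
    rw [Finset.filter_filter]
    refine Finset.sum_congr (Finset.filter_congr fun F _ => ?_) fun _ _ => rfl
    constructor
    · rintro ⟨h1, h2⟩
      exact ⟨⟨h1, by rw [h2]; exact hσ'⟩, Subtype.ext h2⟩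
    · rintro ⟨⟨h1, -⟩, h2⟩
      exact ⟨h1, congrArg Subtype.val h2⟩
  · intro F hF
    refine Finset.mem_filter.2 ⟨Finset.mem_univ _, ?_⟩
    rw [concordant_iff_isConcordantTuple]
    exact (Finset.mem_filter.1 hF).2.2

/-- Up to the common sign `c` the concordant sums are the determinants of `networkMatrix` at
increasing tuples, whose tuple sign is 1. The zero locus also covers a vanishing grove vector. -/
theorem sum_concordantSet_mem_zeroLocus (Γ : ElectricalNetwork (N + 1)) :
    (fun I : KSubset N (2 * (N + 1)) =>
      ∑ σ ∈ concordantSet (n := N + 1) I, (Γ.groveMeasurement σ : ℂ)) ∈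
      MvPolynomial.zeroLocus ℂ (pluckerIdeal N (2 * (N + 1))) := by
  classical
  set c : ℂ := ∏ k : Fin N, (-1) ^ ((k : ℕ) + 1) with hc
  have hcc : c * c = 1 := by
    rw [hc, ← Finset.prod_mul_distrib]
    exact Finset.prod_eq_one fun k _ => by rw [← mul_pow]; simp
  convert (Γ.isPluckerFunction_det_networkMatrix.const_mul c).mem_zeroLocus
    (by omega : N ≤ 2 * (N + 1)) using 2 with I
  rw [det_networkMatrix (I.1.orderEmbOfFin I.2).injective, sum_concordantSet_groveMeasurement,
    tupleSign_of_strictMono (OrderEmbedding.strictMono _), Int.cast_one, mul_one, ← mul_assoc, hcc,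
    one_mul]

end GroveVector

end ElectricalNetwork

/-! ### The embedding -/

section Embedding

open MvPolynomial

variable {N : ℕ}

/-- The linear map that sends a grove vector to the vector of its concordant sums. -/
noncomputable def concordantSum (N : ℕ) :
    (NCPartition (N + 1) → ℂ) →ₗ[ℂ] (KSubset N (2 * (N + 1)) → ℂ) where
  toFun v I := ∑ σ ∈ concordantSet (n := N + 1) I, v σ
  map_add' v w := funext fun I => Finset.sum_add_distrib
  map_smul' c v := funext fun I => by simp [Finset.mul_sum]

theorem concordantSum_apply (v : NCPartition (N + 1) → ℂ) (I : KSubset N (2 * (N + 1))) :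
    concordantSum N v I = ∑ σ ∈ concordantSet (n := N + 1) I, v σ := rfl

theorem concordantSum_injective : Function.Injective (concordantSum N) := by
  rw [injective_iff_map_eq_zero]
  exact fun v hv => eq_zero_of_sum_concordantSet_eq_zero v fun I => congrFun hv I

/-- The substitution of the concordant sums into the Plücker coordinates. -/
noncomputable def concordantSubst (N : ℕ) : MvPolynomial (KSubset N (2 * (N + 1))) ℂ →ₐ[ℂ]
    MvPolynomial (NCPartition (N + 1)) ℂ :=
  aeval fun I => ∑ σ ∈ concordantSet (n := N + 1) I, X σ

theorem aeval_concordantSubst (v : NCPartition (N + 1) → ℂ)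
    (f : MvPolynomial (KSubset N (2 * (N + 1))) ℂ) :
    aeval v (concordantSubst N f) = aeval (concordantSum N v) f := by
  rw [concordantSubst, comp_aeval_apply]
  congr 2
  funext I
  rw [map_sum, concordantSum_apply]
  simp

theorem concordantSubst_mem {f : MvPolynomial (KSubset N (2 * (N + 1))) ℂ}
    (hf : f ∈ pluckerIdeal N (2 * (N + 1))) : concordantSubst N f ∈ groveIdeal (N + 1) := by
  rintro _ ⟨Γ, rfl⟩
  rw [aeval_concordantSubst]
  exact Γ.sum_concordantSet_mem_zeroLocus f hf

/-- The homomorphism from the Plücker ring to the grove algebra. -/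
noncomputable def concordantHom (N : ℕ) : PluckerRing N (2 * (N + 1)) →ₐ[ℂ] GroveAlgebra (N + 1) :=
  Ideal.quotientMapₐ (groveIdeal (N + 1)) (concordantSubst N) fun _ hf => concordantSubst_mem hf

theorem concordantHom_mk (f : MvPolynomial (KSubset N (2 * (N + 1))) ℂ) :
    concordantHom N (Ideal.Quotient.mk _ f) = Ideal.Quotient.mk _ (concordantSubst N f) := rfl

theorem concordantHom_pluckerCoord (I : KSubset N (2 * (N + 1))) :
    concordantHom N (pluckerCoord I) = ∑ σ ∈ concordantSet (n := N + 1) I, groveCoord σ := by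
  rw [pluckerCoord, concordantHom_mk, concordantSubst, aeval_X, map_sum]
  rfl

theorem concordantHom_mem {d : ℕ} {x : PluckerRing N (2 * (N + 1))}
    (hx : x ∈ pluckerPiece N (2 * (N + 1)) d) : concordantHom N x ∈ grovePiece (N + 1) d := by
  obtain ⟨f, hf, rfl⟩ := hx
  refine ⟨concordantSubst N f, ?_, rfl⟩
  have h := IsHomogeneous.aeval (φ := f) hf
    (fun I => ∑ σ ∈ concordantSet (n := N + 1) I, (X σ : MvPolynomial (NCPartition (N + 1)) ℂ))
    (n := 1) fun I => IsHomogeneous.sum _ _ _ fun σ _ => isHomogeneous_X ℂ σ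
  rwa [one_mul] at h

/-- A linear left inverse of `concordantSum` writes the coordinate `σ` as a combination of
concordant sums, and the same coefficients work in the grove algebra. -/
theorem groveCoord_mem_range (σ : NCPartition (N + 1)) :
    groveCoord σ ∈ (concordantHom N).range := by
  classical
  obtain ⟨G, hG⟩ := (concordantSum N).exists_leftInverse_of_injective
    (LinearMap.ker_eq_bot.2 concordantSum_injective)
  have key : ∀ v : NCPartition (N + 1) → ℂ,
      v σ = ∑ I, G (Pi.single I 1) σ * ∑ τ ∈ concordantSet (n := N + 1) I, v τ := by
    intro v
    have h1 : G (concordantSum N v) = v := LinearMap.congr_fun hG v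
    conv_lhs => rw [← h1, pi_eq_sum_univ' (concordantSum N v), map_sum, Finset.sum_apply]
    refine Finset.sum_congr rfl fun I _ => ?_
    rw [map_smul, Pi.smul_apply, smul_eq_mul, mul_comm, concordantSum_apply]
  -- Evaluation of `key` at indicator vectors turns it into an identity of coefficients.
  have hcoef : ∀ τ, ∑ I : KSubset N (2 * (N + 1)),
      (if τ ∈ concordantSet (n := N + 1) I then G (Pi.single I 1) σ else 0) =
      if σ = τ then 1 else 0 := by
    intro τ
    refine Eq.trans (Finset.sum_congr rfl fun I _ => ?_) (key fun ρ => if ρ = τ then 1 else 0).symm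
    rw [Finset.sum_ite_eq']
    split_ifs <;> simp
  have hsum : groveCoord σ = ∑ I : KSubset N (2 * (N + 1)),
      G (Pi.single I 1) σ • concordantHom N (pluckerCoord I) := by
    simp only [concordantHom_pluckerCoord, Finset.smul_sum]
    have hite : ∀ I : KSubset N (2 * (N + 1)),
        ∑ τ ∈ concordantSet (n := N + 1) I, G (Pi.single I 1) σ • groveCoord τ =
          ∑ τ, (if τ ∈ concordantSet (n := N + 1) I then G (Pi.single I 1) σ else 0) •
            groveCoord τ := by
      intro I
      rw [← Finset.sum_subset (Finset.subset_univ (concordantSet (n := N + 1) I))]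
      · exact Finset.sum_congr rfl fun τ hτ => by rw [if_pos hτ]
      · exact fun τ _ hτ => by rw [if_neg hτ, zero_smul]
    simp only [hite]
    rw [Finset.sum_comm, Finset.sum_eq_single σ]
    · rw [← Finset.sum_smul, hcoef, if_pos rfl, one_smul]
    · intro τ _ hτ
      rw [← Finset.sum_smul, hcoef, if_neg hτ.symm, zero_smul]
    · simp
  rw [hsum]
  exact Subalgebra.sum_mem _ fun I _ => Subalgebra.smul_mem _ (AlgHom.mem_range_self _ _) _

theorem concordantHom_surjective : Function.Surjective (concordantHom N) := by
  rw [← AlgHom.range_eq_top, eq_top_iff]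
  rintro x -
  obtain ⟨f, rfl⟩ := Ideal.Quotient.mk_surjective x
  have h : (aeval fun σ => (groveCoord σ : GroveAlgebra (N + 1))) =
      Ideal.Quotient.mkₐ ℂ (groveIdeal (N + 1)) := by
    ext σ
    simp [groveCoord]
  have h2 : Ideal.Quotient.mk (groveIdeal (N + 1)) f = aeval groveCoord f :=
    (AlgHom.congr_fun h f).symm
  rw [h2]
  induction f using MvPolynomial.induction_on with
  | C a => rw [aeval_C]; exact Subalgebra.algebraMap_mem _ a
  | add p q hp hq =>
    rw [map_add]
    exact Subalgebra.add_mem _ (hp (AlgHom.congr_fun h p).symm) (hq (AlgHom.congr_fun h q).symm)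
  | mul_X p σ hp =>
    rw [map_mul, aeval_X]
    exact Subalgebra.mul_mem _ (hp (AlgHom.congr_fun h p).symm) (groveCoord_mem_range σ)

theorem exists_gradedAlgHom (N : ℕ) :
    ∃ (_ : GradedAlgebra (pluckerPiece N (2 * (N + 1)))) (_ : GradedAlgebra (grovePiece (N + 1))),
      ∃ ι : pluckerPiece N (2 * (N + 1)) →ₐᵍ[ℂ] grovePiece (N + 1),
        (∀ I : KSubset N (2 * (N + 1)),
          ι (pluckerCoord I) = ∑ σ ∈ concordantSet (n := N + 1) I, groveCoord σ) ∧
        (∀ ι' : PluckerRing N (2 * (N + 1)) →ₐ[ℂ] GroveAlgebra (N + 1),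
          (∀ I : KSubset N (2 * (N + 1)),
            ι' (pluckerCoord I) = ∑ σ ∈ concordantSet (n := N + 1) I, groveCoord σ) →
          ι' = ι.toAlgHom) ∧
        Function.Surjective ι := by
  obtain ⟨i1⟩ := nonempty_gradedAlgebra_pluckerPiece N (2 * (N + 1))
  obtain ⟨i2⟩ := nonempty_gradedAlgebra_grovePiece N
  refine ⟨i1, i2, { concordantHom N with map_mem := fun h => concordantHom_mem h },
    concordantHom_pluckerCoord, fun ι' h => ?_, concordantHom_surjective⟩
  refine Ideal.Quotient.algHom_ext _ (MvPolynomial.algHom_ext fun I => ?_)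
  exact (h I).trans (concordantHom_pluckerCoord I).symm

theorem concordantSum_mem_zeroLocus {v : NCPartition (N + 1) → ℂ}
    (hv : v ∈ zeroLocus ℂ (groveIdeal (N + 1))) :
    concordantSum N v ∈ zeroLocus ℂ (pluckerIdeal N (2 * (N + 1))) := by
  intro f hf
  rw [← aeval_concordantSubst]
  exact hv _ (concordantSubst_mem hf)

/-- The vector of concordant sums of a representative is a nonzero point of the Plücker cone. If two
points have the same subspace, these vectors are proportional, and by injectivity so are the
representatives. -/
theorem exists_injective_groveVariety (N : ℕ) :
    ∃ j : groveVariety (N + 1) → Gr N (2 * (N + 1)), Function.Injective j ∧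
      ∀ (x : groveVariety (N + 1)) (v : NCPartition (N + 1) → ℂ), v ∈ x.1.submodule → v ≠ 0 →
        IsPluckerVector (j x) (fun I => ∑ σ ∈ concordantSet (n := N + 1) I, v σ) := by
  have hrep : ∀ x : groveVariety (N + 1), x.1.rep ∈ x.1.submodule := fun x => by
    rw [Projectivization.submodule_eq]
    exact Submodule.mem_span_singleton_self _
  have hex : ∀ x : groveVariety (N + 1), ∃ W, IsPluckerVector W (concordantSum N x.1.rep) :=
    fun x => exists_isPluckerVector_of_mem_zeroLocus
      (concordantSum_mem_zeroLocus (x.2 (hrep x)))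
      fun h0 => x.1.rep_nonzero (concordantSum_injective (h0.trans (map_zero _).symm))
  choose j hj using hex
  refine ⟨j, fun x y hxy => ?_, fun x v hv hv0 => ?_⟩
  · have hx := hj x
    rw [hxy] at hx
    obtain ⟨c, hc, h⟩ := hx.exists_smul_eq (hj y)
    rw [← map_smul] at h
    have h2 := concordantSum_injective h
    apply Subtype.ext
    rw [← x.1.mk_rep, ← y.1.mk_rep, Projectivization.mk_eq_mk_iff']
    refine ⟨c⁻¹, ?_⟩
    rw [h2, smul_smul, inv_mul_cancel₀ hc, one_smul]
  · rw [Projectivization.submodule_eq, Submodule.mem_span_singleton] at hv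
    obtain ⟨a, rfl⟩ := hv
    have ha : a ≠ 0 := by rintro rfl; exact hv0 (zero_smul _ _)
    obtain ⟨A, hA, c, hc, h⟩ := hj x
    refine ⟨A, hA, a * c, mul_ne_zero ha hc, ?_⟩
    have h2 : concordantSum N (a • x.1.rep) = a • fun I => c * maxMinor A I := by
      rw [map_smul, h]
    refine h2.trans (funext fun I => ?_)
    simp [mul_assoc]

end Embedding

theorem mainTheorem6 (n : ℕ) (hn : 1 ≤ n) :
    (∃ (_ : GradedAlgebra (pluckerPiece (n - 1) (2 * n))) (_ : GradedAlgebra (grovePiece n)),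
      ∃ ι : pluckerPiece (n - 1) (2 * n) →ₐᵍ[ℂ] grovePiece n,
        (∀ I : KSubset (n - 1) (2 * n),
          ι (pluckerCoord I) = ∑ σ ∈ concordantSet I, groveCoord σ) ∧
        (∀ ι' : PluckerRing (n - 1) (2 * n) →ₐ[ℂ] GroveAlgebra n,
          (∀ I : KSubset (n - 1) (2 * n),
            ι' (pluckerCoord I) = ∑ σ ∈ concordantSet I, groveCoord σ) →
          ι' = ι.toAlgHom) ∧
        Function.Surjective ι) ∧
    (∃ j : groveVariety n → Gr (n - 1) (2 * n),
      Function.Injective j ∧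
        ∀ (x : groveVariety n) (v : NCPartition n → ℂ), v ∈ x.1.submodule → v ≠ 0 →
          IsPluckerVector (j x) (fun I => ∑ σ ∈ concordantSet I, v σ)) := by
  obtain ⟨N, rfl⟩ : ∃ N, n = N + 1 := ⟨n - 1, by omega⟩
  exact ⟨exists_gradedAlgHom N, exists_injective_groveVariety N⟩
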